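/- **Setting.** All random variables live on one probability space $(\Omega,\mathcal F,\mathbb P)$. Let $d,N,n\ge 1$ be integers and $\varrho(z)=\max(z,0)$. For $a_1,\dots,a_N\in\mathbb R^d$, $b,w\in\mathbb R^N$ put $H^{a,b}_w(x)=\sum_{i=1}^N w_i\,\varrho(a_i\cdot x+b_i)$. Let $\pi_{\rm b}:\mathbb R\to(0,\infty)$ be a probability density for which there is a polynomial $p_{\rm b}:\mathbb R\to(0,\infty)$ with $1\le p_{\rm b}(z)\pi_{\rm b}(z)$ for all $z\in\mathbb R$. * *Hidden weights.* $A_1,\dots,A_N$ are i.i.d. with the multivariate $t$-distribution $t_\nu(0,\mathbb 1_d)$, i.e. with Lebesgue density $\frac{\Gamma((\nu+d)/2)}{\Gamma(\nu/2)\nu^{d/2}\pi^{d/2}}(1+\nu^{-1}\|x\|^2)^{-(\nu+d)/2}$ on $\mathbb R^d$; $B_1,\dots,B_N$ are i.i.d. with density $\pi_{\rm b}$; $A=(A_i)_i$ and $B=(B_i)_i$ are independent. * *Target.* $H(x)=\mathbb E[\Phi(x+V)]$ for all $x\in\mathbb R^d$, with $\Phi\in L^1(\mathbb R^d)$ and an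 $\mathbb R^d$-valued random vector $V$ with $|\mathbb E[e^{i\xi\cdot V}]|\le e^{-C\|\xi\|^2}$ for all $\xi\in\mathbb R^d$. * *Data.* $D_n=((X_1,Y_1),\dots,(X_n,Y_n))$ consists of i.i.d. $\mathbb R^d\times\mathbb R$-valued random variables, $D_n$ is independent of $(A,B)$, $H(X_1)=\mathbb E[Y_1\mid X_1]$ a.s., $\|X_1\|_\infty\le M$ a.s. and $\mathbb E[|Y_1|^4]<\infty$. The pair $(\bar X,\bar Y)$ has the distribution of $(X_1,Y_1)$ and is independent of $(A,B,D_n)$. * *Estimator.* For $\lambda>0$ let $\mathcal W_\lambda$ be the set of $\sigma(A,B,D_n)$-measurable $W:\Omega\to\mathbb R^N$ with $\|W\|\le\lambda$ a.s. (Euclidean norm), and let $\widehat W_\lambda\in\mathcal W_\lambda$ be any minimizer of $\frac1n\sum_{i=1}^n(H^{A,B}_W(X_i)-Y_i)^2$ over $W\in\mathcal W_\lambda$, i.e. its empirical risk is a.s. at most that of every $W\in\mathcal W_\lambda$. **Theorem.** Let $\pi_{\rm b}$ be as above. There exist $k\in\mathbb N$, depending only on $\pi_{\rm b}$, and, for all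 $\nu>2$, $C>\frac1{2^{3/2}\pi}$ and $M>0$, constants $C_{\rm app},C_{\rm wgt}>0$, depending only on $\nu,\pi_{\rm b},C,M$, as well as, for all $C_{\rm lam}>0$ and every value of $\mathbb E[Y_1^4]$, a constant $C_{\rm est}>0$, depending only on $\nu,\pi_{\rm b},C_{\rm lam},M,\mathbb E[Y_1^4]$ (in particular none of the constants depends on $d,n,N,H$), such that the following holds for all $d,N\ge1$, all hidden weights $(A,B)$ and all targets $H$ as above. (i) There is a $\sigma(A,B)$-measurable $\mathbb R^N$-valued random vector $W$ with $$\mathbb E\Big[\sup_{x\in[-M,M]^d}|H^{A,B}_W(x)-H(x)|\Big]\le\frac{C_{\rm app}\|\Phi\|_{L^1(\mathbb R^d)}(\nu+d)^{k+3}}{\sqrt N},\qquad \|W_i\|_{L^\infty(\mathbb P)}\le\frac{C_{\rm wgt}\|\Phi\|_{L^1(\mathbb R^d)}(\nu+d)^{2k+\frac12}}{N}\quad(i=1,\dots,N).$$ (ii) With the same $k,C_{\rm app},C_{\rm wgt}$: for all $n\ge1$, all data $D_n$ and $(\bar X,\bar Y)$ as above, all $p\ge0$, $C_{\rm lam}>0$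 and $\lambda>0$ with $$\frac{C_{\rm wgt}\|\Phi\|_{L^1(\mathbb R^d)}(\nu+d)^{2k+\frac12}}{\sqrt N}\le\lambda\le\frac{C_{\rm lam}d^p}{\sqrt N},$$ the constrained least-squares estimator satisfies $$\mathbb E\big[|H(\bar X)-H^{A,B}_{\widehat W_\lambda}(\bar X)|^2\big]^{1/2}\le\frac{C_{\rm app}\|\Phi\|_{L^1(\mathbb R^d)}(\nu+d)^{k+3}}{\sqrt N}+\frac{C_{\rm est}\,d^{p+1}}{n^{1/4}}.$$ -/

import Mathlib

open MeasureTheory ProbabilityTheory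

open scoped ENNReal

noncomputable section

namespace RandomFeatures

/-- The density of the multivariate `t`-distribution `t_ν(0, 1_d)` on `ℝ^d`. -/
def studentDensity (d : ℕ) (ν : ℝ) (x : EuclideanSpace ℝ (Fin d)) : ℝ :=
  Real.Gamma ((ν + d) / 2) /
      (Real.Gamma (ν / 2) * ν ^ ((d : ℝ) / 2) * Real.pi ^ ((d : ℝ) / 2)) *
    (1 + ‖x‖ ^ 2 / ν) ^ (-((ν + d) / 2))

/-- The multivariate `t`-distribution `t_ν(0, 1_d)`. -/
def studentMeasure (d : ℕ) (ν : ℝ) : Measure (EuclideanSpace ℝ (Fin d)) :=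
  volume.withDensity fun x => ENNReal.ofReal (studentDensity d ν x)

/-- The function `πb : ℝ → ℝ` is strictly positive and has at most polynomial decay: there is a
polynomial `p`, positive on the real line, with `1 ≤ p z * πb z` for all `z`. -/
structure PolynomialDecay (πb : ℝ → ℝ) : Prop where
  measurable : Measurable πb
  pos : ∀ z, 0 < πb z
  exists_polynomial : ∃ p : Polynomial ℝ, ∀ z, 0 < p.eval z ∧ 1 ≤ p.eval z * πb z

/-- The rectified linear unit. -/
def relu (z : ℝ) : ℝ := max z 0

/-- The one-hidden-layer ReLU network `x ↦ ∑ i, w i * relu (a i ⬝ x + b i)`. -/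
def network {d N : ℕ} (a : Fin N → EuclideanSpace ℝ (Fin d)) (b : Fin N → ℝ)
    (w : EuclideanSpace ℝ (Fin N)) (x : EuclideanSpace ℝ (Fin d)) : ℝ :=
  ∑ i, w i * relu (inner ℝ (a i) x + b i)

/-- The cube `[-M, M]^d`. -/
def cube (d : ℕ) (M : ℝ) : Set (EuclideanSpace ℝ (Fin d)) := {x | ∀ j, |x j| ≤ M}

/-- The empirical mean-square risk of `f` on the sample `D = ((x₁, y₁), …, (xₙ, yₙ))`. -/
def empiricalRisk {d n : ℕ} (D : Fin n → EuclideanSpace ℝ (Fin d) × ℝ)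
    (f : EuclideanSpace ℝ (Fin d) → ℝ) : ℝ :=
  (1 / (n : ℝ)) * ∑ i, (f (D i).1 - (D i).2) ^ 2

section Probability

variable {Ω : Type*} [MeasurableSpace Ω]

/-- The random hidden weights `(A, B)` as one random variable. -/
def hiddenWeights {d N : ℕ} (A : Fin N → Ω → EuclideanSpace ℝ (Fin d)) (B : Fin N → Ω → ℝ)
    (ω : Ω) : (Fin N → EuclideanSpace ℝ (Fin d)) × (Fin N → ℝ) :=
  (fun i => A i ω, fun i => B i ω)

/-- The sample `D_n` as one random variable. -/
def sample {d n : ℕ} (D : Fin n → Ω → EuclideanSpace ℝ (Fin d) × ℝ) (ω : Ω) :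
    Fin n → EuclideanSpace ℝ (Fin d) × ℝ :=
  fun i => D i ω

/-- The σ-algebra `σ(A, B)`. -/
abbrev sigmaWeights {d N : ℕ} (A : Fin N → Ω → EuclideanSpace ℝ (Fin d)) (B : Fin N → Ω → ℝ) :
    MeasurableSpace Ω :=
  MeasurableSpace.comap (hiddenWeights A B) inferInstance

/-- The σ-algebra `σ(A, B, D_n)`. -/
abbrev sigmaWeightsSample {d N n : ℕ} (A : Fin N → Ω → EuclideanSpace ℝ (Fin d))
    (B : Fin N → Ω → ℝ) (D : Fin n → Ω → EuclideanSpace ℝ (Fin d) × ℝ) : MeasurableSpace Ω :=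
  MeasurableSpace.comap (fun ω => (hiddenWeights A B ω, sample D ω)) inferInstance

/-- `A₁, …, A_N` are i.i.d. with distribution `t_ν(0, 1_d)`, `B₁, …, B_N` are i.i.d. with
Lebesgue density `πb`, and `A` and `B` are independent. -/
structure IsHiddenWeights {d N : ℕ} (P : Measure Ω) (ν : ℝ) (πb : ℝ → ℝ)
    (A : Fin N → Ω → EuclideanSpace ℝ (Fin d)) (B : Fin N → Ω → ℝ) : Prop where
  measurable_A : ∀ i, Measurable (A i)
  measurable_B : ∀ i, Measurable (B i)
  law_A : ∀ i, P.map (A i) = studentMeasure d ν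
  law_B : ∀ i, P.map (B i) = volume.withDensity fun z => ENNReal.ofReal (πb z)
  iIndep_A : iIndepFun A P
  iIndep_B : iIndepFun B P
  indep_A_B : IndepFun (fun ω i => A i ω) (fun ω i => B i ω) P

/-- The data points `D i = (X_i, Y_i)` are i.i.d. and independent of the hidden weights. -/
structure IsSample {d N n : ℕ} [NeZero n] (P : Measure Ω)
    (A : Fin N → Ω → EuclideanSpace ℝ (Fin d)) (B : Fin N → Ω → ℝ)
    (D : Fin n → Ω → EuclideanSpace ℝ (Fin d) × ℝ) : Prop where
  measurable : ∀ i, Measurable (D i)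
  iIndep : iIndepFun D P
  ident : ∀ i, P.map (D i) = P.map (D 0)
  indep_weights : IndepFun (hiddenWeights A B) (sample D) P

/-- The test pair `T = (X̄, Ȳ)` has the distribution of `(X₁, Y₁)` and is independent of
`(A, B, D_n)`. -/
structure IsTestPair {d N n : ℕ} [NeZero n] (P : Measure Ω)
    (A : Fin N → Ω → EuclideanSpace ℝ (Fin d)) (B : Fin N → Ω → ℝ)
    (D : Fin n → Ω → EuclideanSpace ℝ (Fin d) × ℝ)
    (T : Ω → EuclideanSpace ℝ (Fin d) × ℝ) : Prop where
  measurable : Measurable T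
  law : P.map T = P.map (D 0)
  indep : IndepFun T (fun ω => (hiddenWeights A B ω, sample D ω)) P

/-- `H` is the regression function of the pair `Z = (X, Y)`: `H(X) = E[Y | X]` almost surely. -/
def IsRegressionFunction {d : ℕ} (P : Measure Ω) (Z : Ω → EuclideanSpace ℝ (Fin d) × ℝ)
    (H : EuclideanSpace ℝ (Fin d) → ℝ) : Prop :=
  (fun ω => H (Z ω).1) =ᵐ[P]
    P[fun ω => (Z ω).2 | MeasurableSpace.comap (fun ω => (Z ω).1) inferInstance]

/-- The class `𝒲_λ` of `σ(A, B, D_n)`-measurable output weights with Euclidean norm almost surely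
at most `lam`. -/
def admissible {d N n : ℕ} (P : Measure Ω)
    (A : Fin N → Ω → EuclideanSpace ℝ (Fin d)) (B : Fin N → Ω → ℝ)
    (D : Fin n → Ω → EuclideanSpace ℝ (Fin d) × ℝ) (lam : ℝ) :
    Set (Ω → EuclideanSpace ℝ (Fin N)) :=
  {W | Measurable[sigmaWeightsSample A B D] W ∧ ∀ᵐ ω ∂P, ‖W ω‖ ≤ lam}

/-- `What` minimizes the empirical risk of the random network over the class `𝒲_λ`. -/
def IsConstrainedLeastSquares {d N n : ℕ} (P : Measure Ω)
    (A : Fin N → Ω → EuclideanSpace ℝ (Fin d)) (B : Fin N → Ω → ℝ)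
    (D : Fin n → Ω → EuclideanSpace ℝ (Fin d) × ℝ) (lam : ℝ)
    (What : Ω → EuclideanSpace ℝ (Fin N)) : Prop :=
  What ∈ admissible P A B D lam ∧
    ∀ W ∈ admissible P A B D lam, ∀ᵐ ω ∂P,
      empiricalRisk (sample D ω) (network (fun i => A i ω) (fun i => B i ω) (What ω)) ≤
        empiricalRisk (sample D ω) (network (fun i => A i ω) (fun i => B i ω) (W ω))

/-- `H(x) = E[Φ(x + V)]` for all `x`, with `Φ ∈ L¹(ℝ^d)` and a random vector `V` whose
characteristic function satisfies `|E[exp(i ξ ⬝ V)]| ≤ exp(-C ‖ξ‖²)`. -/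
structure IsConvolutional {d : ℕ} (P : Measure Ω) (C : ℝ)
    (Φ : EuclideanSpace ℝ (Fin d) → ℝ) (V : Ω → EuclideanSpace ℝ (Fin d))
    (H : EuclideanSpace ℝ (Fin d) → ℝ) : Prop where
  integrable : Integrable Φ
  measurable : Measurable V
  charFun_le : ∀ ξ, ‖charFun (P.map V) ξ‖ ≤ Real.exp (-C * ‖ξ‖ ^ 2)
  eq_integral : ∀ x, H x = ∫ ω, Φ (x + V ω) ∂P

end Probability

end RandomFeatures

end

/-!
The target is a superposition of plane waves. The characteristic function of `V` has Gaussian decay,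
so `V` has a bounded density, and `H(x) = ∫ Ψ(ξ) exp (2πi ξ·x) dξ` with
`‖Ψ(ξ)‖ ≤ ‖Φ‖₁ exp (-4π²C ‖ξ‖²)` (`IsConvolutional.exists_fourier`). On an interval `[-R, R]` the
profile `z ↦ exp (2πiz)` is a superposition of shifted ReLUs with bounded weights and kinks in
`[-R - 1, R]` (`integral_ridgeCoeff_mul_relu`). Hence, on the cube, `H` is the mean of
`h(A, B) relu (A·x + B)` over the law of the hidden weights, where the importance weight `h` is the
density of the superposition divided by the sampling density. Since `4π²C > π`, the Gaussian decay
beats the density of the `t`-distribution by a factor which is exponentially small in the dimension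
(`exp_neg_le_studentDensity`); this absorbs all powers of `d` and `‖a‖`, including those from the
polynomial decay of the bias density, and `h` is bounded by a constant times `‖Φ‖₁` independently of
the dimension, even after multiplication with the size `√d (1 + ‖a‖)` of the features
(`exists_tameWeight_constant`). No power of `ν + d` is lost, and the bounds hold with `k = 0`.

The comparison network has output weights `h(Aᵢ, Bᵢ) / N`. Its uniform error is an empirical process
with i.i.d. summands; symmetrization (`integral_sup'_deviation_le`) and the contraction principle
(`sum_signs_sup'_abs_contraction`) reduce it to Rademacher averages of linear functions, which are of
order `√N` (`IsTameWeight.lintegral_iSup_le`). At one point of the cube the mean square error is a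
variance (`IsTameWeight.lintegral_sq_sub_le`).

For constrained least squares, the hidden weights are fixed first, which independence permits. The
prediction error `network - Y` of a network is affine in the response and in the ReLU features with
their value at the origin subtracted; the remaining constant is the value of the network at the
origin. The risk minus the empirical risk is therefore a quadratic form in the coefficients, bounded
uniformly over the coefficients by the squared empirical deviations of the features and of their
products (`integral_sq_le_empirical`), whose means are of order `1 / n` (`integral_linDev_le`,
`integral_quadDev_le`). The biases need not have any moment, but a network with a large value at the
origin would have a larger empirical risk than the zero network (`sq_origin_le`). With the
minimising property against the comparison network this gives
`IsRegressionLaw.lintegral_excess_le`: the excess risk is at most that of the comparison network plus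
`n ^ (-1/2)` times the squared size of the features. Integration over the hidden weights uses the
second moment of the `t`-distribution, where `ν > 2` enters, and yields
`IsConstrainedLeastSquares.lintegral_sq_le`; square roots give the rate.
-/

noncomputable section

namespace RandomFeatures

/-! ### Fourier representation of convolutional targets -/

section FourierDensity

open Filter Topology FourierTransform RealInnerProductSpace

variable {E : Type*} [NormedAddCommGroup E] [InnerProductSpace ℝ E]

/-- The isotropic Gaussian kernel arising as the Fourier transform of `exp (-c⁻¹ ‖·‖²)`. -/
def gaussKernel (c : ℝ) (v : E) : ℝ :=
  (Real.pi * c) ^ (Module.finrank ℝ E / 2 : ℝ) * Real.exp (-Real.pi ^ 2 * c * ‖v‖ ^ 2)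

lemma gaussKernel_nonneg {c : ℝ} (hc : 0 < c) (v : E) : 0 ≤ gaussKernel c v := by
  unfold gaussKernel; positivity

variable [MeasurableSpace E]

/-- The characteristic function in the normalisation of the Fourier transform,
`ξ ↦ ∫ exp (-2πi ⟪v, ξ⟫) dμ(v)`. -/
def measureFourier (μ : Measure E) (ξ : E) : ℂ := charFun μ (-(2 * Real.pi) • ξ)

lemma measureFourier_eq (μ : Measure E) :
    measureFourier μ = VectorFourier.fourierIntegral Real.fourierChar μ (innerₗ E) 1 := by
  ext ξ
  rw [measureFourier, charFun_eq_fourierIntegral', smul_smul]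
  congr 1
  have : -(2 * Real.pi)⁻¹ * (-(2 * Real.pi)) = 1 := by
    field_simp
  rw [this, one_smul]

variable [BorelSpace E]

lemma continuous_measureFourier (μ : Measure E) [IsProbabilityMeasure μ] :
    Continuous (measureFourier μ) := by
  rw [measureFourier_eq]
  exact VectorFourier.fourierIntegral_continuous Real.continuous_fourierChar
    (by exact continuous_inner) (integrable_const _)

variable [FiniteDimensional ℝ E]

lemma integral_gaussKernel {c : ℝ} (hc : 0 < c) : ∫ v : E, gaussKernel c v = 1 := by
  have hpi := Real.pi_pos
  unfold gaussKernel
  have h := GaussianFourier.integral_rexp_neg_mul_sq_norm (V := E) (b := Real.pi ^ 2 * c)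
    (by positivity)
  have h2 : ∀ v : E, Real.exp (-Real.pi ^ 2 * c * ‖v‖ ^ 2)
      = Real.exp (-(Real.pi ^ 2 * c) * ‖v‖ ^ 2) := fun v => by ring_nf
  simp_rw [h2]
  rw [integral_const_mul, h, ← Real.mul_rpow (by positivity) (by positivity)]
  have : Real.pi * c * (Real.pi / (Real.pi ^ 2 * c)) = 1 := by field_simp
  rw [this, Real.one_rpow]

lemma lintegral_gaussKernel {c : ℝ} (hc : 0 < c) :
    ∫⁻ v : E, ENNReal.ofReal (gaussKernel c v) = 1 := by
  -- a function with nonzero Bochner integral is integrable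
  have hint : Integrable (gaussKernel (E := E) c) := by
    by_contra h
    have := integral_gaussKernel (E := E) hc
    rw [integral_undef h] at this
    norm_num at this
  rw [← ofReal_integral_eq_lintegral_ofReal hint (ae_of_all _ (gaussKernel_nonneg hc)),
    integral_gaussKernel hc, ENNReal.ofReal_one]

/-- The Gaussian regularisation of the inverse Fourier integral of `measureFourier μ` is the
convolution of `μ` with a Gaussian kernel. -/
lemma integral_regularised_eq (μ : Measure E) [IsProbabilityMeasure μ] {c : ℝ} (hc : 0 < c)
    (v : E) :
    ∫ ξ : E, Complex.exp (-(c : ℂ)⁻¹ * ‖ξ‖ ^ 2) • (Real.fourierChar ⟪ξ, v⟫ • measureFourier μ ξ)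
      = ((∫ w, gaussKernel c (v - w) ∂μ : ℝ) : ℂ) := by
  have J : Integrable (fun w : E ↦ Complex.exp (- (c : ℂ)⁻¹ * ‖w‖ ^ 2
      + 2 * Real.pi * Complex.I * ⟪v, w⟫)) :=
    GaussianFourier.integrable_cexp_neg_mul_sq_norm_add (by simpa) _ _
  have key := VectorFourier.integral_fourierIntegral_smul_eq_flip (L := innerₗ E) (μ := μ)
    (ν := (volume : Measure E)) (f := (1 : E → ℂ)) (F := ℂ)
    Real.continuous_fourierChar (by exact continuous_inner) (integrable_const _) J
  rw [← measureFourier_eq] at key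
  rw [← integral_complex_ofReal]
  convert key using 1
  · congr 1; ext ξ
    rw [Circle.smul_def, Real.fourierChar_apply, smul_eq_mul, smul_eq_mul, smul_eq_mul,
      Complex.exp_add, real_inner_comm]
    push_cast
    ring_nf
  · congr 1; ext w
    have h1 : VectorFourier.fourierIntegral Real.fourierChar volume (innerₗ E).flip
        (fun w : E ↦ Complex.exp (- (c : ℂ)⁻¹ * ‖w‖ ^ 2
          + 2 * Real.pi * Complex.I * ⟪v, w⟫)) w
        = 𝓕 (fun w : E ↦ Complex.exp (- (c : ℂ)⁻¹ * ‖w‖ ^ 2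
          + 2 * Real.pi * Complex.I * ⟪v, w⟫)) w := by
      rw [flip_innerₗ]; rfl
    rw [h1, fourier_gaussian_innerProductSpace' (by simpa)]
    simp only [gaussKernel, Pi.one_apply, smul_eq_mul, one_mul, div_inv_eq_mul]
    push_cast
    congr 1
    rw [Complex.ofReal_cpow (by positivity)]
    · push_cast; rfl
    · congr 1; ring

lemma tendsto_gaussian_convolution (μ : Measure E) [IsProbabilityMeasure μ]
    (hμ : Integrable (measureFourier μ)) (v : E) :
    Tendsto (fun c : ℝ => ((∫ w, gaussKernel c (v - w) ∂μ : ℝ) : ℂ)) atTop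
      (𝓝 (𝓕⁻ (measureFourier μ) v)) := by
  have hint : Integrable (fun ξ : E => Real.fourierChar ⟪ξ, v⟫ • measureFourier μ ξ) := by
    refine hμ.norm.mono' ?_ (ae_of_all _ fun ξ => by simp)
    have := continuous_measureFourier μ
    have h2 := Real.continuous_fourierChar
    exact Continuous.aestronglyMeasurable (by fun_prop)
  have h := Real.tendsto_integral_cexp_sq_smul hint
  rw [Real.fourierInv_eq]
  refine h.congr' ?_
  filter_upwards [Ioi_mem_atTop 0] with c (hc : 0 < c)
  rw [← integral_regularised_eq μ hc v, Complex.ofReal_inv]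

/-- The inverse Fourier integral of `measureFourier μ` is real and nonnegative, as a limit of
convolutions of `μ` with Gaussian kernels. -/
lemma fourierInv_measureFourier_eq_re (μ : Measure E) [IsProbabilityMeasure μ]
    (hμ : Integrable (measureFourier μ)) (v : E) :
    𝓕⁻ (measureFourier μ) v = ((𝓕⁻ (measureFourier μ) v).re : ℂ)
      ∧ 0 ≤ (𝓕⁻ (measureFourier μ) v).re
      ∧ Tendsto (fun c : ℝ => ∫ w, gaussKernel c (v - w) ∂μ) atTop
        (𝓝 (𝓕⁻ (measureFourier μ) v).re) := by
  have h := tendsto_gaussian_convolution μ hμ v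
  have hre := (Complex.continuous_re.tendsto _).comp h
  have him := (Complex.continuous_im.tendsto _).comp h
  simp only [Function.comp_def, Complex.ofReal_re, Complex.ofReal_im] at hre him
  have h0 : (𝓕⁻ (measureFourier μ) v).im = 0 := (tendsto_nhds_unique him tendsto_const_nhds)
  refine ⟨Complex.ext (by simp) (by simp [h0]), ?_, hre⟩
  refine ge_of_tendsto hre ?_
  filter_upwards [Ioi_mem_atTop 0] with c (hc : 0 < c)
  exact integral_nonneg fun w => gaussKernel_nonneg hc _

/-- The inverse Fourier integral of `measureFourier μ` is integrable: by Fatou's lemma along the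
Gaussian regularisations, each of which has mass one. -/
lemma integrable_fourierInv_measureFourier (μ : Measure E) [IsProbabilityMeasure μ]
    (hμ : Integrable (measureFourier μ)) : Integrable (𝓕⁻ (measureFourier μ)) := by
  have hcont : Continuous (𝓕⁻ (measureFourier μ)) :=
    VectorFourier.fourierIntegral_continuous Real.continuous_fourierChar
      (by exact continuous_inner.neg) hμ
  refine ⟨hcont.aestronglyMeasurable, ?_⟩
  have hmeas : ∀ c : ℝ, Measurable (fun p : E × E => ENNReal.ofReal (gaussKernel c (p.1 - p.2))) := by
    intro c; unfold gaussKernel; fun_prop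
  have hFatou : ∫⁻ v, ENNReal.ofReal (𝓕⁻ (measureFourier μ) v).re ≤ 1 := by
    calc ∫⁻ v, ENNReal.ofReal (𝓕⁻ (measureFourier μ) v).re
        ≤ ∫⁻ v, liminf (fun n : ℕ =>
            ∫⁻ w, ENNReal.ofReal (gaussKernel ((n : ℝ) + 1) (v - w)) ∂μ) atTop := by
          refine lintegral_mono fun v => ?_
          have ht := (fourierInv_measureFourier_eq_re μ hμ v).2.2.comp
            (tendsto_atTop_add_const_right atTop (1 : ℝ) tendsto_natCast_atTop_atTop)
          have ht2 := (ENNReal.continuous_ofReal.tendsto _).comp ht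
          rw [← ht2.liminf_eq]
          refine le_of_eq ?_
          congr 1; ext n
          have hn : (0 : ℝ) < n + 1 := by positivity
          simp only [Function.comp]
          refine ofReal_integral_eq_lintegral_ofReal ?_
            (ae_of_all _ fun w => gaussKernel_nonneg hn _)
          refine Integrable.of_bound (C := (Real.pi * ((n : ℝ) + 1)) ^ (Module.finrank ℝ E / 2 : ℝ))
            ?_ (ae_of_all _ fun w => ?_)
          · unfold gaussKernel
            exact Continuous.aestronglyMeasurable (by fun_prop)
          · rw [Real.norm_eq_abs, abs_of_nonneg (gaussKernel_nonneg hn _)]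
            unfold gaussKernel
            refine mul_le_of_le_one_right (by positivity) (Real.exp_le_one_iff.2 ?_)
            have : 0 ≤ Real.pi ^ 2 * ((n : ℝ) + 1) * ‖v - w‖ ^ 2 := by positivity
            linarith
      _ ≤ liminf (fun n : ℕ => ∫⁻ v,
            ∫⁻ w, ENNReal.ofReal (gaussKernel ((n : ℝ) + 1) (v - w)) ∂μ) atTop := by
          refine lintegral_liminf_le fun n => ?_
          exact (hmeas _).lintegral_prod_right'
      _ = 1 := by
          have : ∀ n : ℕ, ∫⁻ v : E,
              ∫⁻ w, ENNReal.ofReal (gaussKernel ((n : ℝ) + 1) (v - w)) ∂μ = 1 := by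
            intro n
            rw [lintegral_lintegral_swap (hmeas _).aemeasurable]
            have : ∀ w : E, ∫⁻ v : E, ENNReal.ofReal (gaussKernel ((n : ℝ) + 1) (v - w)) = 1 := by
              intro w
              rw [lintegral_sub_right_eq_self (fun v : E =>
                ENNReal.ofReal (gaussKernel ((n : ℝ) + 1) v)) w]
              exact lintegral_gaussKernel (by positivity)
            simp [this]
          simp [this]
  refine lt_of_le_of_lt ?_ ENNReal.one_lt_top
  refine le_trans (le_of_eq ?_) hFatou
  refine lintegral_congr fun v => ?_
  obtain ⟨h1, h2, -⟩ := fourierInv_measureFourier_eq_re μ hμ v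
  rw [h1, ← ofReal_norm, Complex.norm_real, Real.norm_eq_abs, Complex.ofReal_re, abs_of_nonneg h2]

/-- A probability measure with integrable characteristic function has the inverse Fourier
integral of that function as its Lebesgue density. -/
lemma eq_withDensity_fourierInv (μ : Measure E) [IsProbabilityMeasure μ]
    (hμ : Integrable (measureFourier μ)) :
    μ = volume.withDensity (fun v => ENNReal.ofReal (𝓕⁻ (measureFourier μ) v).re) := by
  have hq := integrable_fourierInv_measureFourier μ hμ
  have hfin : IsFiniteMeasure
      (volume.withDensity (fun v => ENNReal.ofReal (𝓕⁻ (measureFourier μ) v).re)) :=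
    isFiniteMeasure_withDensity_ofReal hq.re.2
  have hcont : Continuous (𝓕⁻ (measureFourier μ)) :=
    VectorFourier.fourierIntegral_continuous Real.continuous_fourierChar
      (by exact continuous_inner.neg) hμ
  have hinv := (continuous_measureFourier μ).fourier_fourierInv_eq hμ (by
    have : 𝓕 (measureFourier μ) = fun v => 𝓕⁻ (measureFourier μ) (-v) := by
      ext v; rw [Real.fourierInv_eq_fourier_neg]; simp
    rw [this]
    exact hq.comp_neg)
  have hF : measureFourier μ = measureFourier (volume.withDensity
      (fun v => ENNReal.ofReal (𝓕⁻ (measureFourier μ) v).re)) := by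
    conv_lhs => rw [← hinv]
    ext ξ
    rw [measureFourier_eq (volume.withDensity _), Real.fourier_eq]
    change _ = ∫ v, Real.fourierChar (-⟪v, ξ⟫) • (1 : E → ℂ) v ∂_
    rw [integral_withDensity_eq_integral_toReal_smul (by fun_prop) (by simp)]
    congr 1; ext v
    obtain ⟨h1, h2, -⟩ := fourierInv_measureFourier_eq_re μ hμ v
    rw [ENNReal.toReal_ofReal h2]
    conv_lhs => rw [h1]
    simp [Circle.smul_def, mul_comm]
  refine Measure.ext_of_charFun ?_
  ext t
  have := congrFun hF (-(2 * Real.pi)⁻¹ • t)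
  simp only [measureFourier, smul_smul] at this
  have h1 : (-(2 * Real.pi)) * (-(2 * Real.pi)⁻¹) = 1 := by field_simp
  rwa [h1, one_smul] at this

/-- The mean of translates of an integrable function, as a Fourier integral. -/
lemma integral_translate_eq_fourier (μ : Measure E) [IsProbabilityMeasure μ]
    (hμ : Integrable (measureFourier μ)) (Φ : E → ℝ) (hΦ : Integrable Φ) (x : E) :
    ((∫ v, Φ (x + v) ∂μ : ℝ) : ℂ)
      = 𝓕 (fun ξ => measureFourier μ ξ * 𝓕⁻ (fun y => (Φ y : ℂ)) ξ) x := by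
  have hcont : Continuous (𝓕⁻ (measureFourier μ)) :=
    VectorFourier.fourierIntegral_continuous Real.continuous_fourierChar
      (by exact continuous_inner.neg) hμ
  have hg : Integrable (fun ξ => (Real.fourierChar (-⟪ξ, x⟫) : ℂ) * measureFourier μ ξ) := by
    refine hμ.norm.mono' ?_ (ae_of_all _ fun ξ => by
      rw [norm_mul, Circle.norm_coe, one_mul])
    have := continuous_measureFourier μ
    have h2 := Real.continuous_fourierChar
    exact Continuous.aestronglyMeasurable (by fun_prop)
  have key := VectorFourier.integral_fourierIntegral_smul_eq_flip (L := -innerₗ E)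
    (μ := (volume : Measure E)) (ν := (volume : Measure E)) (f := fun y => (Φ y : ℂ)) (F := ℂ)
    Real.continuous_fourierChar (by exact continuous_inner.neg) hΦ.ofReal hg
  have hl : 𝓕 (fun ξ => measureFourier μ ξ * 𝓕⁻ (fun y => (Φ y : ℂ)) ξ) x
      = ∫ ξ : E, VectorFourier.fourierIntegral Real.fourierChar volume (-innerₗ E)
        (fun y => (Φ y : ℂ)) ξ • ((Real.fourierChar (-⟪ξ, x⟫) : ℂ) * measureFourier μ ξ) := by
    rw [Real.fourier_eq]
    congr 1; ext ξ
    rw [Circle.smul_def, smul_eq_mul, smul_eq_mul]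
    have : 𝓕⁻ (fun y => (Φ y : ℂ)) ξ = VectorFourier.fourierIntegral Real.fourierChar volume
        (-innerₗ E) (fun y => (Φ y : ℂ)) ξ := rfl
    rw [this]; ring
  rw [hl, key, ← integral_complex_ofReal]
  conv_lhs => rw [eq_withDensity_fourierInv μ hμ]
  rw [integral_withDensity_eq_integral_toReal_smul (by fun_prop) (by simp)]
  conv_rhs => rw [← integral_add_left_eq_self _ x]
  congr 1; ext v
  obtain ⟨h1, h2, -⟩ := fourierInv_measureFourier_eq_re μ hμ v
  rw [ENNReal.toReal_ofReal h2]
  have h3 : VectorFourier.fourierIntegral Real.fourierChar volume (-innerₗ E).flip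
      (fun ξ => (Real.fourierChar (-⟪ξ, x⟫) : ℂ) * measureFourier μ ξ) (x + v)
      = 𝓕⁻ (measureFourier μ) v := by
    rw [Real.fourierInv_eq]
    change ∫ ξ, Real.fourierChar (-(((-innerₗ E).flip ξ) (x + v)))
      • ((Real.fourierChar (-⟪ξ, x⟫) : ℂ) * measureFourier μ ξ) = _
    congr 1; ext ξ
    have : (-(((-innerₗ E).flip ξ) (x + v)) : ℝ) = ⟪ξ, x⟫ + ⟪ξ, v⟫ := by
      simp [real_inner_comm]
    rw [this, AddChar.map_add_eq_mul, AddChar.map_neg_eq_inv, Circle.smul_def,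
      Circle.smul_def]
    simp only [Circle.coe_mul, smul_eq_mul, Circle.coe_inv]
    have := Circle.coe_ne_zero (Real.fourierChar ⟪ξ, x⟫)
    field_simp
  rw [h3]
  conv_rhs => rw [h1]
  simp [mul_comm]

end FourierDensity

/-- A convolutional target is the superposition of plane waves whose amplitude has
Gaussian decay. -/
lemma IsConvolutional.exists_fourier {Ω : Type*} [MeasurableSpace Ω] {P : Measure Ω}
    [IsProbabilityMeasure P] {d : ℕ} {C : ℝ} (hC : 0 < C)
    {Φ : EuclideanSpace ℝ (Fin d) → ℝ} {V : Ω → EuclideanSpace ℝ (Fin d)}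
    {H : EuclideanSpace ℝ (Fin d) → ℝ} (h : IsConvolutional P C Φ V H) :
    ∃ Ψ : EuclideanSpace ℝ (Fin d) → ℂ, Continuous Ψ ∧ Integrable Ψ ∧ Continuous H ∧
      (∀ ξ, ‖Ψ ξ‖ ≤ (∫ x, |Φ x|) * Real.exp (-(4 * Real.pi ^ 2 * C) * ‖ξ‖ ^ 2)) ∧
      ∀ x, (H x : ℂ) = ∫ ξ, Ψ ξ * Complex.exp (2 * Real.pi * (inner ℝ ξ x : ℝ) * Complex.I) := by
  have hpi := Real.pi_pos
  have hprob : IsProbabilityMeasure (P.map V) :=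
    Measure.isProbabilityMeasure_map h.measurable.aemeasurable
  have hbd : ∀ ξ, ‖measureFourier (P.map V) ξ‖ ≤ Real.exp (-(4 * Real.pi ^ 2 * C) * ‖ξ‖ ^ 2) := by
    intro ξ
    refine (h.charFun_le _).trans (le_of_eq ?_)
    rw [norm_smul, Real.norm_eq_abs, abs_neg, abs_of_pos (by positivity)]
    congr 1; ring
  have hgauss : Integrable (fun ξ : EuclideanSpace ℝ (Fin d) =>
      Real.exp (-(4 * Real.pi ^ 2 * C) * ‖ξ‖ ^ 2)) := by
    have := GaussianFourier.integral_rexp_neg_mul_sq_norm (V := EuclideanSpace ℝ (Fin d))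
      (b := 4 * Real.pi ^ 2 * C) (by positivity)
    by_contra hn
    rw [integral_undef hn] at this
    have h2 : (0 : ℝ) < (Real.pi / (4 * Real.pi ^ 2 * C)) ^
      ((Module.finrank ℝ (EuclideanSpace ℝ (Fin d)) : ℝ) / 2) := by positivity
    linarith
  have hcF := continuous_measureFourier (P.map V)
  have hμ : Integrable (measureFourier (P.map V)) :=
    hgauss.mono' hcF.aestronglyMeasurable (ae_of_all _ hbd)
  set G : EuclideanSpace ℝ (Fin d) → ℂ := fun ξ =>
    measureFourier (P.map V) ξ * FourierTransformInv.fourierInv (fun y => (Φ y : ℂ)) ξ with hG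
  have hcInv : Continuous (FourierTransformInv.fourierInv (fun y => (Φ y : ℂ))) :=
    VectorFourier.fourierIntegral_continuous Real.continuous_fourierChar
      (by exact continuous_inner.neg) h.integrable.ofReal
  have hGc : Continuous G := hcF.mul hcInv
  have hGb : ∀ ξ, ‖G ξ‖ ≤ (∫ x, |Φ x|) * Real.exp (-(4 * Real.pi ^ 2 * C) * ‖ξ‖ ^ 2) := by
    intro ξ
    rw [hG, norm_mul, mul_comm]
    refine mul_le_mul ?_ (hbd ξ) (norm_nonneg _) (integral_nonneg fun _ => abs_nonneg _)
    refine (VectorFourier.norm_fourierIntegral_le_integral_norm _ _ _ _ _).trans (le_of_eq ?_)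
    simp
  have hGi : Integrable G := (hgauss.const_mul _).mono' hGc.aestronglyMeasurable (ae_of_all _ hGb)
  have hH : ∀ x, (H x : ℂ) = FourierTransform.fourier G x := by
    intro x
    rw [h.eq_integral, ← integral_translate_eq_fourier (P.map V) hμ Φ h.integrable x]
    congr 1
    symm
    refine integral_map h.measurable.aemeasurable ?_
    -- `Φ` is only almost everywhere equal to a measurable function, but `V` has a density
    have hac : P.map V ≪ volume := by
      rw [eq_withDensity_fourierInv (P.map V) hμ]
      exact withDensity_absolutelyContinuous _ _
    exact (h.integrable.comp_add_left x).aestronglyMeasurable.mono_ac hac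
  refine ⟨fun ξ => G (-ξ), hGc.comp continuous_neg, hGi.comp_neg, ?_, fun ξ => ?_, fun x => ?_⟩
  · have : Continuous fun x => (FourierTransform.fourier G x).re :=
      Complex.continuous_re.comp (VectorFourier.fourierIntegral_continuous
        Real.continuous_fourierChar (by exact continuous_inner) hGi)
    convert this using 2 with x
    rw [← hH, Complex.ofReal_re]
  · simpa using hGb (-ξ)
  · rw [hH, Real.fourier_eq', ← integral_neg_eq_self]
    congr 1; ext ξ
    rw [smul_eq_mul, mul_comm]
    congr 2
    simp

/-! ### Ridge expansion of plane waves in ReLU features -/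

section Ridge

open Complex Set

lemma continuous_relu : Continuous relu := by unfold relu; fun_prop

lemma relu_nonneg (z : ℝ) : 0 ≤ relu z := le_max_right _ _

lemma relu_le_abs (z : ℝ) : relu z ≤ |z| := max_le (le_abs_self z) (abs_nonneg z)

lemma abs_relu_sub_relu_le (s t : ℝ) : |relu s - relu t| ≤ |s - t| :=
  abs_max_sub_max_le_abs s t 0

/-- Coefficient of the ReLU with kink at `u ∈ (-R, R]` in the expansion of the plane wave profile
`z ↦ exp (2πiz)` on `[-R, R]`: its second derivative. -/
def waveCoeff (u : ℝ) : ℂ := -(4 * Real.pi ^ 2 : ℝ) * exp (2 * Real.pi * u * I)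

/-- Coefficient of the ReLU with kink at `u ∈ (-R - 1, -R]`. With `t = -R - u ∈ [0, 1)`, the weight
`12 t - 6` superposes the shifted ReLUs to the constant function `1` on `[-R, ∞)` and
`4 - 6 t` to `z ↦ z + R`; these are combined to the first Taylor polynomial of
`exp (2πiz)` at `z = -R`. -/
def affineCoeff (R u : ℝ) : ℂ :=
  exp (-(2 * Real.pi * R * I)) *
    (((12 * (-R - u) - 6 : ℝ) : ℂ) + 2 * Real.pi * I * ((4 - 6 * (-R - u) : ℝ) : ℂ))

/-- Density of the kinks in the expansion of `exp (2πiz)`, `|z| ≤ R`, as a superposition of shifted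
ReLUs. -/
def ridgeCoeff (R u : ℝ) : ℂ :=
  if -R < u ∧ u ≤ R then waveCoeff u
  else if -R - 1 < u ∧ u ≤ -R then affineCoeff R u else 0

lemma measurable_ridgeCoeff : Measurable fun p : ℝ × ℝ => ridgeCoeff p.1 p.2 := by
  unfold ridgeCoeff waveCoeff affineCoeff
  refine Measurable.ite ?_ (by fun_prop) (Measurable.ite ?_ (by fun_prop) measurable_const)
  · exact (measurableSet_lt measurable_fst.neg measurable_snd).inter
      (measurableSet_le measurable_snd measurable_fst)
  · exact (measurableSet_lt (measurable_fst.neg.sub_const 1) measurable_snd).inter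
      (measurableSet_le measurable_snd measurable_fst.neg)

lemma norm_ridgeCoeff_le (R u : ℝ) : ‖ridgeCoeff R u‖ ≤ 40 := by
  have h1 := Real.pi_pos
  have h2 := Real.pi_lt_d2
  unfold ridgeCoeff
  split_ifs with ha hb
  · unfold waveCoeff
    have : (2 * Real.pi * u * I : ℂ) = ((2 * Real.pi * u : ℝ) : ℂ) * I := by push_cast; ring
    rw [norm_mul, this, norm_exp_ofReal_mul_I, norm_neg, norm_real, Real.norm_eq_abs,
      abs_of_pos (by positivity)]
    nlinarith
  · unfold affineCoeff
    have : (-(2 * Real.pi * R * I) : ℂ) = ((-(2 * Real.pi * R) : ℝ) : ℂ) * I := by push_cast; ring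
    rw [norm_mul, this, norm_exp_ofReal_mul_I, one_mul]
    have e1 : ‖((12 * (-R - u) - 6 : ℝ) : ℂ)‖ ≤ 6 := by
      rw [norm_real, Real.norm_eq_abs, abs_le]; constructor <;> linarith [hb.1, hb.2]
    have e2 : ‖((4 - 6 * (-R - u) : ℝ) : ℂ)‖ ≤ 4 := by
      rw [norm_real, Real.norm_eq_abs, abs_le]; constructor <;> linarith [hb.1, hb.2]
    have e3 : ‖(2 * Real.pi * I : ℂ)‖ = 2 * Real.pi := by
      simp [abs_of_pos h1]
    calc _ ≤ 6 + 2 * Real.pi * 4 := by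
          refine (norm_add_le _ _).trans ?_
          rw [norm_mul, e3]
          gcongr
      _ ≤ 40 := by linarith
  · simp

lemma abs_le_of_ridgeCoeff_ne_zero {R u : ℝ} (hR : 0 ≤ R) (h : ridgeCoeff R u ≠ 0) :
    |u| ≤ R + 1 := by
  unfold ridgeCoeff at h
  rw [abs_le]
  split_ifs at h with ha hb
  · constructor <;> linarith [ha.1, ha.2]
  · constructor <;> linarith [hb.1, hb.2]
  · exact absurd rfl h

/-- Taylor's formula at `-R`, with the remainder in integral form. -/
lemma integral_waveCoeff_mul_relu {R z : ℝ} (hz : |z| ≤ R) :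
    ∫ u in (-R)..R, waveCoeff u * (relu (z - u) : ℂ)
      = exp (2 * Real.pi * z * I) - exp (-(2 * Real.pi * R * I)) * (1 + 2 * Real.pi * I * (z + R)) := by
  obtain ⟨hz1, hz2⟩ := abs_le.1 hz
  have hcont : Continuous fun u : ℝ => waveCoeff u * (relu (z - u) : ℂ) := by
    have := continuous_relu
    unfold waveCoeff
    fun_prop
  rw [← intervalIntegral.integral_add_adjacent_intervals (b := z)
    (hcont.intervalIntegrable _ _) (hcont.intervalIntegrable _ _)]
  have hzero : ∫ u in z..R, waveCoeff u * (relu (z - u) : ℂ) = 0 := by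
    rw [intervalIntegral.integral_congr (g := fun _ => (0 : ℂ)), intervalIntegral.integral_zero]
    intro u hu
    rw [uIcc_of_le hz2] at hu
    have : relu (z - u) = 0 := max_eq_right (by linarith [hu.1])
    simp [this]
  have hwave : ∀ u : ℝ, HasDerivAt
      (fun u : ℝ => ((z - u : ℝ) : ℂ) * (2 * Real.pi * I * exp (2 * Real.pi * u * I))
        + exp (2 * Real.pi * u * I)) (waveCoeff u * ((z - u : ℝ) : ℂ)) u := by
    intro u
    have h1 : HasDerivAt (fun u : ℝ => exp (2 * Real.pi * u * I))
        (exp (2 * Real.pi * u * I) * (2 * Real.pi * I)) u := by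
      have h0 : HasDerivAt (fun u : ℝ => (2 * Real.pi * u * I : ℂ)) (2 * Real.pi * I) u := by
        have := ((hasDerivAt_id u).ofReal_comp.const_mul (2 * Real.pi : ℂ)).mul_const I
        simpa using this
      exact h0.cexp
    have h2 : HasDerivAt (fun u : ℝ => ((z - u : ℝ) : ℂ)) (-1) u := by
      have := ((hasDerivAt_id u).const_sub z).ofReal_comp
      simpa using this
    have h3 := (h2.mul (h1.const_mul (2 * Real.pi * I : ℂ))).add h1
    refine h3.congr_deriv ?_
    unfold waveCoeff
    have hI : (I : ℂ) * I = -1 := I_mul_I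
    push_cast
    linear_combination (4 * Real.pi ^ 2 * exp (2 * Real.pi * u * I) * (z - u) : ℂ) * hI
  have hmain : ∫ u in (-R)..z, waveCoeff u * (relu (z - u) : ℂ)
      = ∫ u in (-R)..z, waveCoeff u * ((z - u : ℝ) : ℂ) := by
    refine intervalIntegral.integral_congr fun u hu => ?_
    rw [uIcc_of_le hz1] at hu
    have : relu (z - u) = z - u := max_eq_left (by linarith [hu.2])
    simp only [this]
  rw [hzero, add_zero, hmain, intervalIntegral.integral_eq_sub_of_hasDerivAt (fun u _ => hwave u)]
  · have : (2 * Real.pi * ((-R : ℝ) : ℂ) * I : ℂ) = -(2 * Real.pi * R * I) := by push_cast; ring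
    rw [this]
    push_cast
    ring
  · refine Continuous.intervalIntegrable ?_ _ _
    unfold waveCoeff; fun_prop

/-- The affine part of Taylor's formula is itself a superposition of ReLUs with kinks to the left of
`-R`. -/
lemma integral_affineCoeff_mul_relu {R z : ℝ} (hz : -R ≤ z) :
    ∫ u in (-R - 1)..(-R), affineCoeff R u * (relu (z - u) : ℂ)
      = exp (-(2 * Real.pi * R * I)) * (1 + 2 * Real.pi * I * (z + R)) := by
  have h1 : ∫ u in (-R - 1)..(-R), affineCoeff R u * (relu (z - u) : ℂ)
      = ∫ t in (0 : ℝ)..1, affineCoeff R (-R - t) * ((z + R + t : ℝ) : ℂ) := by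
    have := intervalIntegral.integral_comp_sub_left (a := 0) (b := 1)
      (fun u : ℝ => affineCoeff R u * (relu (z - u) : ℂ)) (-R)
    rw [sub_zero] at this
    rw [← this]
    refine intervalIntegral.integral_congr fun t ht => ?_
    rw [uIcc_of_le zero_le_one] at ht
    have : relu (z - (-R - t)) = z + R + t := by
      unfold relu; rw [max_eq_left (by linarith [ht.1])]; ring
    simp only [this]
  have hd : ∀ t : ℝ, HasDerivAt
      (fun t : ℝ => exp (-(2 * Real.pi * R * I)) *
        (((4 * t ^ 3 - 3 * t ^ 2 + (z + R) * (6 * t ^ 2 - 6 * t) : ℝ) : ℂ)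
          + 2 * Real.pi * I * ((2 * t ^ 2 - 2 * t ^ 3 + (z + R) * (4 * t - 3 * t ^ 2) : ℝ) : ℂ)))
      (affineCoeff R (-R - t) * ((z + R + t : ℝ) : ℂ)) t := by
    intro t
    have p2 := hasDerivAt_pow 2 t
    have p3 := hasDerivAt_pow 3 t
    have p1 := hasDerivAt_id t
    have a1 : HasDerivAt (fun t : ℝ => 4 * t ^ 3 - 3 * t ^ 2 + (z + R) * (6 * t ^ 2 - 6 * t))
        ((12 * t - 6) * (z + R + t)) t := by
      refine (((p3.const_mul 4).sub (p2.const_mul 3)).add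
        (((p2.const_mul 6).sub (p1.const_mul 6)).const_mul (z + R))).congr_deriv ?_
      norm_num; ring
    have a2 : HasDerivAt (fun t : ℝ => 2 * t ^ 2 - 2 * t ^ 3 + (z + R) * (4 * t - 3 * t ^ 2))
        ((4 - 6 * t) * (z + R + t)) t := by
      refine (((p2.const_mul 2).sub (p3.const_mul 2)).add
        (((p1.const_mul 4).sub (p2.const_mul 3)).const_mul (z + R))).congr_deriv ?_
      norm_num; ring
    refine ((a1.ofReal_comp.add (a2.ofReal_comp.const_mul (2 * Real.pi * I : ℂ))).const_mul
      (exp (-(2 * Real.pi * R * I)))).congr_deriv ?_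
    unfold affineCoeff
    push_cast
    ring
  rw [h1, intervalIntegral.integral_eq_sub_of_hasDerivAt (fun t _ => hd t)]
  · push_cast; ring
  · refine Continuous.intervalIntegrable ?_ _ _
    unfold affineCoeff; fun_prop

/-- A plane wave profile is, on `[-R, R]`, a superposition of shifted ReLUs whose kinks lie in
`[-R - 1, R]` and whose weights are bounded independently of `R`. -/
lemma integral_ridgeCoeff_mul_relu {R z : ℝ} (hz : |z| ≤ R) :
    ∫ u, ridgeCoeff R u * (relu (z - u) : ℂ) = exp (2 * Real.pi * z * I) := by
  have hR : 0 ≤ R := (abs_nonneg z).trans hz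
  have hrelu := continuous_relu
  have h1 : (fun u => ridgeCoeff R u * (relu (z - u) : ℂ))
      = fun u => (Ioc (-R) R).indicator (fun u => waveCoeff u * (relu (z - u) : ℂ)) u
        + (Ioc (-R - 1) (-R)).indicator (fun u => affineCoeff R u * (relu (z - u) : ℂ)) u := by
    ext u
    unfold ridgeCoeff
    simp only [indicator, mem_Ioc]
    by_cases ha : -R < u ∧ u ≤ R
    · have hb : ¬ (-R - 1 < u ∧ u ≤ -R) := fun hb => absurd hb.2 (not_le.2 ha.1)
      simp [ha, hb]
    · by_cases hb : -R - 1 < u ∧ u ≤ -R <;> simp [ha, hb]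
  have i1 : Integrable ((Ioc (-R) R).indicator fun u => waveCoeff u * (relu (z - u) : ℂ)) := by
    rw [integrable_indicator_iff measurableSet_Ioc]
    refine (Continuous.integrableOn_Icc ?_).mono_set Ioc_subset_Icc_self
    unfold waveCoeff; fun_prop
  have i2 : Integrable
      ((Ioc (-R - 1) (-R)).indicator fun u => affineCoeff R u * (relu (z - u) : ℂ)) := by
    rw [integrable_indicator_iff measurableSet_Ioc]
    refine (Continuous.integrableOn_Icc ?_).mono_set Ioc_subset_Icc_self
    unfold affineCoeff; fun_prop
  rw [h1, integral_add i1 i2, integral_indicator measurableSet_Ioc,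
    integral_indicator measurableSet_Ioc,
    ← intervalIntegral.integral_of_le (by linarith),
    ← intervalIntegral.integral_of_le (by linarith),
    integral_waveCoeff_mul_relu hz, integral_affineCoeff_mul_relu (abs_le.1 hz).1]
  ring

end Ridge

/-! ### The multivariate t-density and importance weights -/

section StudentDensity

/-- The lower bound `∫ₓ^∞ e⁻ᵗ tᵅ dt ≥ xᵅ e⁻ˣ` for the Gamma integral. It allows to compare an
exponential with a power, with the normalising Gamma value as the constant. -/
lemma rpow_mul_exp_neg_le_Gamma {α x : ℝ} (hα : 0 < α) (hx : 0 < x) :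
    x ^ α * Real.exp (-x) ≤ Real.Gamma (α + 1) := by
  have hint := Real.GammaIntegral_convergent (s := α + 1) (by linarith)
  rw [Real.Gamma_eq_integral (by linarith)]
  have hsub : Set.Ioi x ⊆ Set.Ioi 0 := Set.Ioi_subset_Ioi hx.le
  calc x ^ α * Real.exp (-x) = ∫ t in Set.Ioi x, x ^ α * Real.exp (-t) := by
        rw [integral_const_mul, integral_exp_neg_Ioi]
    _ ≤ ∫ t in Set.Ioi x, Real.exp (-t) * t ^ (α + 1 - 1) := by
        refine setIntegral_mono_on ((integrableOn_exp_neg_Ioi x).const_mul _)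
          (hint.mono_set hsub) measurableSet_Ioi fun t ht => ?_
        rw [add_sub_cancel_right, mul_comm]
        have : x ≤ t := le_of_lt ht
        gcongr
    _ ≤ ∫ t in Set.Ioi 0, Real.exp (-t) * t ^ (α + 1 - 1) := by
        refine setIntegral_mono_set hint ?_ (hsub.eventuallyLE)
        filter_upwards [self_mem_ae_restrict measurableSet_Ioi] with t ht
        have : (0 : ℝ) < t := ht
        positivity

lemma studentDensity_pos {d : ℕ} {ν : ℝ} (hν : 0 < ν) (x : EuclideanSpace ℝ (Fin d)) :
    0 < studentDensity d ν x := by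
  unfold studentDensity
  have h1 : 0 < Real.Gamma ((ν + d) / 2) := Real.Gamma_pos_of_pos (by positivity)
  have h2 : 0 < Real.Gamma (ν / 2) := Real.Gamma_pos_of_pos (by positivity)
  positivity

lemma measurable_studentDensity (d : ℕ) (ν : ℝ) : Measurable (studentDensity d ν) := by
  unfold studentDensity; fun_prop

/-- A Gaussian is dominated by the density of the `t`-distribution, up to a factor which decays
exponentially in the dimension as soon as `c > π`. -/
lemma exp_neg_le_studentDensity (d : ℕ) {ν c : ℝ} (hν : 0 < ν) (hc : 0 < c)
    (x : EuclideanSpace ℝ (Fin d)) :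
    Real.exp (-c * ‖x‖ ^ 2) ≤ Real.exp (c * ν) * (c * ν) ^ (-(ν / 2)) * Real.Gamma (ν / 2) *
      ((ν + d) / 2) * (Real.pi / c) ^ ((d : ℝ) / 2) * studentDensity d ν x := by
  have hpi := Real.pi_pos
  set α : ℝ := (ν + d) / 2 with hα
  have hαpos : 0 < α := by positivity
  set s : ℝ := 1 + ‖x‖ ^ 2 / ν with hs
  have hspos : 0 < s := by positivity
  -- the power `(1 + ‖x‖² / ν) ^ (-α)` of the density appears at the argument `c ν (1 + ‖x‖² / ν)`
  have hg := rpow_mul_exp_neg_le_Gamma hαpos (x := c * ν * s) (by positivity)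
  have hexp : Real.exp (-c * ‖x‖ ^ 2) = Real.exp (c * ν) * Real.exp (-(c * ν * s)) := by
    rw [← Real.exp_add]; congr 1; rw [hs]; field_simp; ring
  have hG2 : 0 < Real.Gamma (ν / 2) := Real.Gamma_pos_of_pos (by positivity)
  have hGa : 0 < Real.Gamma α := Real.Gamma_pos_of_pos hαpos
  have hsplit : (c * ν) ^ α = (c * ν) ^ (ν / 2) * (c ^ ((d : ℝ) / 2) * ν ^ ((d : ℝ) / 2)) := by
    rw [← Real.mul_rpow hc.le hν.le, ← Real.rpow_add (by positivity), hα]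
    congr 1; ring
  have hbase : Real.exp (-(c * ν * s)) ≤ α * Real.Gamma α / ((c * ν) ^ α * s ^ α) := by
    rw [le_div_iff₀ (by positivity), ← Real.mul_rpow (by positivity) hspos.le,
      ← Real.Gamma_add_one hαpos.ne', mul_comm]
    exact hg
  rw [hexp]
  calc Real.exp (c * ν) * Real.exp (-(c * ν * s))
      ≤ Real.exp (c * ν) * (α * Real.Gamma α / ((c * ν) ^ α * s ^ α)) := by gcongr
    _ = _ := by
        unfold studentDensity
        rw [← hα, ← hs, hsplit, Real.rpow_neg hspos.le, Real.rpow_neg (by positivity),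
          Real.div_rpow hpi.le hc.le]
        field_simp

/-- Powers of the dimension and of the norm are absorbed by a Gaussian of rate `c > π`, relative to
the density of the `t`-distribution. -/
lemma exists_dimension_free_bound (m : ℕ) {ν c : ℝ} (hν : 1 ≤ ν) (hc : Real.pi < c) :
    ∃ K : ℝ, 0 < K ∧ ∀ d : ℕ, 1 ≤ d → ∀ x : EuclideanSpace ℝ (Fin d),
      (Real.sqrt d * (1 + ‖x‖)) ^ m * Real.exp (-c * ‖x‖ ^ 2) ≤ K * studentDensity d ν x := by
  have hpi := Real.pi_pos
  have hνpos : 0 < ν := by linarith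
  -- a part `δ` of the Gaussian rate is spent on the powers of the norm
  set c' : ℝ := (c + Real.pi) / 2 with hc'
  set δ : ℝ := c - c' with hδ
  have hc'pi : Real.pi < c' := by rw [hc']; linarith
  have hc'pos : 0 < c' := by linarith
  have hδpos : 0 < δ := by rw [hδ, hc']; linarith
  set ρ : ℝ := (Real.pi / c') ^ (1 / 2 : ℝ) with hρ
  have hρ0 : 0 ≤ ρ := by positivity
  have hρ1 : ρ < 1 := Real.rpow_lt_one (by positivity) ((div_lt_one hc'pos).2 hc'pi) (by norm_num)
  obtain ⟨K₃, hK₃⟩ := (tendsto_pow_const_mul_const_pow_of_abs_lt_one (m + 1)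
    (by rwa [abs_of_nonneg hρ0] : |ρ| < 1)).bddAbove_range
  have hK₃' : ∀ d : ℕ, (d : ℝ) ^ (m + 1) * ρ ^ d ≤ K₃ := fun d => hK₃ ⟨d, rfl⟩
  set K₁ : ℝ := m.factorial * Real.exp (1 + 1 / (4 * δ)) with hK₁
  have hK₁pos : 0 < K₁ := by positivity
  have hpow : ∀ r : ℝ, 0 ≤ r → (1 + r) ^ m * Real.exp (-δ * r ^ 2) ≤ K₁ := by
    intro r hr
    have h1 : (1 + r) ^ m ≤ m.factorial * Real.exp (1 + r) := by
      have := Real.pow_div_factorial_le_exp (1 + r) (by linarith) m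
      rwa [div_le_iff₀ (by positivity), mul_comm] at this
    have h2 : 1 + r + -δ * r ^ 2 ≤ 1 + 1 / (4 * δ) := by
      have : r - δ * r ^ 2 ≤ 1 / (4 * δ) := by
        rw [le_div_iff₀ (by positivity)]
        nlinarith [sq_nonneg (2 * δ * r - 1)]
      linarith
    calc (1 + r) ^ m * Real.exp (-δ * r ^ 2)
        ≤ m.factorial * Real.exp (1 + r) * Real.exp (-δ * r ^ 2) := by gcongr
      _ = m.factorial * Real.exp (1 + r + -δ * r ^ 2) := by rw [mul_assoc, ← Real.exp_add]
      _ ≤ K₁ := by rw [hK₁]; gcongr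
  set K₂ : ℝ := Real.exp (c' * ν) * (c' * ν) ^ (-(ν / 2)) * Real.Gamma (ν / 2) with hK₂
  have hG2 : 0 < Real.Gamma (ν / 2) := Real.Gamma_pos_of_pos (by positivity)
  have hK₂pos : 0 < K₂ := by positivity
  refine ⟨K₁ * (K₂ * (ν * (|K₃| + 1))), by positivity, fun d hd x => ?_⟩
  have hd' : (1 : ℝ) ≤ d := by exact_mod_cast hd
  have hdim : Real.sqrt d ^ m * ((ν + d) / 2 * (Real.pi / c') ^ ((d : ℝ) / 2))
      ≤ ν * (|K₃| + 1) := by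
    have e1 : Real.sqrt d ^ m ≤ (d : ℝ) ^ m := by
      refine pow_le_pow_left₀ (Real.sqrt_nonneg _) ?_ _
      rw [Real.sqrt_le_left (by linarith)]
      nlinarith
    have e2 : (ν + d) / 2 ≤ ν * d := by nlinarith
    have e3 : (Real.pi / c') ^ ((d : ℝ) / 2) = ρ ^ d := by
      rw [hρ, ← Real.rpow_natCast, ← Real.rpow_mul (by positivity)]; congr 1; ring
    calc Real.sqrt d ^ m * ((ν + d) / 2 * (Real.pi / c') ^ ((d : ℝ) / 2))
        ≤ (d : ℝ) ^ m * (ν * d * ρ ^ d) := by rw [e3]; gcongr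
      _ = ν * ((d : ℝ) ^ (m + 1) * ρ ^ d) := by ring
      _ ≤ ν * (|K₃| + 1) := by
          gcongr
          linarith [hK₃' d, le_abs_self K₃]
  have hst := studentDensity_pos hνpos x
  calc (Real.sqrt d * (1 + ‖x‖)) ^ m * Real.exp (-c * ‖x‖ ^ 2)
      = ((1 + ‖x‖) ^ m * Real.exp (-δ * ‖x‖ ^ 2)) *
        (Real.sqrt d ^ m * Real.exp (-c' * ‖x‖ ^ 2)) := by
        have : -c * ‖x‖ ^ 2 = -δ * ‖x‖ ^ 2 + -c' * ‖x‖ ^ 2 := by rw [hδ]; ring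
        rw [mul_pow, this, Real.exp_add]; ring
    _ ≤ K₁ * (Real.sqrt d ^ m * (K₂ * ((ν + d) / 2) * (Real.pi / c') ^ ((d : ℝ) / 2)
          * studentDensity d ν x)) := by
        gcongr
        · exact hpow _ (norm_nonneg _)
        · exact exp_neg_le_studentDensity d hνpos hc'pos x
    _ = K₁ * (K₂ * (Real.sqrt d ^ m * ((ν + d) / 2 * (Real.pi / c') ^ ((d : ℝ) / 2)))
          * studentDensity d ν x) := by ring
    _ ≤ K₁ * (K₂ * (ν * (|K₃| + 1)) * studentDensity d ν x) := by gcongr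
    _ = K₁ * (K₂ * (ν * (|K₃| + 1))) * studentDensity d ν x := by ring

end StudentDensity

section ImportanceWeight

lemma exists_abs_eval_le (p : Polynomial ℝ) :
    ∃ K : ℝ, 0 < K ∧ ∀ z, |p.eval z| ≤ K * (1 + |z|) ^ p.natDegree := by
  refine ⟨∑ i ∈ Finset.range (p.natDegree + 1), |p.coeff i| + 1, by positivity, fun z => ?_⟩
  rw [Polynomial.eval_eq_sum_range]
  have hz : 1 ≤ 1 + |z| := by linarith [abs_nonneg z]
  calc |∑ i ∈ Finset.range (p.natDegree + 1), p.coeff i * z ^ i|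
      ≤ ∑ i ∈ Finset.range (p.natDegree + 1), |p.coeff i| * (1 + |z|) ^ p.natDegree := by
        refine (Finset.abs_sum_le_sum_abs _ _).trans (Finset.sum_le_sum fun i hi => ?_)
        rw [abs_mul, abs_pow]
        gcongr
        calc |z| ^ i ≤ (1 + |z|) ^ i := by gcongr; linarith
          _ ≤ (1 + |z|) ^ p.natDegree :=
            pow_le_pow_right₀ hz (Nat.lt_succ_iff.1 (Finset.mem_range.1 hi))
    _ ≤ _ := by
        rw [← Finset.sum_mul]
        have : 0 ≤ (1 + |z|) ^ p.natDegree := by positivity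
        nlinarith

/-- The output weight attached to the hidden weights `(a, b)` by importance sampling: the density of
the ReLU expansion of `∫ Ψ(a) exp (2πi a·x) da` on the cube `[-M, M]^d`, divided by the sampling
density. On that cube `|a·x| ≤ M √d ‖a‖`. -/
def importanceWeight (d : ℕ) (ν : ℝ) (πb : ℝ → ℝ) (M : ℝ) (Ψ : EuclideanSpace ℝ (Fin d) → ℂ)
    (z : EuclideanSpace ℝ (Fin d) × ℝ) : ℝ :=
  (Ψ z.1 * ridgeCoeff (M * Real.sqrt d * ‖z.1‖) (-z.2)).re / (studentDensity d ν z.1 * πb z.2)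

lemma measurable_importanceWeight {d : ℕ} {ν : ℝ} {πb : ℝ → ℝ} (hπ : Measurable πb) {M : ℝ}
    {Ψ : EuclideanSpace ℝ (Fin d) → ℂ} (hΨ : Measurable Ψ) :
    Measurable (importanceWeight d ν πb M Ψ) := by
  have h1 := measurable_studentDensity d ν
  have h2 : Measurable fun z : EuclideanSpace ℝ (Fin d) × ℝ =>
      ridgeCoeff (M * Real.sqrt d * ‖z.1‖) (-z.2) :=
    measurable_ridgeCoeff.comp (f := fun z : EuclideanSpace ℝ (Fin d) × ℝ =>
      ((M * Real.sqrt d * ‖z.1‖, -z.2) : ℝ × ℝ)) (by fun_prop)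
  unfold importanceWeight
  fun_prop

lemma abs_le_of_importanceWeight_ne_zero {d : ℕ} {ν : ℝ} {πb : ℝ → ℝ} {M : ℝ} (hM : 0 ≤ M)
    {Ψ : EuclideanSpace ℝ (Fin d) → ℂ} {z : EuclideanSpace ℝ (Fin d) × ℝ}
    (h : importanceWeight d ν πb M Ψ z ≠ 0) : |z.2| ≤ M * Real.sqrt d * ‖z.1‖ + 1 := by
  rw [← abs_neg]
  refine abs_le_of_ridgeCoeff_ne_zero (by positivity) fun h0 => h ?_
  simp [importanceWeight, h0]

/-- The importance weights are bounded independently of the dimension, even after multiplication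
with the size `√d (1 + ‖a‖)` of the features. -/
lemma exists_importanceWeight_bound {πb : ℝ → ℝ} (hπb : PolynomialDecay πb) {ν C M : ℝ}
    (hν : 1 ≤ ν) (hC : Real.pi < 4 * Real.pi ^ 2 * C) (hM : 0 < M) :
    ∃ K : ℝ, 0 < K ∧ ∀ (d : ℕ), 1 ≤ d → ∀ (S : ℝ) (Ψ : EuclideanSpace ℝ (Fin d) → ℂ),
      (∀ ξ, ‖Ψ ξ‖ ≤ S * Real.exp (-(4 * Real.pi ^ 2 * C) * ‖ξ‖ ^ 2)) →
      ∀ z, |importanceWeight d ν πb M Ψ z| * (Real.sqrt d * (1 + ‖z.1‖)) ≤ K * S := by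
  obtain ⟨p, hp⟩ := hπb.exists_polynomial
  obtain ⟨Kp, hKp, hpoly⟩ := exists_abs_eval_le p
  obtain ⟨K, hK, hbound⟩ := exists_dimension_free_bound (p.natDegree + 1) hν hC
  refine ⟨40 * (Kp * (2 + M) ^ p.natDegree) * K, by positivity, fun d hd S Ψ hΨ z => ?_⟩
  have hS : 0 ≤ S := by
    by_contra hS
    have := (norm_nonneg _).trans (hΨ 0)
    simp at this
    exact hS this
  by_cases h0 : importanceWeight d ν πb M Ψ z = 0
  · rw [h0, abs_zero, zero_mul]; positivity
  have hb := abs_le_of_importanceWeight_ne_zero hM.le h0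
  have hsd : 1 ≤ Real.sqrt d := by
    rw [Real.one_le_sqrt]; exact_mod_cast hd
  have hr := norm_nonneg z.1
  have hst := studentDensity_pos (by linarith : 0 < ν) z.1
  have hπ := hπb.pos z.2
  have h1b : 1 + |z.2| ≤ (2 + M) * (Real.sqrt d * (1 + ‖z.1‖)) := by
    have : 2 ≤ 2 * (Real.sqrt d * (1 + ‖z.1‖)) := by nlinarith
    have : 0 ≤ M * Real.sqrt d := by positivity
    nlinarith
  have hinv : (πb z.2)⁻¹ ≤ Kp * (2 + M) ^ p.natDegree * (Real.sqrt d * (1 + ‖z.1‖)) ^ p.natDegree := by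
    calc (πb z.2)⁻¹ ≤ p.eval z.2 := by
          rw [inv_le_iff_one_le_mul₀ hπ]; exact (hp z.2).2
      _ ≤ Kp * (1 + |z.2|) ^ p.natDegree := (le_abs_self _).trans (hpoly _)
      _ ≤ Kp * ((2 + M) * (Real.sqrt d * (1 + ‖z.1‖))) ^ p.natDegree := by gcongr
      _ = _ := by rw [mul_pow]; ring
  have hnum : |(Ψ z.1 * ridgeCoeff (M * Real.sqrt d * ‖z.1‖) (-z.2)).re|
      ≤ S * Real.exp (-(4 * Real.pi ^ 2 * C) * ‖z.1‖ ^ 2) * 40 := by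
    refine (Complex.abs_re_le_norm _).trans ?_
    rw [norm_mul]
    exact mul_le_mul (hΨ _) (norm_ridgeCoeff_le _ _) (norm_nonneg _) (by positivity)
  unfold importanceWeight
  rw [abs_div, abs_of_pos (mul_pos hst hπ), div_mul_eq_mul_div, div_le_iff₀ (mul_pos hst hπ)]
  have hmain := hbound d hd z.1
  set Y : ℝ := Real.sqrt d * (1 + ‖z.1‖) with hY
  set e : ℝ := Real.exp (-(4 * Real.pi ^ 2 * C) * ‖z.1‖ ^ 2) with he
  have hY0 : 0 ≤ Y := by positivity
  have he0 : 0 < e := Real.exp_pos _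
  have hone : 1 ≤ Kp * (2 + M) ^ p.natDegree * Y ^ p.natDegree * πb z.2 := by
    rwa [inv_le_iff_one_le_mul₀ hπ] at hinv
  calc |(Ψ z.1 * ridgeCoeff (M * Real.sqrt d * ‖z.1‖) (-z.2)).re| * Y
      ≤ S * e * 40 * Y * 1 := by rw [mul_one]; gcongr
    _ ≤ S * e * 40 * Y * (Kp * (2 + M) ^ p.natDegree * Y ^ p.natDegree * πb z.2) := by gcongr
    _ = 40 * (Kp * (2 + M) ^ p.natDegree) * S * πb z.2 * (Y ^ (p.natDegree + 1) * e) := by ring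
    _ ≤ 40 * (Kp * (2 + M) ^ p.natDegree) * S * πb z.2 * (K * studentDensity d ν z.1) := by
        gcongr
    _ = _ := by ring

lemma abs_inner_le_of_mem_cube {d : ℕ} {M : ℝ} (hM : 0 ≤ M) {x : EuclideanSpace ℝ (Fin d)}
    (hx : x ∈ cube d M) (a : EuclideanSpace ℝ (Fin d)) :
    |inner ℝ a x| ≤ M * Real.sqrt d * ‖a‖ := by
  have hxn : ‖x‖ ≤ M * Real.sqrt d := by
    rw [EuclideanSpace.norm_eq, Real.sqrt_le_left (by positivity), mul_pow,
      Real.sq_sqrt (by positivity)]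
    calc ∑ i, ‖x i‖ ^ 2 ≤ ∑ _i : Fin d, M ^ 2 :=
          Finset.sum_le_sum fun i _ => pow_le_pow_left₀ (norm_nonneg _) (hx i) 2
      _ = M ^ 2 * d := by simp [mul_comm]
  refine (abs_real_inner_le_norm a x).trans ?_
  rw [mul_comm]
  gcongr

/-- The law of one pair `(A_i, B_i)` of hidden weights. -/
def weightLaw (d : ℕ) (ν : ℝ) (πb : ℝ → ℝ) : Measure (EuclideanSpace ℝ (Fin d) × ℝ) :=
  (studentMeasure d ν).prod (volume.withDensity fun z => ENNReal.ofReal (πb z))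

/-- A plane wave superposition on the cube is the mean, over the law of the hidden weights, of the
ReLU features with their importance weights. -/
lemma integral_importanceWeight_mul_relu {d : ℕ} {ν : ℝ} (hν : 0 < ν) {πb : ℝ → ℝ}
    (hπb : Measurable πb) (hπpos : ∀ z, 0 < πb z) {M : ℝ} (hM : 0 ≤ M)
    [IsProbabilityMeasure (studentMeasure d ν)]
    [IsProbabilityMeasure (volume.withDensity fun z => ENNReal.ofReal (πb z))]
    {Ψ : EuclideanSpace ℝ (Fin d) → ℂ} (hΨi : Integrable Ψ)
    {x : EuclideanSpace ℝ (Fin d)} (hx : x ∈ cube d M)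
    (hint : Integrable (fun z : EuclideanSpace ℝ (Fin d) × ℝ =>
      importanceWeight d ν πb M Ψ z * relu (inner ℝ z.1 x + z.2)) (weightLaw d ν πb)) :
    ((∫ z, importanceWeight d ν πb M Ψ z * relu (inner ℝ z.1 x + z.2) ∂weightLaw d ν πb : ℝ))
      = (∫ ξ, Ψ ξ * Complex.exp (2 * Real.pi * (inner ℝ ξ x : ℝ) * Complex.I)).re := by
  have hmeas := measurable_studentDensity d ν
  rw [weightLaw, integral_prod _ hint, studentMeasure,
    integral_withDensity_eq_integral_toReal_smul (by fun_prop) (by simp)]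
  have hwave : ∀ a : EuclideanSpace ℝ (Fin d),
      ‖Complex.exp (2 * Real.pi * (inner ℝ a x : ℝ) * Complex.I)‖ = 1 := by
    intro a
    have := Complex.norm_exp_ofReal_mul_I (2 * Real.pi * inner ℝ a x)
    push_cast at this
    exact this
  have hI : Integrable fun ξ : EuclideanSpace ℝ (Fin d) =>
      Ψ ξ * Complex.exp (2 * Real.pi * (inner ℝ ξ x : ℝ) * Complex.I) := by
    refine hΨi.norm.mono' (hΨi.1.mul (Continuous.aestronglyMeasurable (by fun_prop))) ?_
    exact ae_of_all _ fun ξ => by rw [norm_mul, hwave, mul_one]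
  rw [← RCLike.re_eq_complex_re, ← integral_re hI]
  refine integral_congr_ae (ae_of_all _ fun a => ?_)
  have hst := studentDensity_pos hν a
  have hridge := integral_ridgeCoeff_mul_relu (abs_inner_le_of_mem_cube hM hx a)
  rw [← integral_neg_eq_self] at hridge
  -- the integral is nonzero, so the integrand is integrable
  have hridgeInt : Integrable fun b : ℝ => ridgeCoeff (M * Real.sqrt d * ‖a‖) (-b)
      * (relu (inner ℝ a x - -b) : ℂ) := by
    by_contra hn
    rw [integral_undef hn] at hridge
    exact Complex.exp_ne_zero _ hridge.symm
  simp only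
  rw [ENNReal.toReal_ofReal hst.le,
    integral_withDensity_eq_integral_toReal_smul (by fun_prop) (by simp), smul_eq_mul,
    ← integral_const_mul, ← hridge, ← integral_const_mul, ← integral_re (hridgeInt.const_mul _)]
  refine integral_congr_ae (ae_of_all _ fun b => ?_)
  have hπ := hπpos b
  simp only [sub_neg_eq_add, RCLike.re_eq_complex_re]
  rw [ENNReal.toReal_ofReal hπ.le, ← mul_assoc (Ψ a), Complex.re_mul_ofReal, smul_eq_mul]
  unfold importanceWeight
  field_simp

end ImportanceWeight

/-! ### Contraction and symmetrization -/

section SignAverages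

/-- The values `±1` of a Rademacher variable, indexed by `Bool`. -/
def sgn (b : Bool) : ℝ := if b then 1 else -1

lemma sum_signs_succ {N : ℕ} (F : (Fin (N + 1) → Bool) → ℝ) :
    ∑ ε, F ε = ∑ ε : Fin N → Bool, (F (Fin.cons true ε) + F (Fin.cons false ε)) := by
  rw [← (Fin.consEquiv fun _ : Fin (N + 1) => Bool).sum_comp, Fintype.sum_prod_type,
    Fintype.sum_bool, Finset.sum_add_distrib]
  rfl

/-- The contraction principle for a single sign. -/
lemma sup'_add_sup'_le {τ : Type*} (T : Finset τ) (hT : T.Nonempty) (u φ ψ : τ → ℝ)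
    (h : ∀ s t, |φ s - φ t| ≤ |ψ s - ψ t|) :
    T.sup' hT (fun t => u t + φ t) + T.sup' hT (fun t => u t - φ t)
      ≤ T.sup' hT (fun t => u t + ψ t) + T.sup' hT (fun t => u t - ψ t) := by
  obtain ⟨s, hs, hs'⟩ := Finset.exists_mem_eq_sup' hT (fun t => u t + φ t)
  obtain ⟨t, ht, ht'⟩ := Finset.exists_mem_eq_sup' hT (fun t => u t - φ t)
  rw [hs', ht']
  have h1 := (le_abs_self _).trans (h s t)
  have a1 := Finset.le_sup' (fun t => u t + ψ t) hs
  have a2 := Finset.le_sup' (fun t => u t + ψ t) ht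
  have b1 := Finset.le_sup' (fun t => u t - ψ t) hs
  have b2 := Finset.le_sup' (fun t => u t - ψ t) ht
  rcases abs_cases (ψ s - ψ t) with ⟨hc, -⟩ | ⟨hc, -⟩ <;> rw [hc] at h1 <;> linarith

/-- Contraction principle of Ledoux and Talagrand for finite index sets. -/
lemma sum_signs_sup'_contraction {τ : Type*} (T : Finset τ) (hT : T.Nonempty) {N : ℕ}
    (φ ψ : Fin N → τ → ℝ) (h : ∀ i s t, |φ i s - φ i t| ≤ |ψ i s - ψ i t|) (u : τ → ℝ) :
    ∑ ε : Fin N → Bool, T.sup' hT (fun t => u t + ∑ i, sgn (ε i) * φ i t)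
      ≤ ∑ ε : Fin N → Bool, T.sup' hT (fun t => u t + ∑ i, sgn (ε i) * ψ i t) := by
  induction N generalizing u with
  | zero => simp
  | succ N ih =>
    rw [sum_signs_succ, sum_signs_succ]
    simp only [Fin.sum_univ_succ, Fin.cons_zero, Fin.cons_succ, Finset.sum_add_distrib, sgn,
      if_true, Bool.false_eq_true, if_false, one_mul, neg_mul, ← add_assoc]
    refine (add_le_add (ih (fun i => φ i.succ) (fun i => ψ i.succ) (fun i => h i.succ) _)
      (ih (fun i => φ i.succ) (fun i => ψ i.succ) (fun i => h i.succ) _)).trans ?_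
    rw [← Finset.sum_add_distrib, ← Finset.sum_add_distrib]
    refine Finset.sum_le_sum fun ε _ => ?_
    have := sup'_add_sup'_le T hT (fun t => u t + ∑ i : Fin N, sgn (ε i) * ψ i.succ t)
      (φ 0) (ψ 0) (h 0)
    simp only [sgn] at this ⊢
    refine le_of_eq_of_le ?_ (this.trans_eq ?_) <;>
    exact congrArg₂ (· + ·) (congrArg (T.sup' hT) (funext fun t => by ring))
      (congrArg (T.sup' hT) (funext fun t => by ring))

/-- Contraction principle with absolute values. The point `t₀` makes both one-sided suprema
nonnegative, so the two-sided supremum is at most their sum. -/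
lemma sum_signs_sup'_abs_contraction {τ : Type*} (T : Finset τ) (hT : T.Nonempty) {N : ℕ}
    (φ ψ : Fin N → τ → ℝ) (h : ∀ i s t, |φ i s - φ i t| ≤ |ψ i s - ψ i t|) {t₀ : τ} (ht₀ : t₀ ∈ T)
    (hφ : ∀ i, φ i t₀ = 0) :
    ∑ ε : Fin N → Bool, T.sup' hT (fun t => |∑ i, sgn (ε i) * φ i t|)
      ≤ 2 * ∑ ε : Fin N → Bool, T.sup' hT (fun t => ∑ i, sgn (ε i) * ψ i t) := by
  have h1 := sum_signs_sup'_contraction T hT φ ψ h 0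
  have h2 := sum_signs_sup'_contraction T hT (fun i t => -φ i t) ψ (fun i s t => by
    rw [← abs_neg]; convert h i s t using 2; ring) 0
  simp only [Pi.zero_apply, zero_add] at h1 h2
  rw [two_mul]
  refine le_trans ?_ (add_le_add h1 h2)
  rw [← Finset.sum_add_distrib]
  refine Finset.sum_le_sum fun ε _ => Finset.sup'_le _ _ fun t ht => ?_
  have a1 := Finset.le_sup' (fun t => ∑ i, sgn (ε i) * φ i t) ht
  have a0 := Finset.le_sup' (fun t => ∑ i, sgn (ε i) * φ i t) ht₀
  have b1 := Finset.le_sup' (fun t => ∑ i, sgn (ε i) * -φ i t) ht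
  have b0 := Finset.le_sup' (fun t => ∑ i, sgn (ε i) * -φ i t) ht₀
  simp only [hφ, mul_neg, mul_zero, neg_zero, Finset.sum_const_zero, Finset.sum_neg_distrib]
    at a0 b0 a1 b1 ⊢
  rcases abs_cases (∑ i, sgn (ε i) * φ i t) with ⟨hc, -⟩ | ⟨hc, -⟩ <;> rw [hc] <;> linarith

/-- Orthogonality of signs, from the parallelogram law. -/
lemma sum_signs_norm_sq {E : Type*} [NormedAddCommGroup E] [InnerProductSpace ℝ E] {N : ℕ}
    (v : Fin N → E) (u : E) :
    ∑ ε : Fin N → Bool, ‖u + ∑ i, sgn (ε i) • v i‖ ^ 2 = 2 ^ N * (‖u‖ ^ 2 + ∑ i, ‖v i‖ ^ 2) := by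
  induction N generalizing u with
  | zero => simp
  | succ N ih =>
    rw [sum_signs_succ]
    simp only [Fin.sum_univ_succ, Fin.cons_zero, Fin.cons_succ, Finset.sum_add_distrib, sgn,
      if_true, Bool.false_eq_true, if_false, one_smul, neg_smul, ← add_assoc]
    have h1 := ih (fun i => v i.succ) (u + v 0)
    have h2 := ih (fun i => v i.succ) (u + -v 0)
    simp only [sgn] at h1 h2
    rw [h1, h2]
    have := parallelogram_law_with_norm ℝ u (v 0)
    rw [← sub_eq_add_neg, pow_succ]
    linear_combination 2 ^ N * this

lemma sum_signs_norm_le {E : Type*} [NormedAddCommGroup E] [InnerProductSpace ℝ E] {N : ℕ}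
    (v : Fin N → E) :
    ∑ ε : Fin N → Bool, ‖∑ i, sgn (ε i) • v i‖ ≤ 2 ^ N * Real.sqrt (∑ i, ‖v i‖ ^ 2) := by
  have h := sum_signs_norm_sq v 0
  simp only [zero_add, norm_zero, ne_eq, OfNat.ofNat_ne_zero, not_false_eq_true, zero_pow] at h
  have hcs := sq_sum_le_card_mul_sum_sq (s := (Finset.univ : Finset (Fin N → Bool)))
    (f := fun ε => ‖∑ i, sgn (ε i) • v i‖)
  rw [h] at hcs
  simp only [Finset.card_univ, Fintype.card_pi, Fintype.card_bool, Finset.prod_const,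
    Fintype.card_fin] at hcs
  refine (sq_le_sq₀ (Finset.sum_nonneg fun _ _ => norm_nonneg _) (by positivity)).1 ?_
  rw [mul_pow, Real.sq_sqrt (by positivity)]
  push_cast at hcs
  linarith

end SignAverages

section Symmetrization

variable {E : Type*} [MeasurableSpace E]

/-- Pairs of independent copies may be swapped in any set of coordinates. -/
lemma integral_pi_swap {N : ℕ} (κ : Measure E) [IsProbabilityMeasure κ] (ε : Fin N → Bool)
    (F : (Fin N → E × E) → ℝ) :
    ∫ w, F (fun i => if ε i then w i else (w i).swap) ∂(Measure.pi fun _ => κ.prod κ)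
      = ∫ w, F w ∂(Measure.pi fun _ => κ.prod κ) := by
  let e : ∀ i : Fin N, (E × E) ≃ᵐ (E × E) := fun i =>
    if ε i then MeasurableEquiv.refl _ else MeasurableEquiv.prodComm
  have he : ∀ i, MeasurePreserving (e i) (κ.prod κ) (κ.prod κ) := by
    intro i
    by_cases h : ε i
    · simp only [e, h, if_true]; exact MeasurePreserving.id _
    · simp only [e, h]; exact Measure.measurePreserving_swap
  have hp := measurePreserving_pi (fun _ : Fin N => κ.prod κ) (fun _ => κ.prod κ) he
  have := hp.integral_comp (MeasurableEquiv.piCongrRight e).measurableEmbedding F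
  rw [← this]
  congr 1; ext w
  congr 1; ext i : 1
  by_cases h : ε i <;> simp [e, h, MeasurableEquiv.prodComm]

lemma abs_sgn (b : Bool) : |sgn b| = 1 := by cases b <;> simp [sgn]

lemma abs_sum_le_card_mul {N : ℕ} {c : Fin N → ℝ} {K : ℝ} (hc : ∀ i, |c i| ≤ K) :
    |∑ i, c i| ≤ N * K := by
  refine (Finset.abs_sum_le_sum_abs _ _).trans ((Finset.sum_le_sum fun i _ => hc i).trans ?_)
  simp

lemma measurable_sup'_abs {τ : Type*} (T : Finset τ) (hT : T.Nonempty) {g : τ → E → ℝ}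
    (hg : ∀ t, Measurable (g t)) : Measurable fun w => T.sup' hT fun t => |g t w| := by
  have h := Finset.measurable_sup' hT (f := fun t w => |g t w|)
    fun t _ => continuous_abs.measurable.comp (hg t)
  convert h using 2 with w
  rw [Finset.sup'_apply]

lemma integrable_sup'_abs {τ : Type*} (T : Finset τ) (hT : T.Nonempty) (μ : Measure E)
    [IsProbabilityMeasure μ] {g : τ → E → ℝ} (hg : ∀ t, Measurable (g t)) {B : ℝ}
    (hB : ∀ t w, |g t w| ≤ B) : Integrable (fun w => T.sup' hT fun t => |g t w|) μ := by
  refine Integrable.of_bound (measurable_sup'_abs T hT hg).aestronglyMeasurable B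
    (ae_of_all _ fun w => ?_)
  obtain ⟨t, ht⟩ := hT
  rw [Real.norm_eq_abs, abs_of_nonneg ((abs_nonneg (g t w)).trans
    (Finset.le_sup' (fun t => |g t w|) ht))]
  exact Finset.sup'_le _ _ fun t _ => hB t w

lemma abs_sub_le_two_mul {K u v : ℝ} (hu : |u| ≤ K) (hv : |v| ≤ K) : |u - v| ≤ 2 * K := by
  have := abs_sub u v; linarith

lemma integrable_sup'_deviation {τ : Type*} (T : Finset τ) (hT : T.Nonempty) {N : ℕ}
    (κ : Measure E) [IsProbabilityMeasure κ] (f : τ → E → ℝ) (hf : ∀ t, Measurable (f t))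
    {K : ℝ} (hK : ∀ t z, |f t z| ≤ K) :
    Integrable (fun z : Fin N → E => T.sup' hT (fun t => |∑ i, f t (z i) - N * ∫ y, f t y ∂κ|))
      (Measure.pi fun _ => κ) := by
  have hmean : ∀ t, |∫ y, f t y ∂κ| ≤ K := fun t => by
    have := norm_integral_le_of_norm_le_const (μ := κ) (f := f t) (C := K)
      (ae_of_all _ fun z => hK t z)
    simpa using this
  refine integrable_sup'_abs T hT _ (B := N * (2 * K)) (fun t => ?_) (fun t z => ?_)
  · exact (Finset.measurable_sum _ fun i _ => (hf t).comp (measurable_pi_apply i)).sub_const _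
  · have : ∑ i, f t (z i) - N * ∫ y, f t y ∂κ = ∑ i, (f t (z i) - ∫ y, f t y ∂κ) := by simp
    rw [this]
    exact abs_sum_le_card_mul fun i => abs_sub_le_two_mul (hK _ _) (hmean t)

/-- Replacing the mean by an independent copy does not decrease the expected uniform deviation. -/
lemma integral_sup'_deviation_le_copy {τ : Type*} (T : Finset τ) (hT : T.Nonempty) {N : ℕ}
    (κ : Measure E) [IsProbabilityMeasure κ] (f : τ → E → ℝ) (hf : ∀ t, Measurable (f t))
    {K : ℝ} (hK : ∀ t z, |f t z| ≤ K) :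
    ∫ z, T.sup' hT (fun t => |∑ i, f t (z i) - N * ∫ y, f t y ∂κ|) ∂(Measure.pi fun _ : Fin N => κ)
      ≤ ∫ p : (Fin N → E) × (Fin N → E),
        T.sup' hT (fun t => |∑ i, (f t (p.1 i) - f t (p.2 i))|)
          ∂((Measure.pi fun _ : Fin N => κ).prod (Measure.pi fun _ : Fin N => κ)) := by
  set ρ : Measure (Fin N → E) := Measure.pi fun _ : Fin N => κ with hρ
  have hm : ∀ t (i : Fin N), Measurable fun z : Fin N → E => f t (z i) := fun t i =>
    (hf t).comp (measurable_pi_apply i)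
  have hm2 : ∀ t, Measurable fun p : (Fin N → E) × (Fin N → E) =>
      ∑ i, (f t (p.1 i) - f t (p.2 i)) := fun t =>
    Finset.measurable_sum _ fun i _ =>
      ((hm t i).comp measurable_fst).sub ((hm t i).comp measurable_snd)
  have hb2 : ∀ t (p : (Fin N → E) × (Fin N → E)),
      |∑ i, (f t (p.1 i) - f t (p.2 i))| ≤ N * (2 * K) := fun t p =>
    abs_sum_le_card_mul fun i => abs_sub_le_two_mul (hK _ _) (hK _ _)
  have hpi := integrable_sup'_abs T hT (ρ.prod ρ) hm2 hb2
  rw [integral_prod _ hpi]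
  refine integral_mono (integrable_sup'_deviation T hT κ f hf hK) hpi.integral_prod_left
    fun z => ?_
  · refine Finset.sup'_le _ _ fun t ht => ?_
    have hi : ∀ i : Fin N, Integrable (fun z' : Fin N → E => f t (z' i)) ρ := fun i =>
      Integrable.of_bound (hm t i).aestronglyMeasurable K (ae_of_all _ fun z' => hK _ _)
    have hi' : ∀ i : Fin N, Integrable (fun z' : Fin N → E => f t (z i) - f t (z' i)) ρ :=
      fun i => (integrable_const _).sub (hi i)
    have : ∑ i, f t (z i) - N * ∫ y, f t y ∂κ = ∫ z', ∑ i, (f t (z i) - f t (z' i)) ∂ρ := by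
      rw [integral_finsetSum _ fun i _ => hi' i]
      have hE : ∀ i : Fin N, ∫ z', (f t (z i) - f t (z' i)) ∂ρ
          = f t (z i) - ∫ y, f t y ∂κ := fun i => by
        rw [integral_sub (integrable_const _) (hi i), hρ,
          integral_comp_eval (μ := fun _ : Fin N => κ) (hf t).aestronglyMeasurable]
        simp
      simp [hE]
    rw [this]
    refine abs_integral_le_integral_abs.trans (integral_mono_of_nonneg
      (ae_of_all _ fun _ => abs_nonneg _) ?_ (ae_of_all _ fun z' => ?_))
    · exact integrable_sup'_abs T hT ρ (g := fun t z' => ∑ i, (f t (z i) - f t (z' i)))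
        (fun t => (hm2 t).comp measurable_prodMk_left) (fun t z' => hb2 t (z, z'))
    · exact Finset.le_sup' (fun t => |∑ i, (f t (z i) - f t (z' i))|) ht

/-- Symmetrization: a bound on the sign averages, uniform in the sample, bounds the expected
uniform deviation of a sum from its mean. -/
lemma integral_sup'_deviation_le {τ : Type*} (T : Finset τ) (hT : T.Nonempty) {N : ℕ}
    (κ : Measure E) [IsProbabilityMeasure κ] (f : τ → E → ℝ) (hf : ∀ t, Measurable (f t))
    {K : ℝ} (hK : ∀ t z, |f t z| ≤ K) {S : ℝ}
    (hS : ∀ z : Fin N → E, ∑ ε : Fin N → Bool,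
      T.sup' hT (fun t => |∑ i, sgn (ε i) * f t (z i)|) ≤ 2 ^ N * S) :
    ∫ z, T.sup' hT (fun t => |∑ i, f t (z i) - N * ∫ y, f t y ∂κ|) ∂(Measure.pi fun _ : Fin N => κ)
      ≤ 2 * S := by
  refine (integral_sup'_deviation_le_copy T hT κ f hf hK).trans ?_
  have harrow := measurePreserving_arrowProdEquivProdArrow E E (Fin N) (fun _ => κ) (fun _ => κ)
  rw [← harrow.integral_comp (MeasurableEquiv.measurableEmbedding _)]
  set Q : Measure (Fin N → E × E) := Measure.pi fun _ : Fin N => κ.prod κ with hQ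
  -- the symmetrized difference, evaluated with signs `ε`
  let G : (Fin N → Bool) → (Fin N → E × E) → ℝ := fun ε w =>
    T.sup' hT fun t => |∑ i, sgn (ε i) * (f t (w i).1 - f t (w i).2)|
  have hGi : ∀ ε, Integrable (G ε) Q := fun ε => by
    refine integrable_sup'_abs T hT Q (B := N * (2 * K)) (fun t => ?_) (fun t w => ?_)
    · exact Finset.measurable_sum _ fun i _ => (((hf t).comp
        (measurable_fst.comp (measurable_pi_apply i))).sub ((hf t).comp
        (measurable_snd.comp (measurable_pi_apply i)))).const_mul _
    · refine abs_sum_le_card_mul fun i => ?_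
      rw [abs_mul, abs_sgn, one_mul]
      exact abs_sub_le_two_mul (hK _ _) (hK _ _)
  let one : Fin N → Bool := fun _ => true
  have hG1 : ∀ w, T.sup' hT (fun t =>
      |∑ i, (f t ((MeasurableEquiv.arrowProdEquivProdArrow E E (Fin N) w).1 i)
        - f t ((MeasurableEquiv.arrowProdEquivProdArrow E E (Fin N) w).2 i))|) = G one w := by
    intro w
    simp [G, one, sgn, MeasurableEquiv.arrowProdEquivProdArrow, Equiv.arrowProdEquivProdArrow]
  simp_rw [hG1]
  have hGε : ∀ ε, ∫ w, G ε w ∂Q = ∫ w, G one w ∂Q := by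
    intro ε
    rw [hQ, ← integral_pi_swap κ ε (G one)]
    congr 1; ext w
    refine congrArg (T.sup' hT) (funext fun t => congrArg _ (Finset.sum_congr rfl fun i _ => ?_))
    simp only [sgn, one, if_true, one_mul]
    split_ifs <;> simp
  have hsum : 2 ^ N * ∫ w, G one w ∂Q = ∫ w, ∑ ε, G ε w ∂Q := by
    rw [integral_finsetSum _ fun ε _ => hGi ε]
    simp [hGε]
  have hbound : ∫ w, ∑ ε, G ε w ∂Q ≤ ∫ _w, 2 ^ N * (2 * S) ∂Q := by
    refine integral_mono (integrable_finsetSum _ fun ε _ => hGi ε) (integrable_const _)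
      fun w => ?_
    have h1 := hS fun i => (w i).1
    have h2 := hS fun i => (w i).2
    calc ∑ ε, G ε w ≤ ∑ ε : Fin N → Bool,
          (T.sup' hT (fun t => |∑ i, sgn (ε i) * f t (w i).1|)
          + T.sup' hT (fun t => |∑ i, sgn (ε i) * f t (w i).2|)) := by
          refine Finset.sum_le_sum fun ε _ => Finset.sup'_le _ _ fun t ht => ?_
          have a1 := Finset.le_sup' (fun t => |∑ i, sgn (ε i) * f t (w i).1|) ht
          have a2 := Finset.le_sup' (fun t => |∑ i, sgn (ε i) * f t (w i).2|) ht
          refine le_trans ?_ (add_le_add a1 a2)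
          simp only [mul_sub, Finset.sum_sub_distrib]
          exact abs_sub _ _
      _ ≤ 2 ^ N * (2 * S) := by rw [Finset.sum_add_distrib]; linarith
  rw [integral_const, ← hsum] at hbound
  simp only [probReal_univ, smul_eq_mul, one_mul] at hbound
  exact le_of_mul_le_mul_left hbound (by positivity)

end Symmetrization

/-! ### Uniform Monte Carlo approximation on the cube -/

section UniformApproximation

variable {d : ℕ} {M B : ℝ} {h : EuclideanSpace ℝ (Fin d) × ℝ → ℝ}

/-- A bounded weight function for ReLU features: `h` is bounded by `B`, also after multiplication
with the size `√d (1 + ‖a‖)` of the features, and is supported where the bias `b` is at most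
`M √d ‖a‖ + 1`. -/
structure IsTameWeight (M B : ℝ) (h : EuclideanSpace ℝ (Fin d) × ℝ → ℝ) : Prop where
  measurable : Measurable h
  bound : ∀ z, |h z| * (Real.sqrt d * (1 + ‖z.1‖)) ≤ B
  support : ∀ z, h z ≠ 0 → |z.2| ≤ M * Real.sqrt d * ‖z.1‖ + 1

lemma IsTameWeight.nonneg (hh : IsTameWeight M B h) : 0 ≤ B :=
  le_trans (by positivity) (hh.bound 0)

lemma IsTameWeight.abs_le (hh : IsTameWeight M B h) (hd : 1 ≤ d)
    (z : EuclideanSpace ℝ (Fin d) × ℝ) : |h z| ≤ B := by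
  refine le_trans ?_ (hh.bound z)
  have hsd : 1 ≤ Real.sqrt d := by rw [Real.one_le_sqrt]; exact_mod_cast hd
  have : 1 ≤ Real.sqrt d * (1 + ‖z.1‖) := by nlinarith [norm_nonneg z.1]
  exact le_mul_of_one_le_right (abs_nonneg _) this

lemma IsTameWeight.abs_mul_norm_le (hh : IsTameWeight M B h)
    (z : EuclideanSpace ℝ (Fin d) × ℝ) : |h z| * (Real.sqrt d * ‖z.1‖) ≤ B := by
  refine le_trans ?_ (hh.bound z)
  gcongr
  linarith

lemma IsTameWeight.abs_mul_bias_le (hh : IsTameWeight M B h) (hd : 1 ≤ d) (hM : 0 ≤ M)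
    (z : EuclideanSpace ℝ (Fin d) × ℝ) : |h z| * |z.2| ≤ (M + 1) * B := by
  by_cases h0 : h z = 0
  · rw [h0, abs_zero, zero_mul]
    exact mul_nonneg (by linarith) hh.nonneg
  · calc |h z| * |z.2| ≤ |h z| * (M * Real.sqrt d * ‖z.1‖ + 1) := by
          gcongr; exact hh.support z h0
      _ = M * (|h z| * (Real.sqrt d * ‖z.1‖)) + |h z| := by ring
      _ ≤ M * B + B := by gcongr; exacts [hh.abs_mul_norm_le z, hh.abs_le hd z]
      _ = _ := by ring

lemma IsTameWeight.abs_mul_relu_le (hh : IsTameWeight M B h) (hd : 1 ≤ d) (hM : 0 ≤ M)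
    {x : EuclideanSpace ℝ (Fin d)} (hx : x ∈ cube d M)
    (z : EuclideanSpace ℝ (Fin d) × ℝ) :
    |h z * relu (inner ℝ z.1 x + z.2)| ≤ (2 * M + 1) * B := by
  have hx' := abs_inner_le_of_mem_cube hM hx z.1
  rw [abs_mul, abs_of_nonneg (relu_nonneg _)]
  calc |h z| * relu (inner ℝ z.1 x + z.2) ≤ |h z| * (M * Real.sqrt d * ‖z.1‖ + |z.2|) := by
        gcongr
        exact (relu_le_abs _).trans ((abs_add_le _ _).trans (by linarith))
    _ = M * (|h z| * (Real.sqrt d * ‖z.1‖)) + |h z| * |z.2| := by ring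
    _ ≤ M * B + (M + 1) * B := by
        exact add_le_add (mul_le_mul_of_nonneg_left (hh.abs_mul_norm_le z) hM)
          (hh.abs_mul_bias_le hd hM z)
    _ = _ := by ring

lemma measurable_weight_mul_relu (hh : Measurable h) (x : EuclideanSpace ℝ (Fin d)) :
    Measurable fun z => h z * relu (inner ℝ z.1 x + z.2) := by
  have := continuous_relu.measurable
  fun_prop

/-- Sign averages of weighted ReLU features. The features are Lipschitz functions of `⟪a, x⟫` up
to their value at `x = 0`, so the contraction principle replaces them by linear functions. -/
lemma IsTameWeight.sum_signs_le (hh : IsTameWeight M B h) (hd : 1 ≤ d) (hM : 0 ≤ M) {N : ℕ}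
    (T : Finset (cube d M)) (hT : T.Nonempty) {t₀ : cube d M} (ht₀ : t₀ ∈ T)
    (h₀ : (t₀ : EuclideanSpace ℝ (Fin d)) = 0) (z : Fin N → EuclideanSpace ℝ (Fin d) × ℝ) :
    ∑ ε : Fin N → Bool, T.sup' hT (fun x => |∑ i, sgn (ε i) *
        (h (z i) * relu (inner ℝ (z i).1 (x : EuclideanSpace ℝ (Fin d)) + (z i).2))|)
      ≤ 2 ^ N * ((3 * M + 1) * B * Real.sqrt N) := by
  have hB := hh.nonneg
  set v : Fin N → EuclideanSpace ℝ (Fin d) := fun i => |h (z i)| • (z i).1 with hv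
  set φ : Fin N → cube d M → ℝ := fun i x =>
    h (z i) * (relu (inner ℝ (z i).1 (x : EuclideanSpace ℝ (Fin d)) + (z i).2)
      - relu (z i).2) with hφ
  set ψ : Fin N → cube d M → ℝ := fun i x => inner ℝ (v i) (x : EuclideanSpace ℝ (Fin d)) with hψ
  have hlip : ∀ i s t, |φ i s - φ i t| ≤ |ψ i s - ψ i t| := by
    intro i s t
    have e1 : φ i s - φ i t = h (z i) *
        (relu (inner ℝ (z i).1 (s : EuclideanSpace ℝ (Fin d)) + (z i).2)
          - relu (inner ℝ (z i).1 (t : EuclideanSpace ℝ (Fin d)) + (z i).2)) := by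
      simp only [hφ]; ring
    have e2 : ψ i s - ψ i t = |h (z i)| *
        (inner ℝ (z i).1 (s : EuclideanSpace ℝ (Fin d))
          - inner ℝ (z i).1 (t : EuclideanSpace ℝ (Fin d))) := by
      simp only [hψ, hv, inner_smul_left]; simp; ring
    rw [e1, e2, abs_mul, abs_mul, abs_abs]
    refine mul_le_mul_of_nonneg_left ((abs_relu_sub_relu_le _ _).trans (le_of_eq ?_))
      (abs_nonneg _)
    congr 1; ring
  have hcon := sum_signs_sup'_abs_contraction T hT φ ψ hlip ht₀ (fun i => by simp [hφ, h₀])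
  have hlin : ∑ ε : Fin N → Bool, T.sup' hT (fun x => ∑ i, sgn (ε i) * ψ i x)
      ≤ 2 ^ N * (M * B * Real.sqrt N) := by
    calc ∑ ε : Fin N → Bool, T.sup' hT (fun x => ∑ i, sgn (ε i) * ψ i x)
        ≤ ∑ ε : Fin N → Bool, M * Real.sqrt d * ‖∑ i, sgn (ε i) • v i‖ := by
          refine Finset.sum_le_sum fun ε _ => Finset.sup'_le _ _ fun x _ => ?_
          have : ∑ i, sgn (ε i) * ψ i x
              = inner ℝ (∑ i, sgn (ε i) • v i) (x : EuclideanSpace ℝ (Fin d)) := by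
            simp [sum_inner, hψ, inner_smul_left]
          rw [this]
          exact (le_abs_self _).trans (abs_inner_le_of_mem_cube hM x.2 _)
      _ ≤ M * Real.sqrt d * (2 ^ N * Real.sqrt (∑ i, ‖v i‖ ^ 2)) := by
          rw [← Finset.mul_sum]
          gcongr
          exact sum_signs_norm_le v
      _ = 2 ^ N * (M * Real.sqrt (d * ∑ i, ‖v i‖ ^ 2)) := by
          rw [Real.sqrt_mul (by positivity)]; ring
      _ ≤ 2 ^ N * (M * Real.sqrt (B ^ 2 * N)) := by
          refine mul_le_mul_of_nonneg_left (mul_le_mul_of_nonneg_left (Real.sqrt_le_sqrt ?_) hM)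
            (by positivity)
          rw [Finset.mul_sum]
          calc ∑ i, (d : ℝ) * ‖v i‖ ^ 2 ≤ ∑ _i : Fin N, B ^ 2 := by
                refine Finset.sum_le_sum fun i _ => ?_
                have h1 := hh.abs_mul_norm_le (z i)
                have h2 : (d : ℝ) * ‖v i‖ ^ 2 = (|h (z i)| * (Real.sqrt d * ‖(z i).1‖)) ^ 2 := by
                  rw [hv, norm_smul, Real.norm_eq_abs, abs_abs, mul_pow, mul_pow, mul_pow,
                    Real.sq_sqrt (by positivity)]
                  ring
                rw [h2]
                gcongr
            _ = B ^ 2 * N := by simp [mul_comm]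
      _ = 2 ^ N * (M * B * Real.sqrt N) := by
          rw [Real.sqrt_mul (by positivity), Real.sqrt_sq hB]; ring
  have hbias : ∑ ε : Fin N → Bool, |∑ i, sgn (ε i) * (h (z i) * relu (z i).2)|
      ≤ 2 ^ N * ((M + 1) * B * Real.sqrt N) := by
    have := sum_signs_norm_le (fun i => h (z i) * relu (z i).2)
    simp only [smul_eq_mul, Real.norm_eq_abs] at this
    refine this.trans ?_
    have hs : Real.sqrt (∑ i, |h (z i) * relu (z i).2| ^ 2)
        ≤ Real.sqrt (((M + 1) * B) ^ 2 * N) := by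
      refine Real.sqrt_le_sqrt ?_
      calc ∑ i, |h (z i) * relu (z i).2| ^ 2 ≤ ∑ _i : Fin N, ((M + 1) * B) ^ 2 := by
            refine Finset.sum_le_sum fun i _ => ?_
            gcongr
            rw [abs_mul, abs_of_nonneg (relu_nonneg _)]
            refine le_trans ?_ (hh.abs_mul_bias_le hd hM (z i))
            gcongr
            exact relu_le_abs _
        _ = _ := by simp [mul_comm]
    rw [Real.sqrt_mul (by positivity), Real.sqrt_sq (mul_nonneg (by linarith) hB)] at hs
    gcongr
  calc _ ≤ ∑ ε : Fin N → Bool, (T.sup' hT (fun x => |∑ i, sgn (ε i) * φ i x|)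
          + |∑ i, sgn (ε i) * (h (z i) * relu (z i).2)|) := by
        refine Finset.sum_le_sum fun ε _ => Finset.sup'_le _ _ fun x hx => ?_
        have a1 := Finset.le_sup' (fun x => |∑ i, sgn (ε i) * φ i x|) hx
        refine le_trans ?_ (add_le_add a1 le_rfl)
        refine le_trans (le_of_eq ?_) (abs_add_le _ _)
        rw [← Finset.sum_add_distrib]
        congr 1
        refine Finset.sum_congr rfl fun i _ => ?_
        simp only [hφ]; ring
    _ ≤ 2 ^ N * ((3 * M + 1) * B * Real.sqrt N) := by
        rw [Finset.sum_add_distrib]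
        linarith

/-- Monte Carlo approximation, uniformly over the cube, of a mean of weighted ReLU features. -/
lemma IsTameWeight.lintegral_iSup_le (hh : IsTameWeight M B h) (hd : 1 ≤ d) (hM : 0 ≤ M) {N : ℕ}
    (hN : 1 ≤ N) (κ : Measure (EuclideanSpace ℝ (Fin d) × ℝ)) [IsProbabilityMeasure κ]
    {H : EuclideanSpace ℝ (Fin d) → ℝ} (hHc : Continuous H)
    (hH : ∀ x ∈ cube d M, H x = ∫ z, h z * relu (inner ℝ z.1 x + z.2) ∂κ) :
    ∫⁻ z : Fin N → EuclideanSpace ℝ (Fin d) × ℝ, ⨆ x ∈ cube d M, ENNReal.ofReal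
        |∑ i, h (z i) / N * relu (inner ℝ (z i).1 x + (z i).2) - H x| ∂(Measure.pi fun _ => κ)
      ≤ ENNReal.ofReal ((6 * M + 2) * B / Real.sqrt N) := by
  have hB := hh.nonneg
  have hN' : (0 : ℝ) < N := by exact_mod_cast hN
  have hrelu := continuous_relu
  let o : cube d M := ⟨0, fun j => by simpa using hM⟩
  have : Nonempty (cube d M) := ⟨o⟩
  classical
  let e : ℕ → cube d M := TopologicalSpace.denseSeq (cube d M)
  let T : ℕ → Finset (cube d M) := fun n => insert o ((Finset.range n).image e)
  have hT : ∀ n, (T n).Nonempty := fun n => ⟨o, Finset.mem_insert_self _ _⟩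
  have hTmono : Monotone T := fun m n hmn =>
    Finset.insert_subset_insert _ (Finset.image_subset_image (Finset.range_mono hmn))
  let G : (Fin N → EuclideanSpace ℝ (Fin d) × ℝ) → EuclideanSpace ℝ (Fin d) → ℝ := fun z x =>
    ∑ i, h (z i) / N * relu (inner ℝ (z i).1 x + (z i).2) - H x
  have hGm : ∀ x, Measurable fun z => G z x := fun x => by
    have hm := measurable_weight_mul_relu hh.measurable x
    refine (Finset.measurable_sum _ fun i _ => ?_).sub_const _
    have : (fun z : Fin N → EuclideanSpace ℝ (Fin d) × ℝ =>
        h (z i) / N * relu (inner ℝ (z i).1 x + (z i).2))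
        = fun z => (fun y : EuclideanSpace ℝ (Fin d) × ℝ =>
          h y * relu (inner ℝ y.1 x + y.2)) (z i) / N := by
      ext z; ring
    rw [this]
    exact (hm.comp (measurable_pi_apply i)).div_const _
  -- by continuity, the supremum is the limit of maxima over finite sets
  have hsup : ∀ z, (⨆ x ∈ cube d M, ENNReal.ofReal |G z x|)
      ≤ ⨆ n, ENNReal.ofReal ((T n).sup' (hT n) fun x => |G z x|) := by
    intro z
    refine iSup₂_le fun x hx => ?_
    have hcont : Continuous fun y : cube d M => ENNReal.ofReal |G z y| := by
      refine ENNReal.continuous_ofReal.comp ?_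
      simp only [G]
      fun_prop
    have hdense : DenseRange e := TopologicalSpace.denseRange_denseSeq _
    refine hdense.induction_on (p := fun y : cube d M => ENNReal.ofReal |G z y|
      ≤ ⨆ n, ENNReal.ofReal ((T n).sup' (hT n) fun x => |G z x|)) ⟨x, hx⟩
      (isClosed_le hcont continuous_const) fun n => ?_
    refine le_iSup_of_le (n + 1) (ENNReal.ofReal_le_ofReal ?_)
    refine Finset.le_sup' (fun x : cube d M => |G z x|)
      (Finset.mem_insert_of_mem (Finset.mem_image_of_mem e ?_))
    simp
  refine (lintegral_mono hsup).trans ?_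
  rw [lintegral_iSup (fun n => (measurable_sup'_abs (T n) (hT n)
    (g := fun (x : cube d M) z => G z x) fun x => hGm x).ennreal_ofReal)
    (fun m n hmn z => ENNReal.ofReal_le_ofReal (Finset.sup'_mono _ (hTmono hmn) (hT m)))]
  refine iSup_le fun n => ?_
  have hdev := integral_sup'_deviation_le (T n) (hT n) (N := N) κ
    (fun (x : cube d M) z => h z * relu (inner ℝ z.1 (x : EuclideanSpace ℝ (Fin d)) + z.2))
    (fun x => measurable_weight_mul_relu hh.measurable _)
    (K := (2 * M + 1) * B) (fun x z => hh.abs_mul_relu_le hd hM x.2 z)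
    (S := (3 * M + 1) * B * Real.sqrt N)
    (hh.sum_signs_le hd hM (T n) (hT n) (Finset.mem_insert_self _ _) rfl)
  have hGeq : ∀ z (x : cube d M), (N : ℝ)⁻¹ * |∑ i, h (z i) * relu (inner ℝ (z i).1
      (x : EuclideanSpace ℝ (Fin d)) + (z i).2)
      - N * ∫ y, h y * relu (inner ℝ y.1 (x : EuclideanSpace ℝ (Fin d)) + y.2) ∂κ| = |G z x| := by
    intro z x
    rw [← hH x x.2, ← abs_of_pos (inv_pos.2 hN'), ← abs_mul]
    congr 1
    simp only [G]
    rw [mul_sub, Finset.mul_sum]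
    congr 1
    · exact Finset.sum_congr rfl fun i _ => by ring
    · field_simp
  have hGs : ∀ z, (T n).sup' (hT n) (fun x => |G z x|) = (N : ℝ)⁻¹ *
      (T n).sup' (hT n) fun x => |∑ i, h (z i) * relu (inner ℝ (z i).1
      (x : EuclideanSpace ℝ (Fin d)) + (z i).2)
      - N * ∫ y, h y * relu (inner ℝ y.1 (x : EuclideanSpace ℝ (Fin d)) + y.2) ∂κ| := by
    intro z
    rw [Finset.mul₀_sup' (inv_pos.2 hN').le]
    simp_rw [hGeq]
  have hGnn : ∀ z, 0 ≤ (T n).sup' (hT n) fun x => |G z x| := fun z =>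
    (abs_nonneg (G z o)).trans (Finset.le_sup' (fun x : cube d M => |G z x|)
      (Finset.mem_insert_self _ _))
  have hGi : Integrable (fun z => (T n).sup' (hT n) fun x => |G z x|)
      (Measure.pi fun _ : Fin N => κ) := by
    simp_rw [hGs]
    exact (integrable_sup'_deviation (T n) (hT n) (N := N) κ
      (fun (x : cube d M) z => h z * relu (inner ℝ z.1 (x : EuclideanSpace ℝ (Fin d)) + z.2))
      (fun x => measurable_weight_mul_relu hh.measurable _)
      (K := (2 * M + 1) * B) (fun x z => hh.abs_mul_relu_le hd hM x.2 z)).const_mul _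
  rw [← ofReal_integral_eq_lintegral_ofReal hGi (ae_of_all _ hGnn)]
  refine ENNReal.ofReal_le_ofReal ?_
  simp_rw [hGs]
  rw [integral_const_mul]
  refine (mul_le_mul_of_nonneg_left hdev (inv_pos.2 hN').le).trans (le_of_eq ?_)
  have hs : Real.sqrt N * Real.sqrt N = N := Real.mul_self_sqrt hN'.le
  have hs0 : 0 < Real.sqrt N := Real.sqrt_pos.2 hN'
  rw [inv_mul_eq_div, div_eq_div_iff hN'.ne' hs0.ne']
  linear_combination (6 * M + 2) * B * hs

end UniformApproximation

/-! ### Moments of the hidden weights and variance of means -/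

section StudentMoment

lemma lintegral_rpow_mul_exp_neg {a r : ℝ} (ha : 0 < a) (hr : 0 < r) :
    ∫⁻ t in Set.Ioi (0 : ℝ), ENNReal.ofReal (t ^ (a - 1) * Real.exp (-(r * t)))
      = ENNReal.ofReal ((1 / r) ^ a * Real.Gamma a) := by
  have h := Real.integral_rpow_mul_exp_neg_mul_Ioi ha hr
  have hG : 0 < Real.Gamma a := Real.Gamma_pos_of_pos ha
  have hint : Integrable (fun t : ℝ => t ^ (a - 1) * Real.exp (-(r * t)))
      (volume.restrict (Set.Ioi 0)) := by
    by_contra hn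
    rw [integral_undef hn] at h
    have : 0 < (1 / r) ^ a * Real.Gamma a := by positivity
    linarith
  rw [← ofReal_integral_eq_lintegral_ofReal hint, h]
  filter_upwards [self_mem_ae_restrict measurableSet_Ioi] with t ht
  have : (0 : ℝ) < t := ht
  positivity

lemma lintegral_exp_neg_mul_sq_norm {d : ℕ} {b : ℝ} (hb : 0 < b) :
    ∫⁻ x : EuclideanSpace ℝ (Fin d), ENNReal.ofReal (Real.exp (-b * ‖x‖ ^ 2))
      = ENNReal.ofReal ((Real.pi / b) ^ ((d : ℝ) / 2)) := by
  have h := GaussianFourier.integral_rexp_neg_mul_sq_norm (V := EuclideanSpace ℝ (Fin d)) hb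
  have hpi := Real.pi_pos
  rw [finrank_euclideanSpace_fin] at h
  rw [← h, ofReal_integral_eq_lintegral_ofReal _ (ae_of_all _ fun x => (Real.exp_pos _).le)]
  by_contra hn
  rw [integral_undef hn] at h
  have : 0 < (Real.pi / b) ^ ((d : ℝ) / 2) := by positivity
  linarith

/-- The normalisation of multivariate `t`-densities, obtained by writing the power as a Gamma
mixture of Gaussians. -/
lemma lintegral_one_add_sq_rpow {d : ℕ} {ν β : ℝ} (hν : 0 < ν) (hβ : (d : ℝ) / 2 < β) :
    ∫⁻ x : EuclideanSpace ℝ (Fin d), ENNReal.ofReal ((1 + ‖x‖ ^ 2 / ν) ^ (-β))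
      = ENNReal.ofReal ((Real.pi * ν) ^ ((d : ℝ) / 2) * Real.Gamma (β - d / 2) / Real.Gamma β) := by
  have hpi := Real.pi_pos
  have hβ0 : 0 < β := lt_of_le_of_lt (by positivity) hβ
  have hG : 0 < Real.Gamma β := Real.Gamma_pos_of_pos hβ0
  have hmix : ∀ x : EuclideanSpace ℝ (Fin d), ENNReal.ofReal ((1 + ‖x‖ ^ 2 / ν) ^ (-β))
      = ENNReal.ofReal (Real.Gamma β)⁻¹ * ∫⁻ t in Set.Ioi (0 : ℝ),
        ENNReal.ofReal (t ^ (β - 1) * Real.exp (-((1 + ‖x‖ ^ 2 / ν) * t))) := by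
    intro x
    have hy : 0 < 1 + ‖x‖ ^ 2 / ν := by positivity
    rw [lintegral_rpow_mul_exp_neg hβ0 hy, ← ENNReal.ofReal_mul (by positivity)]
    congr 1
    rw [Real.rpow_neg hy.le, one_div, Real.inv_rpow hy.le]
    field_simp
  simp_rw [hmix]
  rw [lintegral_const_mul _ (by
    refine Measurable.lintegral_prod_right' (f := fun p : EuclideanSpace ℝ (Fin d) × ℝ =>
      ENNReal.ofReal (p.2 ^ (β - 1) * Real.exp (-((1 + ‖p.1‖ ^ 2 / ν) * p.2)))) ?_
    fun_prop),
    lintegral_lintegral_swap (by fun_prop)]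
  have hinner : ∀ t ∈ Set.Ioi (0 : ℝ), ∫⁻ x : EuclideanSpace ℝ (Fin d),
      ENNReal.ofReal (t ^ (β - 1) * Real.exp (-((1 + ‖x‖ ^ 2 / ν) * t)))
      = ENNReal.ofReal ((Real.pi * ν) ^ ((d : ℝ) / 2)) *
        ENNReal.ofReal (t ^ (β - d / 2 - 1) * Real.exp (-(1 * t))) := by
    intro t (ht : 0 < t)
    have e1 : ∀ x : EuclideanSpace ℝ (Fin d),
        ENNReal.ofReal (t ^ (β - 1) * Real.exp (-((1 + ‖x‖ ^ 2 / ν) * t)))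
        = ENNReal.ofReal (t ^ (β - 1) * Real.exp (-t)) *
          ENNReal.ofReal (Real.exp (-(t / ν) * ‖x‖ ^ 2)) := by
      intro x
      rw [← ENNReal.ofReal_mul (by positivity), mul_assoc, ← Real.exp_add]
      congr 3; ring
    simp_rw [e1]
    rw [lintegral_const_mul _ (by fun_prop), lintegral_exp_neg_mul_sq_norm (by positivity),
      ← ENNReal.ofReal_mul (by positivity), ← ENNReal.ofReal_mul (by positivity)]
    congr 1
    have : Real.pi / (t / ν) = Real.pi * ν / t := by field_simp
    rw [this, Real.div_rpow (by positivity) ht.le, one_mul]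
    have h2 : t ^ (β - d / 2 - 1) = t ^ (β - 1) / t ^ ((d : ℝ) / 2) := by
      rw [← Real.rpow_sub ht]; congr 1; ring
    rw [h2]
    field_simp
  rw [setLIntegral_congr_fun measurableSet_Ioi hinner,
    lintegral_const_mul _ (by fun_prop), lintegral_rpow_mul_exp_neg (by linarith) one_pos,
    ← ENNReal.ofReal_mul (by positivity), ← ENNReal.ofReal_mul (by positivity)]
  congr 1
  simp
  field_simp

/-- The second moment of the `t`-distribution grows linearly with the dimension. -/
lemma lintegral_sq_norm_studentMeasure_le {d : ℕ} (hd : 1 ≤ d) {ν : ℝ} (hν : 2 < ν) :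
    ∫⁻ x, ENNReal.ofReal (‖x‖ ^ 2) ∂studentMeasure d ν ≤ ENNReal.ofReal (d * (ν ^ 2 / (ν - 2))) := by
  have hpi := Real.pi_pos
  have hν0 : 0 < ν := by linarith
  have hd' : (1 : ℝ) ≤ d := by exact_mod_cast hd
  have hm := measurable_studentDensity d ν
  set β : ℝ := (ν + d) / 2 - 1 with hβ
  have hβ1 : (d : ℝ) / 2 < β := by rw [hβ]; linarith
  have hβ0 : 0 < β := by linarith
  set c : ℝ := Real.Gamma ((ν + d) / 2) /
      (Real.Gamma (ν / 2) * ν ^ ((d : ℝ) / 2) * Real.pi ^ ((d : ℝ) / 2)) with hc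
  have hG0 : 0 < Real.Gamma (ν / 2) := Real.Gamma_pos_of_pos (by positivity)
  have hG1 : 0 < Real.Gamma ((ν + d) / 2) := Real.Gamma_pos_of_pos (by positivity)
  have hG2 : 0 < Real.Gamma (ν / 2 - 1) := Real.Gamma_pos_of_pos (by linarith)
  have hG3 : 0 < Real.Gamma β := Real.Gamma_pos_of_pos hβ0
  have hc0 : 0 < c := by positivity
  rw [studentMeasure, lintegral_withDensity_eq_lintegral_mul _ (by fun_prop) (by fun_prop)]
  calc ∫⁻ x : EuclideanSpace ℝ (Fin d), ((fun x : EuclideanSpace ℝ (Fin d) =>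
          ENNReal.ofReal (studentDensity d ν x)) *
          (fun x : EuclideanSpace ℝ (Fin d) => ENNReal.ofReal (‖x‖ ^ 2))) x
      ≤ ∫⁻ x : EuclideanSpace ℝ (Fin d), ENNReal.ofReal (ν * c) *
          ENNReal.ofReal ((1 + ‖x‖ ^ 2 / ν) ^ (-β)) := by
        refine lintegral_mono fun x => ?_
        have hs : 0 < 1 + ‖x‖ ^ 2 / ν := by positivity
        rw [Pi.mul_apply, ← ENNReal.ofReal_mul (studentDensity_pos hν0 x).le,
          ← ENNReal.ofReal_mul (by positivity)]
        refine ENNReal.ofReal_le_ofReal ?_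
        have h1 : ‖x‖ ^ 2 ≤ ν * (1 + ‖x‖ ^ 2 / ν) := by
          have : ν * (1 + ‖x‖ ^ 2 / ν) = ν + ‖x‖ ^ 2 := by field_simp
          linarith
        have h2 : (1 + ‖x‖ ^ 2 / ν) ^ (-β)
            = (1 + ‖x‖ ^ 2 / ν) ^ (-((ν + d) / 2)) * (1 + ‖x‖ ^ 2 / ν) := by
          rw [← Real.rpow_add_one hs.ne']; congr 1; rw [hβ]; ring
        calc studentDensity d ν x * ‖x‖ ^ 2
            ≤ studentDensity d ν x * (ν * (1 + ‖x‖ ^ 2 / ν)) :=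
              mul_le_mul_of_nonneg_left h1 (studentDensity_pos hν0 x).le
          _ = ν * c * (1 + ‖x‖ ^ 2 / ν) ^ (-β) := by
              rw [h2]; unfold studentDensity; rw [← hc]; ring
    _ = ENNReal.ofReal (ν * (β / (ν / 2 - 1))) := by
        rw [lintegral_const_mul _ (by fun_prop), lintegral_one_add_sq_rpow hν0 hβ1,
          ← ENNReal.ofReal_mul (by positivity)]
        congr 1
        have e1 : Real.Gamma ((ν + d) / 2) = β * Real.Gamma β := by
          rw [← Real.Gamma_add_one hβ0.ne']; congr 1; rw [hβ]; ring
        have e2 : Real.Gamma (ν / 2) = (ν / 2 - 1) * Real.Gamma (ν / 2 - 1) := by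
          rw [← Real.Gamma_add_one (by linarith)]; congr 1; ring
        have e3 : β - d / 2 = ν / 2 - 1 := by rw [hβ]; ring
        have e4 : 0 < ν / 2 - 1 := by linarith
        rw [e3, hc, e1, e2, Real.mul_rpow hpi.le hν0.le]
        generalize Real.Gamma (ν / 2 - 1) = G at *
        generalize ν / 2 - 1 = w at *
        field_simp
    _ ≤ ENNReal.ofReal (d * (ν ^ 2 / (ν - 2))) := by
        refine ENNReal.ofReal_le_ofReal ?_
        have e4 : 0 < ν - 2 := by linarith
        have : ν * (β / (ν / 2 - 1)) = ν * (ν + d - 2) / (ν - 2) := by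
          rw [hβ]; field_simp
        rw [this, mul_div_assoc', div_le_div_iff_of_pos_right e4]
        have h5 := mul_nonneg (by linarith : (0 : ℝ) ≤ ν - 1) (by linarith : (0 : ℝ) ≤ d - 1)
        nlinarith

end StudentMoment

section IndependentSums

variable {E : Type*} [MeasurableSpace E]

/-- Deviation of the empirical mean of `g` over the sample `s` from the mean under `μ`. -/
def empDev {n : ℕ} (μ : Measure E) (s : Fin n → E) (g : E → ℝ) : ℝ :=
  (1 / (n : ℝ)) * ∑ i, g (s i) - ∫ z, g z ∂μ

/-- The mean of `n` independent copies has mean square deviation at most `1 / n` times the second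
moment. -/
lemma integral_empDev_sq_le {n : ℕ} (hn : 1 ≤ n) (κ : Measure E) [IsProbabilityMeasure κ]
    {g : E → ℝ} (hg : MemLp g 2 κ) :
    Integrable (fun z : Fin n → E => empDev κ z g ^ 2) (Measure.pi fun _ => κ) ∧
    ∫ z : Fin n → E, empDev κ z g ^ 2 ∂(Measure.pi fun _ => κ)
      ≤ (1 / (n : ℝ)) * ∫ y, g y ^ 2 ∂κ := by
  unfold empDev
  have hn' : (0 : ℝ) < n := by exact_mod_cast hn
  have hgi : ∀ i : Fin n, MemLp (fun z : Fin n → E => g (z i)) 2 (Measure.pi fun _ => κ) :=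
    fun i => hg.comp_measurePreserving (measurePreserving_eval (fun _ : Fin n => κ) i)
  have hsum : MemLp (fun z : Fin n → E => (1 / (n : ℝ)) * ∑ i, g (z i)) 2
      (Measure.pi fun _ => κ) := (memLp_finsetSum _ fun i _ => hgi i).const_mul _
  have hmean : ∫ z : Fin n → E, (1 / (n : ℝ)) * ∑ i, g (z i) ∂(Measure.pi fun _ => κ)
      = ∫ y, g y ∂κ := by
    rw [integral_const_mul, integral_finsetSum _ fun i _ => (hgi i).integrable one_le_two]
    have : ∀ i : Fin n, ∫ z : Fin n → E, g (z i) ∂(Measure.pi fun _ => κ) = ∫ y, g y ∂κ :=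
      fun i => integral_comp_eval (μ := fun _ : Fin n => κ) hg.aestronglyMeasurable
    simp only [this, Finset.sum_const, Finset.card_univ, Fintype.card_fin, nsmul_eq_mul]
    field_simp
  refine ⟨(hsum.sub (memLp_const _)).integrable_sq, ?_⟩
  have hvar := variance_sum_pi (μ := fun _ : Fin n => κ) (X := fun _ => g) (fun _ => hg)
  have h1 : ∫ z : Fin n → E, ((1 / (n : ℝ)) * ∑ i, g (z i) - ∫ y, g y ∂κ) ^ 2
      ∂(Measure.pi fun _ => κ) = Var[fun z : Fin n → E => (1 / (n : ℝ)) * ∑ i, g (z i);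
        Measure.pi fun _ => κ] := by
    rw [variance_eq_integral hsum.aestronglyMeasurable.aemeasurable, hmean]
  have h2 : (∑ i : Fin n, fun ω : Fin n → E => g (ω i)) = fun ω => ∑ i, g (ω i) := by
    ext ω; simp
  rw [h2] at hvar
  rw [h1, variance_const_mul, hvar]
  simp only [Finset.sum_const, Finset.card_univ, Fintype.card_fin, nsmul_eq_mul]
  have h3 : Var[g; κ] ≤ ∫ y, g y ^ 2 ∂κ := variance_le_expectation_sq hg.aestronglyMeasurable
  calc (1 / (n : ℝ)) ^ 2 * (n * Var[g; κ]) = (1 / (n : ℝ)) * Var[g; κ] := by field_simp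
    _ ≤ _ := by gcongr

/-- Two independent families of i.i.d. variables form an i.i.d. family of pairs. -/
lemma map_pair_eq_pi {Ω F : Type*} [MeasurableSpace Ω] [MeasurableSpace F] {P : Measure Ω}
    [IsProbabilityMeasure P] {N : ℕ} {A : Fin N → Ω → E} {B : Fin N → Ω → F}
    (hA : ∀ i, Measurable (A i)) (hB : ∀ i, Measurable (B i)) {α : Measure E} {β : Measure F}
    [IsProbabilityMeasure α] [IsProbabilityMeasure β]
    (hα : ∀ i, P.map (A i) = α) (hβ : ∀ i, P.map (B i) = β)
    (hiA : iIndepFun A P) (hiB : iIndepFun B P)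
    (hAB : IndepFun (fun ω i => A i ω) (fun ω i => B i ω) P) :
    P.map (fun ω i => (A i ω, B i ω)) = Measure.pi fun _ => α.prod β := by
  have h1 := (iIndepFun_iff_map_fun_eq_pi_map fun i => (hA i).aemeasurable).1 hiA
  have h2 := (iIndepFun_iff_map_fun_eq_pi_map fun i => (hB i).aemeasurable).1 hiB
  have h3 := (indepFun_iff_map_prod_eq_prod_map_map (measurable_pi_lambda _ hA).aemeasurable
    (measurable_pi_lambda _ hB).aemeasurable).1 hAB
  rw [h1, h2] at h3
  simp only [hα, hβ] at h3
  have harrow := (measurePreserving_arrowProdEquivProdArrow E F (Fin N) (fun _ => α)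
    (fun _ => β)).symm
  rw [← harrow.map_eq, ← h3, Measure.map_map (MeasurableEquiv.measurable _)
    ((measurable_pi_lambda _ hA).prodMk (measurable_pi_lambda _ hB))]
  rfl

end IndependentSums

/-! ### The quadratic process of constrained least squares -/

section QuadraticProcess

variable {Z ι : Type*} [MeasurableSpace Z] [Fintype ι]

/-- Sum of squared empirical deviations of the features. -/
def linDev {n : ℕ} (μ : Measure Z) (ζ : ι → Z → ℝ) (s : Fin n → Z) : ℝ :=
  ∑ j, empDev μ s (ζ j) ^ 2

/-- Sum of squared empirical deviations of the products of two features. -/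
def quadDev {n : ℕ} (μ : Measure Z) (ζ : ι → Z → ℝ) (s : Fin n → Z) : ℝ :=
  ∑ j, ∑ k, empDev μ s (fun z => ζ j z * ζ k z) ^ 2

lemma sum_mul_le_of_sq_le {c : ι → ℝ} {e : ι → ℝ} {K : ℝ} (hc : ∑ j, c j ^ 2 ≤ K) :
    (∑ j, c j * e j) ^ 2 ≤ K * ∑ j, e j ^ 2 :=
  (Finset.sum_mul_sq_le_sq_mul_sq _ _ _).trans
    (mul_le_mul_of_nonneg_right hc (Finset.sum_nonneg fun _ _ => sq_nonneg _))

/-- The empirical deviation of a quadratic functional is controlled, uniformly over the coefficients,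
by the deviations of the features and of their products. The free parameters `r` and `T` balance the
products of a coefficient and a deviation; `r` will be `√n`, and `T` the size of the features. -/
lemma integral_sq_le_empirical {n : ℕ} (hn : 1 ≤ n) (μ : Measure Z) [IsProbabilityMeasure μ]
    {ζ : ι → Z → ℝ} (hζ : ∀ j, MemLp (ζ j) 2 μ) (s : Fin n → Z) (c : ℝ) {θ : ι → ℝ}
    (hθ : ∑ j, θ j ^ 2 ≤ 2) {r T : ℝ} (hr : 0 < r) (hT : 0 < T) :
    ∫ z, (c + ∑ j, θ j * ζ j z) ^ 2 ∂μ
      ≤ (1 / (n : ℝ)) * ∑ i, (c + ∑ j, θ j * ζ j (s i)) ^ 2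
        + (c ^ 2 / r + 2 * r * linDev μ ζ s + T / r + r * quadDev μ ζ s / T) := by
  have hn' : (0 : ℝ) < n := by exact_mod_cast hn
  have hexp : ∀ z, (c + ∑ j, θ j * ζ j z) ^ 2
      = c ^ 2 + 2 * c * ∑ j, θ j * ζ j z + ∑ j, ∑ k, θ j * θ k * (ζ j z * ζ k z) := by
    intro z
    have : (∑ j, θ j * ζ j z) ^ 2 = ∑ j, ∑ k, θ j * θ k * (ζ j z * ζ k z) := by
      rw [sq, Finset.sum_mul_sum]
      exact Finset.sum_congr rfl fun j _ => Finset.sum_congr rfl fun k _ => by ring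
    rw [← this]; ring
  have hi1 : ∀ j, Integrable (ζ j) μ := fun j => (hζ j).integrable one_le_two
  have hi2 : ∀ j k, Integrable (fun z => ζ j z * ζ k z) μ := fun j k =>
    (hζ j).integrable_mul (hζ k)
  have hI : ∫ z, (c + ∑ j, θ j * ζ j z) ^ 2 ∂μ = c ^ 2 + 2 * c * ∑ j, θ j * ∫ z, ζ j z ∂μ
      + ∑ j, ∑ k, θ j * θ k * ∫ z, ζ j z * ζ k z ∂μ := by
    simp_rw [hexp]
    have a1 : Integrable (fun z => ∑ j, θ j * ζ j z) μ :=
      integrable_finsetSum _ fun j _ => (hi1 j).const_mul _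
    have a2 : Integrable (fun z => ∑ j, ∑ k, θ j * θ k * (ζ j z * ζ k z)) μ :=
      integrable_finsetSum _ fun j _ => integrable_finsetSum _ fun k _ => (hi2 j k).const_mul _
    have a0 : Integrable (fun z => c ^ 2 + 2 * c * ∑ j, θ j * ζ j z) μ :=
      (integrable_const _).add (a1.const_mul _)
    rw [integral_add a0 a2,
      integral_add (integrable_const _) (a1.const_mul _), integral_const_mul,
      integral_finsetSum _ fun j _ => (hi1 j).const_mul _,
      integral_finsetSum _ fun j _ => integrable_finsetSum _ fun k _ => (hi2 j k).const_mul _]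
    simp only [integral_const, probReal_univ, one_smul, integral_const_mul]
    congr 1
    refine Finset.sum_congr rfl fun j _ => ?_
    rw [integral_finsetSum _ fun k _ => (hi2 j k).const_mul _]
    simp only [integral_const_mul]
  have hE : (1 / (n : ℝ)) * ∑ i, (c + ∑ j, θ j * ζ j (s i)) ^ 2
      = c ^ 2 + 2 * c * ∑ j, θ j * ((1 / (n : ℝ)) * ∑ i, ζ j (s i))
      + ∑ j, ∑ k, θ j * θ k * ((1 / (n : ℝ)) * ∑ i, ζ j (s i) * ζ k (s i)) := by
    simp_rw [hexp]
    rw [Finset.sum_add_distrib, Finset.sum_add_distrib, mul_add, mul_add]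
    congr 1
    · congr 1
      · simp; field_simp
      · rw [← Finset.mul_sum, Finset.sum_comm, Finset.mul_sum, Finset.mul_sum, Finset.mul_sum]
        refine Finset.sum_congr rfl fun j _ => ?_
        rw [← Finset.mul_sum]; ring
    · rw [Finset.sum_comm, Finset.mul_sum]
      refine Finset.sum_congr rfl fun j _ => ?_
      rw [Finset.sum_comm, Finset.mul_sum]
      refine Finset.sum_congr rfl fun k _ => ?_
      rw [← Finset.mul_sum]; ring
  set L : ℝ := ∑ j, θ j * empDev μ s (ζ j) with hL
  set Q : ℝ := ∑ j, ∑ k, θ j * θ k * empDev μ s (fun z => ζ j z * ζ k z) with hQ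
  have hdiff : ∫ z, (c + ∑ j, θ j * ζ j z) ^ 2 ∂μ
      = (1 / (n : ℝ)) * ∑ i, (c + ∑ j, θ j * ζ j (s i)) ^ 2 - (2 * c * L + Q) := by
    rw [hI, hE, hL, hQ]
    simp only [empDev, mul_sub, Finset.sum_sub_distrib]
    ring
  have hL2 : L ^ 2 ≤ 2 * linDev μ ζ s := sum_mul_le_of_sq_le hθ
  have hQ2 : Q ^ 2 ≤ 4 * quadDev μ ζ s := by
    have hθ2 : ∑ p : ι × ι, (θ p.1 * θ p.2) ^ 2 ≤ 4 := by
      have : ∑ p : ι × ι, (θ p.1 * θ p.2) ^ 2 = (∑ j, θ j ^ 2) * ∑ k, θ k ^ 2 := by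
        rw [Fintype.sum_prod_type, Finset.sum_mul_sum]
        simp only [mul_pow]
      rw [this]
      have h0 : 0 ≤ ∑ j, θ j ^ 2 := Finset.sum_nonneg fun _ _ => sq_nonneg _
      nlinarith
    have := sum_mul_le_of_sq_le (e := fun p : ι × ι => empDev μ s (fun z => ζ p.1 z * ζ p.2 z)) hθ2
    rw [Fintype.sum_prod_type, Fintype.sum_prod_type] at this
    exact this
  -- completing the squares separates the coefficients from the deviations
  have h1 : -(2 * c * L) ≤ c ^ 2 / r + r * L ^ 2 := by
    have : c ^ 2 / r + r * L ^ 2 + 2 * c * L = (c + r * L) ^ 2 / r := by field_simp; ring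
    have h2 : 0 ≤ (c + r * L) ^ 2 / r := by positivity
    linarith
  have h2 : -Q ≤ T / r + r * (Q ^ 2 / 4) / T := by
    have : T / r + r * (Q ^ 2 / 4) / T + Q = (T + r * Q / 2) ^ 2 / (r * T) := by field_simp; ring
    have h2 : 0 ≤ (T + r * Q / 2) ^ 2 / (r * T) := by positivity
    linarith
  have h3 : r * L ^ 2 ≤ 2 * r * linDev μ ζ s := by nlinarith
  have h4 : r * (Q ^ 2 / 4) / T ≤ r * quadDev μ ζ s / T := by
    gcongr; linarith
  rw [hdiff]
  linarith

lemma integral_linDev_le {n : ℕ} (hn : 1 ≤ n) (μ : Measure Z) [IsProbabilityMeasure μ]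
    {ζ : ι → Z → ℝ} (hζ : ∀ j, MemLp (ζ j) 2 μ) :
    Integrable (linDev (n := n) μ ζ) (Measure.pi fun _ => μ) ∧
    ∫ s, linDev (n := n) μ ζ s ∂(Measure.pi fun _ => μ)
      ≤ (1 / (n : ℝ)) * ∫ z, ∑ j, ζ j z ^ 2 ∂μ := by
  have h := fun j => integral_empDev_sq_le hn μ (hζ j)
  refine ⟨integrable_finsetSum _ fun j _ => (h j).1, ?_⟩
  unfold linDev
  rw [integral_finsetSum _ fun j _ => (h j).1, integral_finsetSum _ fun j _ => (hζ j).integrable_sq,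
    Finset.mul_sum]
  exact Finset.sum_le_sum fun j _ => (h j).2

lemma integral_quadDev_le {n : ℕ} (hn : 1 ≤ n) (μ : Measure Z) [IsProbabilityMeasure μ]
    {ζ : ι → Z → ℝ} (hζ : ∀ j k, MemLp (fun z => ζ j z * ζ k z) 2 μ) :
    Integrable (quadDev (n := n) μ ζ) (Measure.pi fun _ => μ) ∧
    ∫ s, quadDev (n := n) μ ζ s ∂(Measure.pi fun _ => μ)
      ≤ (1 / (n : ℝ)) * ∫ z, (∑ j, ζ j z ^ 2) ^ 2 ∂μ := by
  have h := fun j k => integral_empDev_sq_le hn μ (hζ j k)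
  have hi : ∀ j, Integrable (fun s : Fin n → Z =>
      ∑ k, empDev μ s (fun z => ζ j z * ζ k z) ^ 2) (Measure.pi fun _ => μ) :=
    fun j => integrable_finsetSum _ fun k _ => (h j k).1
  refine ⟨integrable_finsetSum _ fun j _ => hi j, ?_⟩
  have hsq : ∀ z, (∑ j, ζ j z ^ 2) ^ 2 = ∑ j, ∑ k, (ζ j z * ζ k z) ^ 2 := by
    intro z
    rw [sq, Finset.sum_mul_sum]
    simp only [mul_pow]
  unfold quadDev
  simp_rw [hsq]
  rw [integral_finsetSum _ fun j _ => hi j, integral_finsetSum _ fun j _ =>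
    integrable_finsetSum _ fun k _ => (hζ j k).integrable_sq, Finset.mul_sum]
  refine Finset.sum_le_sum fun j _ => ?_
  rw [integral_finsetSum _ fun k _ => (h j k).1, integral_finsetSum _ fun k _ =>
    (hζ j k).integrable_sq, Finset.mul_sum]
  exact Finset.sum_le_sum fun k _ => (h j k).2

end QuadraticProcess

section FixedDesign

variable {d N : ℕ} {M lam : ℝ} (a : Fin N → EuclideanSpace ℝ (Fin d)) (b : Fin N → ℝ)

/-- The ReLU feature with its value at the origin subtracted. -/
def centredFeature (i : Fin N) (x : EuclideanSpace ℝ (Fin d)) : ℝ :=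
  relu (inner ℝ (a i) x + b i) - relu (b i)

/-- The features in which the prediction error of a network is linear, up to its value at the
origin: the response and the centred ReLU features, scaled by the weight constraint `lam`. -/
def riskFeature (lam : ℝ) : Option (Fin N) → EuclideanSpace ℝ (Fin d) × ℝ → ℝ
  | none, z => z.2
  | some i, z => lam * centredFeature a b i z.1

/-- The coefficients of the prediction error in the features `riskFeature`. -/
def riskCoeff (lam : ℝ) (w : EuclideanSpace ℝ (Fin N)) : Option (Fin N) → ℝ
  | none => -1
  | some i => w i / lam

/-- A bound for the square of a centred network on the cube. -/
def sizeSq (M lam : ℝ) : ℝ := lam ^ 2 * (M ^ 2 * d * ∑ i, ‖a i‖ ^ 2)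

lemma sizeSq_nonneg : 0 ≤ sizeSq a M lam := by unfold sizeSq; positivity

lemma continuous_centredFeature (i : Fin N) : Continuous (centredFeature a b i) := by
  have := continuous_relu
  unfold centredFeature; fun_prop

lemma continuous_network (w : EuclideanSpace ℝ (Fin N)) : Continuous (network a b w) := by
  have := continuous_relu
  unfold network; fun_prop

lemma network_zero (x : EuclideanSpace ℝ (Fin d)) : network a b 0 x = 0 := by simp [network]

lemma network_eq_add_centred (w : EuclideanSpace ℝ (Fin N)) (x : EuclideanSpace ℝ (Fin d)) :
    network a b w x = ∑ i, w i * relu (b i) + ∑ i, w i * centredFeature a b i x := by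
  rw [← Finset.sum_add_distrib]
  exact Finset.sum_congr rfl fun i _ => by unfold centredFeature; ring

lemma network_sub_eq (hlam : 0 < lam) (w : EuclideanSpace ℝ (Fin N))
    (z : EuclideanSpace ℝ (Fin d) × ℝ) :
    network a b w z.1 - z.2
      = ∑ i, w i * relu (b i) + ∑ j, riskCoeff lam w j * riskFeature a b lam j z := by
  rw [network_eq_add_centred, Fintype.sum_option]
  have : ∀ i, riskCoeff lam w (some i) * riskFeature a b lam (some i) z
      = w i * centredFeature a b i z.1 := fun i => by
    simp only [riskCoeff, riskFeature]; field_simp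
  simp only [this]
  simp only [riskCoeff, riskFeature]
  ring

lemma sum_riskCoeff_sq_le (hlam : 0 < lam) {w : EuclideanSpace ℝ (Fin N)} (hw : ‖w‖ ≤ lam) :
    ∑ j, riskCoeff lam w j ^ 2 ≤ 2 := by
  rw [Fintype.sum_option]
  simp only [riskCoeff, div_pow]
  rw [← Finset.sum_div]
  have h1 : ∑ i, w i ^ 2 = ‖w‖ ^ 2 := by rw [EuclideanSpace.real_norm_sq_eq]
  have h2 : ‖w‖ ^ 2 / lam ^ 2 ≤ 1 := by
    rw [div_le_one (by positivity)]; gcongr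
  rw [h1]; linarith

lemma sum_centredFeature_sq_le (hM : 0 ≤ M) {x : EuclideanSpace ℝ (Fin d)} (hx : x ∈ cube d M) :
    ∑ i, centredFeature a b i x ^ 2 ≤ M ^ 2 * d * ∑ i, ‖a i‖ ^ 2 := by
  rw [Finset.mul_sum]
  refine Finset.sum_le_sum fun i _ => ?_
  have h1 : |centredFeature a b i x| ≤ M * Real.sqrt d * ‖a i‖ := by
    refine (abs_relu_sub_relu_le _ _).trans ?_
    rw [add_sub_cancel_right]
    exact abs_inner_le_of_mem_cube hM hx (a i)
  calc centredFeature a b i x ^ 2 = |centredFeature a b i x| ^ 2 := (sq_abs _).symm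
    _ ≤ (M * Real.sqrt d * ‖a i‖) ^ 2 := by gcongr
    _ = _ := by rw [mul_pow, mul_pow, Real.sq_sqrt (by positivity)]

lemma sum_riskFeature_sq_le (hM : 0 ≤ M) {z : EuclideanSpace ℝ (Fin d) × ℝ}
    (hz : z.1 ∈ cube d M) :
    ∑ j, riskFeature a b lam j z ^ 2 ≤ sizeSq a M lam + z.2 ^ 2 := by
  rw [Fintype.sum_option]
  simp only [riskFeature, mul_pow, sizeSq]
  rw [← Finset.mul_sum, add_comm]
  gcongr
  exact sum_centredFeature_sq_le a b hM hz

lemma sq_centred_network_le (hM : 0 ≤ M) {w : EuclideanSpace ℝ (Fin N)} (hw : ‖w‖ ≤ lam)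
    {x : EuclideanSpace ℝ (Fin d)} (hx : x ∈ cube d M) :
    (∑ i, w i * centredFeature a b i x) ^ 2 ≤ sizeSq a M lam := by
  refine (sum_mul_le_of_sq_le (K := lam ^ 2) ?_).trans
    (mul_le_mul_of_nonneg_left (sum_centredFeature_sq_le a b hM hx) (sq_nonneg _))
  have h1 : ∑ i, w i ^ 2 = ‖w‖ ^ 2 := by rw [EuclideanSpace.real_norm_sq_eq]
  rw [h1]; gcongr

/-- The value at the origin of a network which fits the sample at least as well as the zero
network. No moment of the biases is needed: a large value at the origin would be visible in the
empirical risk. -/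
lemma sq_origin_le {n : ℕ} (hn : 1 ≤ n) (hM : 0 ≤ M) {w : EuclideanSpace ℝ (Fin N)}
    (hw : ‖w‖ ≤ lam) {s : Fin n → EuclideanSpace ℝ (Fin d) × ℝ} (hs : ∀ i, (s i).1 ∈ cube d M)
    (hrisk : empiricalRisk s (network a b w) ≤ empiricalRisk s (network a b 0)) :
    (∑ i, w i * relu (b i)) ^ 2
      ≤ 2 * sizeSq a M lam + 8 * ((1 / (n : ℝ)) * ∑ i, (s i).2 ^ 2) := by
  have hn' : (0 : ℝ) < n := by exact_mod_cast hn
  set c := ∑ i, w i * relu (b i) with hc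
  unfold empiricalRisk at hrisk
  simp only [network_zero, zero_sub, neg_sq] at hrisk
  have hpt : ∀ i, c ^ 2 ≤ 4 * (network a b w (s i).1 - (s i).2) ^ 2 + 4 * (s i).2 ^ 2
      + 2 * sizeSq a M lam := by
    intro i
    have h1 := sq_centred_network_le a b hM hw (hs i)
    have h2 := network_eq_add_centred a b w (s i).1
    rw [← hc] at h2
    set g := ∑ i_1, w i_1 * centredFeature a b i_1 (s i).1
    have h3 : c = (network a b w (s i).1 - (s i).2) + (s i).2 - g := by rw [h2]; ring
    set u := network a b w (s i).1 - (s i).2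
    rw [h3]
    nlinarith [sq_nonneg (u + (s i).2 + g), sq_nonneg (u - (s i).2)]
  have hsum : (1 / (n : ℝ)) * ∑ _i : Fin n, c ^ 2 ≤ (1 / (n : ℝ)) * ∑ i,
      (4 * (network a b w (s i).1 - (s i).2) ^ 2 + 4 * (s i).2 ^ 2 + 2 * sizeSq a M lam) :=
    mul_le_mul_of_nonneg_left (Finset.sum_le_sum fun i _ => hpt i) (by positivity)
  have e1 : (1 / (n : ℝ)) * ∑ _i : Fin n, c ^ 2 = c ^ 2 := by simp; field_simp
  have e2 : (1 / (n : ℝ)) * ∑ i,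
      (4 * (network a b w (s i).1 - (s i).2) ^ 2 + 4 * (s i).2 ^ 2 + 2 * sizeSq a M lam)
      = 4 * ((1 / (n : ℝ)) * ∑ i, (network a b w (s i).1 - (s i).2) ^ 2)
        + 4 * ((1 / (n : ℝ)) * ∑ i, (s i).2 ^ 2) + 2 * sizeSq a M lam := by
    rw [Finset.sum_add_distrib, Finset.sum_add_distrib, ← Finset.mul_sum, ← Finset.mul_sum]
    simp
    field_simp
  rw [e1, e2] at hsum
  linarith

end FixedDesign

/-! ### Excess risk for fixed hidden weights -/

section ExcessRisk

variable {d N : ℕ} {M lam : ℝ}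

/-- The law `μ` of a data point `(X, Y)`: `X` lies in the cube, `Y` has a fourth moment, and `H` is a
bounded version of the regression function, in the form of orthogonality of the noise `H(X) - Y` to
bounded functions of `X`. -/
structure IsRegressionLaw (M : ℝ) (μ : Measure (EuclideanSpace ℝ (Fin d) × ℝ))
    (H : EuclideanSpace ℝ (Fin d) → ℝ) : Prop where
  mem_cube : ∀ᵐ z ∂μ, z.1 ∈ cube d M
  memLp : MemLp (fun z => z.2) 4 μ
  continuous : Continuous H
  bounded : ∃ K, ∀ x, |H x| ≤ K
  orthogonal : ∀ u : EuclideanSpace ℝ (Fin d) → ℝ, Measurable u →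
    (∃ K, ∀ x ∈ cube d M, |u x| ≤ K) → ∫ z, u z.1 * (H z.1 - z.2) ∂μ = 0

lemma abs_network_le (a : Fin N → EuclideanSpace ℝ (Fin d)) (b : Fin N → ℝ)
    (w : EuclideanSpace ℝ (Fin N)) (hM : 0 ≤ M) {x : EuclideanSpace ℝ (Fin d)}
    (hx : x ∈ cube d M) :
    |network a b w x| ≤ ∑ i, |w i| * (M * Real.sqrt d * ‖a i‖ + |b i|) := by
  refine (Finset.abs_sum_le_sum_abs _ _).trans (Finset.sum_le_sum fun i _ => ?_)
  rw [abs_mul, abs_of_nonneg (relu_nonneg _)]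
  gcongr
  exact (relu_le_abs _).trans ((abs_add_le _ _).trans
    (by linarith [abs_inner_le_of_mem_cube hM hx (a i)]))

lemma memLp_of_bounded_on_cube {μ : Measure (EuclideanSpace ℝ (Fin d) × ℝ)}
    [IsProbabilityMeasure μ] (hcube : ∀ᵐ z ∂μ, z.1 ∈ cube d M)
    {u : EuclideanSpace ℝ (Fin d) → ℝ} (hu : Measurable u) {K : ℝ}
    (hK : ∀ x ∈ cube d M, |u x| ≤ K) (p : ℝ≥0∞) : MemLp (fun z => u z.1) p μ := by
  refine MemLp.of_bound (hu.comp measurable_fst).aestronglyMeasurable K ?_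
  filter_upwards [hcube] with z hz using hK _ hz

/-- Pythagoras: the prediction error of `f` is its risk minus the risk of the regression
function. -/
lemma IsRegressionLaw.integral_sq_sub_eq {μ : Measure (EuclideanSpace ℝ (Fin d) × ℝ)}
    [IsProbabilityMeasure μ] {H : EuclideanSpace ℝ (Fin d) → ℝ} (hμ : IsRegressionLaw M μ H)
    {f : EuclideanSpace ℝ (Fin d) → ℝ} (hf : Measurable f) {K : ℝ}
    (hK : ∀ x ∈ cube d M, |f x| ≤ K) :
    ∫ z, (f z.1 - z.2) ^ 2 ∂μ = ∫ z, (H z.1 - f z.1) ^ 2 ∂μ + ∫ z, (H z.1 - z.2) ^ 2 ∂μ := by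
  obtain ⟨KH, hKH⟩ := hμ.bounded
  have hH := hμ.continuous.measurable
  have hHf : ∀ x ∈ cube d M, |H x - f x| ≤ KH + K := fun x hx =>
    (abs_sub _ _).trans (add_le_add (hKH x) (hK x hx))
  have m1 : MemLp (fun z : EuclideanSpace ℝ (Fin d) × ℝ => H z.1 - f z.1) 2 μ :=
    memLp_of_bounded_on_cube hμ.mem_cube (hH.sub hf) hHf 2
  have m2 : MemLp (fun z : EuclideanSpace ℝ (Fin d) × ℝ => H z.1 - z.2) 2 μ :=
    (memLp_of_bounded_on_cube hμ.mem_cube hH (fun x _ => hKH x) 2).sub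
      (hμ.memLp.mono_exponent (by norm_num))
  have horth := hμ.orthogonal (fun x => H x - f x) (hH.sub hf) ⟨_, hHf⟩
  have hcross : Integrable (fun z : EuclideanSpace ℝ (Fin d) × ℝ =>
      (H z.1 - f z.1) * (H z.1 - z.2)) μ := m1.integrable_mul m2
  have hexp : ∀ z : EuclideanSpace ℝ (Fin d) × ℝ, (f z.1 - z.2) ^ 2
      = (H z.1 - f z.1) ^ 2 + (H z.1 - z.2) ^ 2 - 2 * ((H z.1 - f z.1) * (H z.1 - z.2)) :=
    fun z => by ring
  simp_rw [hexp]
  have h12 : Integrable (fun z : EuclideanSpace ℝ (Fin d) × ℝ =>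
      (H z.1 - f z.1) ^ 2 + (H z.1 - z.2) ^ 2) μ := m1.integrable_sq.add m2.integrable_sq
  rw [integral_sub h12 (hcross.const_mul 2), integral_add m1.integrable_sq m2.integrable_sq,
    integral_const_mul, horth]
  ring

instance holderTriple_four_four_two : ENNReal.HolderTriple 4 4 2 := ⟨by
  have h : (4 : ℝ≥0∞) = 2 * 2 := by norm_num
  rw [h, ENNReal.mul_inv (Or.inl (by simp)) (Or.inl (by simp)), ← two_mul, ← mul_assoc,
    ENNReal.mul_inv_cancel (by simp) (by simp), one_mul]⟩

lemma memLp_riskFeature (a : Fin N → EuclideanSpace ℝ (Fin d)) (b : Fin N → ℝ) (hM : 0 ≤ M)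
    {μ : Measure (EuclideanSpace ℝ (Fin d) × ℝ)} [IsProbabilityMeasure μ]
    {H : EuclideanSpace ℝ (Fin d) → ℝ} (hμ : IsRegressionLaw M μ H) (j : Option (Fin N)) :
    MemLp (riskFeature a b lam j) 4 μ := by
  cases j with
  | none => exact hμ.memLp
  | some i =>
    refine (memLp_of_bounded_on_cube hμ.mem_cube (u := centredFeature a b i)
      (continuous_centredFeature a b i).measurable (K := M * Real.sqrt d * ‖a i‖)
      (fun x hx => ?_) 4).const_mul lam
    refine (abs_relu_sub_relu_le _ _).trans ?_
    rw [add_sub_cancel_right]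
    exact abs_inner_le_of_mem_cube hM hx (a i)

lemma integrable_pow_four {Z : Type*} [MeasurableSpace Z] {μ : Measure Z} {g : Z → ℝ}
    (hg : MemLp g 4 μ) : Integrable (fun z => g z ^ 4) μ := by
  have := hg.integrable_norm_pow (p := 4) (by norm_num)
  refine this.congr (ae_of_all _ fun z => ?_)
  simp only [Real.norm_eq_abs]
  exact Even.pow_abs (by decide) _

/-- Expected excess risk of constrained least squares with fixed hidden weights. The comparison
network `ws` may depend on the hidden weights, but not on the sample. -/
lemma IsRegressionLaw.lintegral_excess_le (a : Fin N → EuclideanSpace ℝ (Fin d)) (b : Fin N → ℝ)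
    (hM : 0 ≤ M) (hlam : 0 < lam) {n : ℕ} (hn : 1 ≤ n)
    {μ : Measure (EuclideanSpace ℝ (Fin d) × ℝ)} [IsProbabilityMeasure μ]
    {H : EuclideanSpace ℝ (Fin d) → ℝ} (hμ : IsRegressionLaw M μ H)
    (ws : EuclideanSpace ℝ (Fin N))
    (wh : (Fin n → EuclideanSpace ℝ (Fin d) × ℝ) → EuclideanSpace ℝ (Fin N))
    (hwh : ∀ᵐ s ∂(Measure.pi fun _ => μ), ‖wh s‖ ≤ lam ∧
      empiricalRisk s (network a b (wh s)) ≤ empiricalRisk s (network a b 0) ∧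
      empiricalRisk s (network a b (wh s)) ≤ empiricalRisk s (network a b ws)) :
    ∫⁻ s, ∫⁻ z, ENNReal.ofReal ((H z.1 - network a b (wh s) z.1) ^ 2) ∂μ ∂(Measure.pi fun _ => μ)
      ≤ ∫⁻ z, ENNReal.ofReal ((H z.1 - network a b ws z.1) ^ 2) ∂μ
        + ENNReal.ofReal (13 * (sizeSq a M lam + 1 + ∫ z, z.2 ^ 4 ∂μ) / Real.sqrt n) := by
  have hn' : (0 : ℝ) < n := by exact_mod_cast hn
  obtain ⟨KH, hKH⟩ := hμ.bounded
  have hH := hμ.continuous.measurable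
  have hG := sizeSq_nonneg a (M := M) (lam := lam)
  set G : ℝ := sizeSq a M lam with hGdef
  set m₄ : ℝ := ∫ z, z.2 ^ 4 ∂μ with hm₄
  have hm₄0 : 0 ≤ m₄ := integral_nonneg fun z => by positivity
  set T : ℝ := G + 1 + m₄ with hT
  have hT0 : 0 < T := by positivity
  set r : ℝ := Real.sqrt n with hr
  have hr0 : 0 < r := Real.sqrt_pos.2 hn'
  have hrr : r * r = n := Real.mul_self_sqrt hn'.le
  have hζ4 := fun j => memLp_riskFeature (lam := lam) a b hM hμ j
  have hζ2 : ∀ j, MemLp (riskFeature a b lam j) 2 μ := fun j =>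
    (hζ4 j).mono_exponent (by norm_num)
  have hζζ : ∀ j k, MemLp (fun z => riskFeature a b lam j z * riskFeature a b lam k z) 2 μ :=
    fun j k => (hζ4 k).mul (hζ4 j)
  have hy2 : MemLp (fun z : EuclideanSpace ℝ (Fin d) × ℝ => z.2) 2 μ :=
    hμ.memLp.mono_exponent (by norm_num)
  have hy4 := integrable_pow_four hμ.memLp
  have hyT : ∫ z, z.2 ^ 2 ∂μ ≤ 1 + m₄ := by
    calc ∫ z, z.2 ^ 2 ∂μ ≤ ∫ z, (1 + z.2 ^ 4) ∂μ := by
          refine integral_mono hy2.integrable_sq ((integrable_const _).add hy4) fun z => ?_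
          nlinarith [sq_nonneg (z.2 ^ 2 - 1)]
      _ = 1 + m₄ := by rw [integral_add (integrable_const _) hy4]; simp [hm₄]
  have hq1 : ∫ z, ∑ j, riskFeature a b lam j z ^ 2 ∂μ ≤ T := by
    calc ∫ z, ∑ j, riskFeature a b lam j z ^ 2 ∂μ ≤ ∫ z, (G + z.2 ^ 2) ∂μ := by
          refine integral_mono_of_nonneg (ae_of_all _ fun z =>
            Finset.sum_nonneg fun _ _ => sq_nonneg _)
            ((integrable_const _).add hy2.integrable_sq) ?_
          filter_upwards [hμ.mem_cube] with z hz using sum_riskFeature_sq_le a b hM hz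
      _ ≤ T := by
          rw [integral_add (integrable_const _) hy2.integrable_sq]
          simp
          linarith
  have hq2 : ∫ z, (∑ j, riskFeature a b lam j z ^ 2) ^ 2 ∂μ ≤ 2 * T ^ 2 := by
    calc ∫ z, (∑ j, riskFeature a b lam j z ^ 2) ^ 2 ∂μ
        ≤ ∫ z, (2 * G ^ 2 + 2 * z.2 ^ 4) ∂μ := by
          refine integral_mono_of_nonneg (ae_of_all _ fun z => sq_nonneg _)
            ((integrable_const _).add (hy4.const_mul 2)) ?_
          filter_upwards [hμ.mem_cube] with z hz
          have h1 := sum_riskFeature_sq_le (lam := lam) a b hM hz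
          have h0 : 0 ≤ ∑ j, riskFeature a b lam j z ^ 2 := Finset.sum_nonneg fun _ _ => sq_nonneg _
          calc (∑ j, riskFeature a b lam j z ^ 2) ^ 2 ≤ (G + z.2 ^ 2) ^ 2 := by gcongr
            _ ≤ 2 * G ^ 2 + 2 * z.2 ^ 4 := by nlinarith [sq_nonneg (G - z.2 ^ 2)]
      _ = 2 * G ^ 2 + 2 * m₄ := by
          have h4 : ∫ z : EuclideanSpace ℝ (Fin d) × ℝ, 2 * z.2 ^ 4 ∂μ = 2 * m₄ :=
            integral_const_mul _ _
          rw [integral_add (integrable_const _) (hy4.const_mul 2), h4]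
          simp
      _ ≤ 2 * T ^ 2 := by rw [hT]; nlinarith [mul_nonneg hG hm₄0, sq_nonneg m₄]
  -- `R` is the risk, and `RH` the risk of the regression function
  obtain ⟨hl1, hl2⟩ := integral_linDev_le hn μ hζ2
  obtain ⟨hqd1, hqd2⟩ := integral_quadDev_le hn μ hζζ
  set R : EuclideanSpace ℝ (Fin N) → ℝ := fun w => ∫ z, (network a b w z.1 - z.2) ^ 2 ∂μ with hRdef
  have hnetm : ∀ w, MemLp (fun z : EuclideanSpace ℝ (Fin d) × ℝ => network a b w z.1) 2 μ :=
    fun w => memLp_of_bounded_on_cube hμ.mem_cube (continuous_network a b w).measurable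
      (fun x hx => abs_network_le a b w hM hx) 2
  have hpyth : ∀ w, R w = ∫ z, (H z.1 - network a b w z.1) ^ 2 ∂μ + ∫ z, (H z.1 - z.2) ^ 2 ∂μ :=
    fun w => hμ.integral_sq_sub_eq (continuous_network a b w).measurable
      (fun x hx => abs_network_le a b w hM hx)
  have hLint : ∀ w, Integrable (fun z : EuclideanSpace ℝ (Fin d) × ℝ =>
      (H z.1 - network a b w z.1) ^ 2) μ := fun w =>
    ((memLp_of_bounded_on_cube hμ.mem_cube hH (fun x _ => hKH x) 2).sub (hnetm w)).integrable_sq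
  have hL : ∀ w, ∫⁻ z, ENNReal.ofReal ((H z.1 - network a b w z.1) ^ 2) ∂μ
      = ENNReal.ofReal (∫ z, (H z.1 - network a b w z.1) ^ 2 ∂μ) := fun w =>
    (ofReal_integral_eq_lintegral_ofReal (hLint w) (ae_of_all _ fun z => sq_nonneg _)).symm
  set RH : ℝ := ∫ z, (H z.1 - z.2) ^ 2 ∂μ with hRH
  have hemp : ∀ g : EuclideanSpace ℝ (Fin d) × ℝ → ℝ, Integrable g μ →
      Integrable (fun s : Fin n → EuclideanSpace ℝ (Fin d) × ℝ => (1 / (n : ℝ)) * ∑ i, g (s i))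
        (Measure.pi fun _ => μ) ∧
      ∫ s : Fin n → EuclideanSpace ℝ (Fin d) × ℝ, (1 / (n : ℝ)) * ∑ i, g (s i)
        ∂(Measure.pi fun _ => μ) = ∫ z, g z ∂μ := by
    intro g hg
    have hi : ∀ i : Fin n, Integrable (fun s : Fin n → EuclideanSpace ℝ (Fin d) × ℝ => g (s i))
        (Measure.pi fun _ => μ) := fun i =>
      (measurePreserving_eval (fun _ : Fin n => μ) i).integrable_comp_of_integrable hg
    refine ⟨(integrable_finsetSum _ fun i _ => hi i).const_mul _, ?_⟩
    rw [integral_const_mul, integral_finsetSum _ fun i _ => hi i]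
    have : ∀ i : Fin n, ∫ s : Fin n → EuclideanSpace ℝ (Fin d) × ℝ, g (s i)
        ∂(Measure.pi fun _ => μ) = ∫ z, g z ∂μ := fun i =>
      integral_comp_eval (μ := fun _ : Fin n => μ) hg.aestronglyMeasurable
    simp only [this, Finset.sum_const, Finset.card_univ, Fintype.card_fin, nsmul_eq_mul]
    field_simp
  obtain ⟨he1, he2⟩ := hemp (fun z => (network a b ws z.1 - z.2) ^ 2)
    ((hnetm ws).sub hy2).integrable_sq
  obtain ⟨hy1, hy3⟩ := hemp (fun z => z.2 ^ 2) hy2.integrable_sq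
  -- the deviation terms; the first one bounds the squared value of the estimator at the origin
  let Δ : (Fin n → EuclideanSpace ℝ (Fin d) × ℝ) → ℝ := fun s =>
    (2 * G + 8 * ((1 / (n : ℝ)) * ∑ i, (s i).2 ^ 2)) / r
      + 2 * r * linDev μ (riskFeature a b lam) s + T / r
      + r * quadDev μ (riskFeature a b lam) s / T
  have hΔ1 : Integrable (fun s : Fin n → EuclideanSpace ℝ (Fin d) × ℝ =>
      (2 * G + 8 * ((1 / (n : ℝ)) * ∑ i, (s i).2 ^ 2)) / r) (Measure.pi fun _ => μ) :=
    ((integrable_const _).add (hy1.const_mul 8)).div_const r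
  have hΔ2 : Integrable (fun s : Fin n → EuclideanSpace ℝ (Fin d) × ℝ =>
      2 * r * linDev μ (riskFeature a b lam) s) (Measure.pi fun _ => μ) := hl1.const_mul _
  have hΔ4 : Integrable (fun s : Fin n → EuclideanSpace ℝ (Fin d) × ℝ =>
      r * quadDev μ (riskFeature a b lam) s / T) (Measure.pi fun _ => μ) :=
    (hqd1.const_mul _).div_const _
  have hΔ3 := (hΔ1.add hΔ2).add (integrable_const (T / r))
  have hΔi : Integrable Δ (Measure.pi fun _ => μ) := hΔ3.add hΔ4
  have hrn : r * (1 / (n : ℝ)) = 1 / r := by rw [← hrr]; field_simp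
  have hΔle : ∫ s, Δ s ∂(Measure.pi fun _ => μ) ≤ 13 * T / r := by
    have e1 : ∫ s, Δ s ∂(Measure.pi fun _ => μ)
        = (2 * G + 8 * ∫ z, z.2 ^ 2 ∂μ) / r
          + 2 * r * ∫ s, linDev (n := n) μ (riskFeature a b lam) s ∂(Measure.pi fun _ => μ)
          + T / r
          + r * (∫ s, quadDev (n := n) μ (riskFeature a b lam) s ∂(Measure.pi fun _ => μ)) / T := by
      have s1 := integral_add hΔ3 hΔ4
      have s2 := integral_add (hΔ1.add hΔ2) (integrable_const (T / r))
      have s3 := integral_add hΔ1 hΔ2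
      have s4 : ∫ s : Fin n → EuclideanSpace ℝ (Fin d) × ℝ,
          (2 * G + 8 * ((1 / (n : ℝ)) * ∑ i, (s i).2 ^ 2)) / r ∂(Measure.pi fun _ => μ)
          = (2 * G + 8 * ∫ z, z.2 ^ 2 ∂μ) / r := by
        have h8 : ∫ s : Fin n → EuclideanSpace ℝ (Fin d) × ℝ,
            8 * ((1 / (n : ℝ)) * ∑ i, (s i).2 ^ 2) ∂(Measure.pi fun _ => μ)
            = 8 * ∫ z, z.2 ^ 2 ∂μ := by rw [integral_const_mul, hy3]
        rw [integral_div, integral_add (integrable_const _) (hy1.const_mul 8), h8]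
        simp
      have s5 : ∫ s : Fin n → EuclideanSpace ℝ (Fin d) × ℝ,
          r * quadDev μ (riskFeature a b lam) s / T ∂(Measure.pi fun _ => μ)
          = r * (∫ s, quadDev (n := n) μ (riskFeature a b lam) s ∂(Measure.pi fun _ => μ)) / T := by
        rw [integral_div, integral_const_mul]
      have s6 : ∫ s : Fin n → EuclideanSpace ℝ (Fin d) × ℝ,
          2 * r * linDev μ (riskFeature a b lam) s ∂(Measure.pi fun _ => μ)
          = 2 * r * ∫ s, linDev (n := n) μ (riskFeature a b lam) s ∂(Measure.pi fun _ => μ) := by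
        rw [integral_const_mul]
      simp only [Pi.add_apply, integral_const, probReal_univ, one_smul] at s1 s2 s3
      rw [s3, s4, s6] at s2
      rw [s2, s5] at s1
      exact s1
    have b1 : (2 * G + 8 * ∫ z, z.2 ^ 2 ∂μ) / r ≤ 8 * T / r := by
      gcongr; rw [hT]; linarith
    have b2 : 2 * r * ∫ s, linDev (n := n) μ (riskFeature a b lam) s ∂(Measure.pi fun _ => μ)
        ≤ 2 * T / r := by
      calc _ ≤ 2 * r * ((1 / (n : ℝ)) * T) := by
            refine mul_le_mul_of_nonneg_left (hl2.trans ?_) (by positivity)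
            gcongr
        _ = 2 * (r * (1 / (n : ℝ))) * T := by ring
        _ = 2 * T / r := by rw [hrn]; ring
    have b3 : r * (∫ s, quadDev (n := n) μ (riskFeature a b lam) s ∂(Measure.pi fun _ => μ)) / T
        ≤ 2 * T / r := by
      calc _ ≤ r * ((1 / (n : ℝ)) * (2 * T ^ 2)) / T := by
            refine div_le_div_of_nonneg_right (mul_le_mul_of_nonneg_left (hqd2.trans ?_) hr0.le)
              hT0.le
            gcongr
        _ = (r * (1 / (n : ℝ))) * (2 * T ^ 2) / T := by ring
        _ = 2 * T / r := by rw [hrn]; field_simp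
    rw [e1]
    have : 13 * T / r = 8 * T / r + 2 * T / r + T / r + 2 * T / r := by ring
    linarith
  have hcubes : ∀ᵐ s : Fin n → EuclideanSpace ℝ (Fin d) × ℝ ∂(Measure.pi fun _ => μ),
      ∀ i, (s i).1 ∈ cube d M :=
    ae_all_iff.2 fun i => (measurePreserving_eval (fun _ : Fin n => μ) i).quasiMeasurePreserving.ae
      hμ.mem_cube
  -- the estimation error on the sample is dominated by a function not involving the estimator
  have hmain : ∀ᵐ s : Fin n → EuclideanSpace ℝ (Fin d) × ℝ ∂(Measure.pi fun _ => μ),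
      ∫ z, (H z.1 - network a b (wh s) z.1) ^ 2 ∂μ
        ≤ (1 / (n : ℝ)) * ∑ i, (network a b ws (s i).1 - (s i).2) ^ 2 + Δ s - RH := by
    filter_upwards [hwh, hcubes] with s hs hc
    obtain ⟨h1, h2, h3⟩ := hs
    have ho := sq_origin_le a b hn hM h1 hc h2
    have hu := integral_sq_le_empirical hn μ hζ2 s (∑ i, wh s i * relu (b i))
      (sum_riskCoeff_sq_le hlam h1) hr0 hT0
    simp only [← network_sub_eq a b hlam] at hu
    have hp := hpyth (wh s)
    simp only [hRdef] at hp
    unfold empiricalRisk at h3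
    have hc2 : (∑ i, wh s i * relu (b i)) ^ 2 / r
        ≤ (2 * G + 8 * ((1 / (n : ℝ)) * ∑ i, (s i).2 ^ 2)) / r := by gcongr
    simp only [Δ]
    linarith
  simp_rw [hL]
  calc ∫⁻ s, ENNReal.ofReal (∫ z, (H z.1 - network a b (wh s) z.1) ^ 2 ∂μ)
        ∂(Measure.pi fun _ => μ)
      ≤ ∫⁻ s : Fin n → EuclideanSpace ℝ (Fin d) × ℝ, ENNReal.ofReal
          ((1 / (n : ℝ)) * ∑ i, (network a b ws (s i).1 - (s i).2) ^ 2 + Δ s - RH)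
          ∂(Measure.pi fun _ => μ) := by
        refine lintegral_mono_ae ?_
        filter_upwards [hmain] with s hs using ENNReal.ofReal_le_ofReal hs
    _ = ENNReal.ofReal (R ws + ∫ s, Δ s ∂(Measure.pi fun _ => μ) - RH) := by
        have hsum : Integrable (fun s : Fin n → EuclideanSpace ℝ (Fin d) × ℝ =>
            (1 / (n : ℝ)) * ∑ i, (network a b ws (s i).1 - (s i).2) ^ 2 + Δ s)
            (Measure.pi fun _ => μ) := he1.add hΔi
        have hsub : Integrable (fun s : Fin n → EuclideanSpace ℝ (Fin d) × ℝ =>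
            (1 / (n : ℝ)) * ∑ i, (network a b ws (s i).1 - (s i).2) ^ 2 + Δ s - RH)
            (Measure.pi fun _ => μ) := hsum.sub (integrable_const _)
        rw [← ofReal_integral_eq_lintegral_ofReal hsub, integral_sub hsum (integrable_const _), integral_add he1 hΔi, he2]
        · simp [hRdef]
        · filter_upwards [hmain] with s hs
          exact (integral_nonneg fun z => sq_nonneg _).trans hs
    _ ≤ _ := by
        rw [← ENNReal.ofReal_add (integral_nonneg fun z => sq_nonneg _) (by positivity)]
        refine ENNReal.ofReal_le_ofReal ?_
        rw [hpyth ws]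
        linarith

end ExcessRisk

/-! ### Sampled networks, hidden weights and regression laws -/

section SampledNetwork

variable {d N : ℕ} {M B : ℝ} {h : EuclideanSpace ℝ (Fin d) × ℝ → ℝ}

/-- The output weights `h (Aᵢ, Bᵢ) / N`, for which the random network is the empirical mean of the
weighted features. -/
def sampledWeights (h : EuclideanSpace ℝ (Fin d) × ℝ → ℝ)
    (z : Fin N → EuclideanSpace ℝ (Fin d) × ℝ) : EuclideanSpace ℝ (Fin N) :=
  WithLp.toLp 2 fun i => h (z i) / N

lemma measurable_sampledWeights (hh : Measurable h) :
    Measurable (sampledWeights (N := N) h) :=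
  (WithLp.measurable_toLp 2 _).comp
    (measurable_pi_lambda _ fun i => (hh.comp (measurable_pi_apply i)).div_const _)

lemma IsTameWeight.abs_sampledWeights_le (hh : IsTameWeight M B h) (hd : 1 ≤ d)
    (z : Fin N → EuclideanSpace ℝ (Fin d) × ℝ) (i : Fin N) :
    |sampledWeights h z i| ≤ B / N := by
  change |h (z i) / N| ≤ B / N
  rw [abs_div, Nat.abs_cast]
  gcongr
  exact hh.abs_le hd _

lemma IsTameWeight.norm_sampledWeights_le (hh : IsTameWeight M B h) (hd : 1 ≤ d) (hN : 1 ≤ N)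
    (z : Fin N → EuclideanSpace ℝ (Fin d) × ℝ) : ‖sampledWeights h z‖ ≤ B / Real.sqrt N := by
  have hN' : (0 : ℝ) < N := by exact_mod_cast hN
  have hB := hh.nonneg
  rw [EuclideanSpace.norm_eq, Real.sqrt_le_left (by positivity), div_pow,
    Real.sq_sqrt (by positivity)]
  calc ∑ i, ‖sampledWeights h z i‖ ^ 2 ≤ ∑ _i : Fin N, (B / N) ^ 2 := by
        refine Finset.sum_le_sum fun i _ => ?_
        gcongr
        exact hh.abs_sampledWeights_le hd z i
    _ = B ^ 2 / N := by simp; field_simp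

/-- Monte Carlo approximation in mean square at one point of the cube. -/
lemma IsTameWeight.lintegral_sq_sub_le (hh : IsTameWeight M B h) (hd : 1 ≤ d) (hM : 0 ≤ M)
    (hN : 1 ≤ N) (κ : Measure (EuclideanSpace ℝ (Fin d) × ℝ)) [IsProbabilityMeasure κ]
    {H : EuclideanSpace ℝ (Fin d) → ℝ} {x : EuclideanSpace ℝ (Fin d)} (hx : x ∈ cube d M)
    (hH : H x = ∫ z, h z * relu (inner ℝ z.1 x + z.2) ∂κ) :
    ∫⁻ z : Fin N → EuclideanSpace ℝ (Fin d) × ℝ, ENNReal.ofReal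
        ((H x - network (fun i => (z i).1) (fun i => (z i).2) (sampledWeights h z) x) ^ 2)
        ∂(Measure.pi fun _ => κ)
      ≤ ENNReal.ofReal (((2 * M + 1) * B) ^ 2 / N) := by
  have hg : MemLp (fun y : EuclideanSpace ℝ (Fin d) × ℝ => h y * relu (inner ℝ y.1 x + y.2)) 2 κ :=
    MemLp.of_bound (measurable_weight_mul_relu hh.measurable x).aestronglyMeasurable _
      (ae_of_all _ fun y => hh.abs_mul_relu_le hd hM hx y)
  obtain ⟨h1, h2⟩ := integral_empDev_sq_le hN κ hg
  have heq : ∀ z : Fin N → EuclideanSpace ℝ (Fin d) × ℝ,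
      (H x - network (fun i => (z i).1) (fun i => (z i).2) (sampledWeights h z) x) ^ 2
      = empDev κ z (fun y => h y * relu (inner ℝ y.1 x + y.2)) ^ 2 := by
    intro z
    rw [empDev, ← hH, ← neg_sq, neg_sub]
    congr 2
    rw [Finset.mul_sum]
    refine Finset.sum_congr rfl fun i _ => ?_
    change h (z i) / N * _ = _
    ring
  simp_rw [heq]
  rw [← ofReal_integral_eq_lintegral_ofReal h1 (ae_of_all _ fun z => sq_nonneg _)]
  refine ENNReal.ofReal_le_ofReal (h2.trans ?_)
  rw [one_div, inv_mul_eq_div]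
  gcongr
  calc ∫ y, (h y * relu (inner ℝ y.1 x + y.2)) ^ 2 ∂κ ≤ ∫ _y, ((2 * M + 1) * B) ^ 2 ∂κ := by
        refine integral_mono hg.integrable_sq (integrable_const _) fun y => ?_
        simp only
        rw [← sq_abs]
        gcongr
        exact hh.abs_mul_relu_le hd hM hx y
    _ = _ := by simp

lemma measurableSet_cube (d : ℕ) (M : ℝ) : MeasurableSet (cube d M) := by
  have : cube d M = ⋂ j, {x : EuclideanSpace ℝ (Fin d) | |x j| ≤ M} := by
    ext x; simp [cube]
  rw [this]
  exact MeasurableSet.iInter fun j => measurableSet_le (by fun_prop) measurable_const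

/-- The supremum over the cube is a countable one. -/
lemma measurable_iSup_cube {Z : Type*} [MeasurableSpace Z] {G : Z → EuclideanSpace ℝ (Fin d) → ℝ}
    (hm : ∀ x, Measurable fun z => G z x) (hc : ∀ z, Continuous (G z)) (hM : 0 ≤ M) :
    Measurable fun z => ⨆ x ∈ cube d M, ENNReal.ofReal |G z x| := by
  have : Nonempty (cube d M) := ⟨⟨0, fun j => by simpa using hM⟩⟩
  let e : ℕ → cube d M := TopologicalSpace.denseSeq (cube d M)
  have heq : (fun z => ⨆ x ∈ cube d M, ENNReal.ofReal |G z x|)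
      = fun z => ⨆ n, ENNReal.ofReal |G z (e n)| := by
    ext z
    refine le_antisymm (iSup₂_le fun x hx => ?_)
      (iSup_le fun n => le_iSup₂_of_le (e n : EuclideanSpace ℝ (Fin d)) (e n).2 le_rfl)
    have hcont : Continuous fun y : cube d M => ENNReal.ofReal |G z y| :=
      ENNReal.continuous_ofReal.comp ((hc z).comp continuous_subtype_val).abs
    have hdense : DenseRange e := TopologicalSpace.denseRange_denseSeq _
    exact hdense.induction_on (p := fun y : cube d M => ENNReal.ofReal |G z y|
      ≤ ⨆ n, ENNReal.ofReal |G z (e n)|) ⟨x, hx⟩ (isClosed_le hcont continuous_const)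
      fun n => le_iSup (fun n => ENNReal.ofReal |G z (e n)|) n
  rw [heq]
  exact Measurable.iSup fun n => (measurable_abs.comp (hm _)).ennreal_ofReal

end SampledNetwork

section HiddenWeights

variable {Ω : Type*} [MeasurableSpace Ω] {P : Measure Ω} {d N : ℕ}
  {ν : ℝ} {πb : ℝ → ℝ} {A : Fin N → Ω → EuclideanSpace ℝ (Fin d)} {B : Fin N → Ω → ℝ}

lemma IsHiddenWeights.isProbabilityMeasure_studentMeasure [IsProbabilityMeasure P] [NeZero N]
    (hAB : IsHiddenWeights P ν πb A B) : IsProbabilityMeasure (studentMeasure d ν) := by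
  rw [← hAB.law_A 0]
  exact Measure.isProbabilityMeasure_map (hAB.measurable_A 0).aemeasurable

lemma IsHiddenWeights.isProbabilityMeasure_bias [IsProbabilityMeasure P] [NeZero N]
    (hAB : IsHiddenWeights P ν πb A B) :
    IsProbabilityMeasure (volume.withDensity fun z => ENNReal.ofReal (πb z)) := by
  rw [← hAB.law_B 0]
  exact Measure.isProbabilityMeasure_map (hAB.measurable_B 0).aemeasurable

lemma IsHiddenWeights.map_pair [IsProbabilityMeasure P] [NeZero N]
    (hAB : IsHiddenWeights P ν πb A B) :
    P.map (fun ω i => (A i ω, B i ω)) = Measure.pi fun _ => weightLaw d ν πb := by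
  have := hAB.isProbabilityMeasure_studentMeasure
  have := hAB.isProbabilityMeasure_bias
  exact map_pair_eq_pi hAB.measurable_A hAB.measurable_B hAB.law_A hAB.law_B hAB.iIndep_A
    hAB.iIndep_B hAB.indep_A_B

lemma IsHiddenWeights.measurable_hiddenWeights (hAB : IsHiddenWeights P ν πb A B) :
    Measurable (hiddenWeights A B) :=
  (measurable_pi_lambda _ hAB.measurable_A).prodMk (measurable_pi_lambda _ hAB.measurable_B)

lemma measurable_pairs : Measurable fun (q : (Fin N → EuclideanSpace ℝ (Fin d)) × (Fin N → ℝ)) i =>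
    (q.1 i, q.2 i) := by fun_prop

lemma IsHiddenWeights.lintegral_sizeSq_le (hAB : IsHiddenWeights P ν πb A B) (hd : 1 ≤ d)
    (hν : 2 < ν) (M lam : ℝ) :
    ∫⁻ ω, ENNReal.ofReal (sizeSq (fun i => A i ω) M lam) ∂P
      ≤ ENNReal.ofReal (lam ^ 2 * M ^ 2 * d ^ 2 * N * (ν ^ 2 / (ν - 2))) := by
  have hν2 : 0 < ν - 2 := by linarith
  have hm : ∀ i, Measurable fun ω => ENNReal.ofReal (‖A i ω‖ ^ 2) := fun i =>
    ((hAB.measurable_A i).norm.pow_const 2).ennreal_ofReal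
  have h1 : ∀ ω, ENNReal.ofReal (sizeSq (fun i => A i ω) M lam)
      = ENNReal.ofReal (lam ^ 2 * (M ^ 2 * d)) * ∑ i, ENNReal.ofReal (‖A i ω‖ ^ 2) := by
    intro ω
    rw [← ENNReal.ofReal_sum_of_nonneg fun i _ => sq_nonneg _,
      ← ENNReal.ofReal_mul (by positivity), sizeSq]
    congr 1; ring
  simp_rw [h1]
  rw [lintegral_const_mul _ (Finset.measurable_fun_sum _ fun i _ => hm i),
    lintegral_finsetSum _ fun i _ => hm i]
  have h2 : ∀ i, ∫⁻ ω, ENNReal.ofReal (‖A i ω‖ ^ 2) ∂P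
      ≤ ENNReal.ofReal (d * (ν ^ 2 / (ν - 2))) := by
    intro i
    refine le_trans (le_of_eq ?_) (lintegral_sq_norm_studentMeasure_le hd hν)
    rw [← hAB.law_A i, lintegral_map (by fun_prop) (hAB.measurable_A i)]
  calc _ ≤ ENNReal.ofReal (lam ^ 2 * (M ^ 2 * d)) *
        ∑ _i : Fin N, ENNReal.ofReal (d * (ν ^ 2 / (ν - 2))) := by
        gcongr with i
        exact h2 i
    _ = _ := by
        rw [← ENNReal.ofReal_sum_of_nonneg fun i _ => by positivity,
          ← ENNReal.ofReal_mul (by positivity)]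
        congr 1
        simp; ring

end HiddenWeights

section Representation

/-- The representation of convolutional targets by weighted ReLU features: the Fourier transform of
such a target has Gaussian decay, hence so does its importance weight. The constant does not depend
on the dimension. -/
lemma exists_tameWeight_constant {πb : ℝ → ℝ} (hπb : PolynomialDecay πb) {ν C M : ℝ}
    (hν : 1 ≤ ν) (hC : Real.pi < 4 * Real.pi ^ 2 * C) (hM : 0 < M) :
    ∃ K : ℝ, 0 < K ∧ ∀ (d : ℕ), 1 ≤ d → IsProbabilityMeasure (studentMeasure d ν) →
      IsProbabilityMeasure (volume.withDensity fun z => ENNReal.ofReal (πb z)) →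
      ∀ (Ω : Type*) [MeasurableSpace Ω] (P : Measure Ω) [IsProbabilityMeasure P]
        (Φ : EuclideanSpace ℝ (Fin d) → ℝ) (V : Ω → EuclideanSpace ℝ (Fin d))
        (H : EuclideanSpace ℝ (Fin d) → ℝ), IsConvolutional P C Φ V H →
        Continuous H ∧ (∃ L, ∀ x, |H x| ≤ L) ∧
        ∃ h, IsTameWeight M (K * ∫ x, |Φ x|) h ∧
          ∀ x ∈ cube d M, H x = ∫ z, h z * relu (inner ℝ z.1 x + z.2) ∂weightLaw d ν πb := by
  obtain ⟨K, hK, hKb⟩ := exists_importanceWeight_bound hπb hν hC hM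
  have hC0 : 0 < C := by
    by_contra hn
    have : 4 * Real.pi ^ 2 * C ≤ 0 := mul_nonpos_of_nonneg_of_nonpos (by positivity) (not_lt.1 hn)
    linarith [Real.pi_pos]
  refine ⟨K, hK, fun d hd hp1 hp2 Ω _ P _ Φ V H hH => ?_⟩
  obtain ⟨Ψ, hΨc, hΨi, hHc, hΨb, hHΨ⟩ := hH.exists_fourier hC0
  have htame : IsTameWeight M (K * ∫ x, |Φ x|) (importanceWeight d ν πb M Ψ) :=
    ⟨measurable_importanceWeight hπb.measurable hΨc.measurable, hKb d hd _ Ψ hΨb,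
      fun z hz => abs_le_of_importanceWeight_ne_zero hM.le hz⟩
  refine ⟨hHc, ⟨∫ ξ, ‖Ψ ξ‖, fun x => ?_⟩, _, htame, fun x hx => ?_⟩
  · rw [← Real.norm_eq_abs, ← Complex.norm_real, hHΨ x]
    refine (norm_integral_le_integral_norm _).trans (le_of_eq ?_)
    congr 1
    ext ξ
    have := Complex.norm_exp_ofReal_mul_I (2 * Real.pi * inner ℝ ξ x)
    push_cast at this
    rw [norm_mul, this, mul_one]
  · have : IsProbabilityMeasure (weightLaw d ν πb) := by unfold weightLaw; infer_instance
    have hint : Integrable (fun z : EuclideanSpace ℝ (Fin d) × ℝ =>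
        importanceWeight d ν πb M Ψ z * relu (inner ℝ z.1 x + z.2)) (weightLaw d ν πb) :=
      Integrable.of_bound (measurable_weight_mul_relu htame.measurable x).aestronglyMeasurable _
        (ae_of_all _ fun z => htame.abs_mul_relu_le hd hM.le hx z)
    rw [integral_importanceWeight_mul_relu (by linarith) hπb.measurable hπb.pos hM.le hΨi hx hint,
      ← hHΨ x, Complex.ofReal_re]

end Representation

section RegressionLaw

variable {Ω : Type*} [MeasurableSpace Ω] {P : Measure Ω} [IsProbabilityMeasure P] {d : ℕ} {M : ℝ}

/-- The regression property `H(X) = E[Y | X]` in terms of the law of `(X, Y)`. -/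
lemma isRegressionLaw_map {Z : Ω → EuclideanSpace ℝ (Fin d) × ℝ} (hZ : Measurable Z)
    {H : EuclideanSpace ℝ (Fin d) → ℝ} (hreg : IsRegressionFunction P Z H) (hHc : Continuous H)
    (hHb : ∃ L, ∀ x, |H x| ≤ L) (hcube : ∀ᵐ ω ∂P, (Z ω).1 ∈ cube d M)
    (hY : MemLp (fun ω => (Z ω).2) 4 P) : IsRegressionLaw M (P.map Z) H := by
  have hcubeMap : ∀ᵐ z ∂P.map Z, z.1 ∈ cube d M :=
    (ae_map_iff hZ.aemeasurable (measurable_fst (measurableSet_cube d M))).2 hcube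
  refine ⟨hcubeMap, ?_, hHc, hHb, ?_⟩
  · rwa [memLp_map_measure_iff measurable_snd.aestronglyMeasurable hZ.aemeasurable]
  · rintro u hu ⟨K, hK⟩
    obtain ⟨L, hL⟩ := hHb
    have hX : Measurable fun ω => (Z ω).1 := measurable_fst.comp hZ
    -- `u` is only bounded on the cube, which carries the law of `X`
    let v : EuclideanSpace ℝ (Fin d) → ℝ := (cube d M).indicator u
    have hv : Measurable v := hu.indicator (measurableSet_cube d M)
    have hvK : ∀ x, ‖v x‖ ≤ |K| := by
      intro x
      by_cases hx : x ∈ cube d M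
      · simpa [v, hx] using (hK x hx).trans (le_abs_self K)
      · simp [v, hx]
    have hvX : StronglyMeasurable[MeasurableSpace.comap (fun ω => (Z ω).1) inferInstance]
        fun ω => v (Z ω).1 :=
      (hv.comp (comap_measurable fun ω => (Z ω).1)).stronglyMeasurable
    have hYi : Integrable (fun ω => (Z ω).2) P := hY.integrable (by norm_num)
    have hvY : Integrable (fun ω => v (Z ω).1 * (Z ω).2) P :=
      hYi.bdd_mul (hv.comp hX).aestronglyMeasurable (ae_of_all _ fun ω => hvK _)
    have hHi : Integrable (fun ω => H (Z ω).1) P :=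
      Integrable.of_bound (hHc.measurable.comp hX).aestronglyMeasurable L
        (ae_of_all _ fun ω => hL _)
    have hvH : Integrable (fun ω => v (Z ω).1 * H (Z ω).1) P :=
      hHi.bdd_mul (hv.comp hX).aestronglyMeasurable (ae_of_all _ fun ω => hvK _)
    have hpull := condExp_mul_of_stronglyMeasurable_left hvX hvY hYi
    have heq : ∫ ω, v (Z ω).1 * H (Z ω).1 ∂P = ∫ ω, v (Z ω).1 * (Z ω).2 ∂P := by
      rw [← integral_condExp hX.comap_le (f := fun ω => v (Z ω).1 * (Z ω).2)]
      refine integral_congr_ae ?_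
      filter_upwards [hpull, hreg] with ω h1 h2
      refine Eq.trans ?_ h1.symm
      simp only [Pi.mul_apply]
      rw [h2]
    calc ∫ z, u z.1 * (H z.1 - z.2) ∂P.map Z = ∫ z, v z.1 * (H z.1 - z.2) ∂P.map Z := by
          refine integral_congr_ae ?_
          filter_upwards [hcubeMap] with z hz
          simp [v, hz]
      _ = ∫ ω, v (Z ω).1 * (H (Z ω).1 - (Z ω).2) ∂P := by
          have hHm := hHc.measurable
          exact integral_map hZ.aemeasurable (Measurable.aestronglyMeasurable (by fun_prop))
      _ = 0 := by
          simp_rw [mul_sub]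
          rw [integral_sub hvH hvY, heq, sub_self]

end RegressionLaw

/-! ### Mean square prediction error -/

section PredictionError

variable {d N n : ℕ}

lemma measurable_network : Measurable fun q : ((Fin N → EuclideanSpace ℝ (Fin d)) × (Fin N → ℝ)) ×
    EuclideanSpace ℝ (Fin N) × EuclideanSpace ℝ (Fin d) => network q.1.1 q.1.2 q.2.1 q.2.2 := by
  have := continuous_relu
  refine Continuous.measurable ?_
  unfold network
  fun_prop

lemma measurable_empiricalRisk_network {Q : Type*} [MeasurableSpace Q]
    {f : Q → (Fin N → EuclideanSpace ℝ (Fin d)) × (Fin N → ℝ)} (hf : Measurable f)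
    {s : Q → Fin n → EuclideanSpace ℝ (Fin d) × ℝ} (hs : Measurable s)
    {w : Q → EuclideanSpace ℝ (Fin N)} (hw : Measurable w) :
    Measurable fun q => empiricalRisk (s q) (network (f q).1 (f q).2 (w q)) := by
  unfold empiricalRisk
  refine (Finset.measurable_sum _ fun i _ => ?_).const_mul _
  have hsi : Measurable fun q => s q i := (measurable_pi_apply i).comp hs
  exact ((measurable_network.comp (hf.prodMk (hw.prodMk (measurable_fst.comp hsi)))).sub
    (measurable_snd.comp hsi)).pow_const 2

variable {Ω : Type*} [MeasurableSpace Ω] {P : Measure Ω}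
  {M B lam ν : ℝ} {πb : ℝ → ℝ}
  {A : Fin N → Ω → EuclideanSpace ℝ (Fin d)} {b : Fin N → Ω → ℝ}

lemma IsSample.measurable_sample [NeZero n] {D : Fin n → Ω → EuclideanSpace ℝ (Fin d) × ℝ}
    (hD : IsSample P A b D) : Measurable (sample D) :=
  measurable_pi_lambda _ hD.measurable

lemma IsSample.map_sample [IsProbabilityMeasure P] [NeZero n]
    {D : Fin n → Ω → EuclideanSpace ℝ (Fin d) × ℝ}
    (hD : IsSample P A b D) : P.map (sample D) = Measure.pi fun _ => P.map (D 0) := by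
  have h := (iIndepFun_iff_map_fun_eq_pi_map fun i => (hD.measurable i).aemeasurable).1 hD.iIndep
  simp only [hD.ident] at h
  exact h

/-- Hidden weights, sample and test pair are jointly independent. -/
lemma map_weights_sample_test [IsProbabilityMeasure P] [NeZero n]
    {D : Fin n → Ω → EuclideanSpace ℝ (Fin d) × ℝ}
    {T : Ω → EuclideanSpace ℝ (Fin d) × ℝ} (hAB : IsHiddenWeights P ν πb A b)
    (hD : IsSample P A b D) (hT : IsTestPair P A b D T) :
    P.map (fun ω => ((hiddenWeights A b ω, sample D ω), T ω))
      = ((P.map (hiddenWeights A b)).prod (Measure.pi fun _ => P.map (D 0))).prod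
          (P.map (D 0)) := by
  have hm := hAB.measurable_hiddenWeights
  have hs := hD.measurable_sample
  rw [(indepFun_iff_map_prod_eq_prod_map_map (hm.prodMk hs).aemeasurable
    hT.measurable.aemeasurable).1 hT.indep.symm,
    (indepFun_iff_map_prod_eq_prod_map_map hm.aemeasurable hs.aemeasurable).1 hD.indep_weights,
    hD.map_sample, hT.law]

/-- Mean square prediction error of the constrained least squares estimator, when the target has a
representation by a tame weight whose sampled output weights satisfy the constraint. -/
lemma IsConstrainedLeastSquares.lintegral_sq_le [IsProbabilityMeasure P] [NeZero n] [NeZero N]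
    {D : Fin n → Ω → EuclideanSpace ℝ (Fin d) × ℝ} {T : Ω → EuclideanSpace ℝ (Fin d) × ℝ}
    {What : Ω → EuclideanSpace ℝ (Fin N)} {H : EuclideanSpace ℝ (Fin d) → ℝ}
    {h : EuclideanSpace ℝ (Fin d) × ℝ → ℝ}
    (hW : IsConstrainedLeastSquares P A b D lam What) (hd : 1 ≤ d) (hν : 2 < ν) (hM : 0 ≤ M)
    (hlam : 0 < lam) (hAB : IsHiddenWeights P ν πb A b)
    (hD : IsSample P A b D) (hT : IsTestPair P A b D T)
    (hμ : IsRegressionLaw M (P.map (D 0)) H) (hh : IsTameWeight M B h)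
    (hB : B / Real.sqrt N ≤ lam)
    (hH : ∀ x ∈ cube d M, H x = ∫ z, h z * relu (inner ℝ z.1 x + z.2) ∂weightLaw d ν πb) :
    ∫⁻ ω, ENNReal.ofReal ((H (T ω).1 -
        network (fun i => A i ω) (fun i => b i ω) (What ω) (T ω).1) ^ 2) ∂P
      ≤ ENNReal.ofReal (((2 * M + 1) * B) ^ 2 / N) + ENNReal.ofReal (13 *
        (lam ^ 2 * M ^ 2 * d ^ 2 * N * (ν ^ 2 / (ν - 2)) + 1 + ∫ ω, (D 0 ω).2 ^ 4 ∂P)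
          / Real.sqrt n) := by
  have hn : 1 ≤ n := Nat.one_le_iff_ne_zero.2 (NeZero.ne n)
  have hN : 1 ≤ N := Nat.one_le_iff_ne_zero.2 (NeZero.ne N)
  have hν2 : 0 < ν - 2 := by linarith
  have hm := hAB.measurable_hiddenWeights
  have hs := hD.measurable_sample
  have hq := hm.prodMk hs
  have hHm := hμ.continuous.measurable
  have hprob := hAB.isProbabilityMeasure_studentMeasure
  have hprob' := hAB.isProbabilityMeasure_bias
  have hprobw : IsProbabilityMeasure (weightLaw d ν πb) := by unfold weightLaw; infer_instance
  have hprobμ : IsProbabilityMeasure (P.map (D 0)) :=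
    Measure.isProbabilityMeasure_map (hD.measurable 0).aemeasurable
  have hprobα : IsProbabilityMeasure (P.map (hiddenWeights A b)) :=
    Measure.isProbabilityMeasure_map hm.aemeasurable
  set μ := P.map (D 0) with hμdef
  set α := P.map (hiddenWeights A b) with hα
  have hjoint := map_weights_sample_test hAB hD hT
  have hpairlaw : P.map (fun ω => (hiddenWeights A b ω, sample D ω))
      = α.prod (Measure.pi fun _ => μ) := by
    rw [(indepFun_iff_map_prod_eq_prod_map_map hm.aemeasurable hs.aemeasurable).1
      hD.indep_weights, hD.map_sample]
  -- the comparison weights and the estimator as functions of the hidden weights and the sample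
  let ws : (Fin N → EuclideanSpace ℝ (Fin d)) × (Fin N → ℝ) → EuclideanSpace ℝ (Fin N) :=
    fun q => sampledWeights h fun i => (q.1 i, q.2 i)
  have hws : Measurable ws := (measurable_sampledWeights hh.measurable).comp measurable_pairs
  obtain ⟨⟨hWm, hWlam⟩, hWmin⟩ := hW
  obtain ⟨wh, hwh, rfl⟩ := hWm.exists_eq_measurable_comp
  have h0 := hWmin (fun _ => 0) ⟨measurable_const, ae_of_all _ fun _ => by simpa using hlam.le⟩
  have h1 := hWmin (fun ω => ws (hiddenWeights A b ω))
    ⟨(hws.comp measurable_fst).comp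
      (comap_measurable fun ω => (hiddenWeights A b ω, sample D ω)),
      ae_of_all _ fun ω => (hh.norm_sampledWeights_le hd hN _).trans hB⟩
  have hae : ∀ᵐ q ∂α.prod (Measure.pi fun _ : Fin n => μ), ‖wh q‖ ≤ lam ∧
      empiricalRisk q.2 (network q.1.1 q.1.2 (wh q)) ≤ empiricalRisk q.2 (network q.1.1 q.1.2 0) ∧
      empiricalRisk q.2 (network q.1.1 q.1.2 (wh q))
        ≤ empiricalRisk q.2 (network q.1.1 q.1.2 (ws q.1)) := by
    rw [← hpairlaw, ae_map_iff hq.aemeasurable]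
    · filter_upwards [hWlam, h0, h1] with ω e1 e2 e3 using ⟨e1, e2, e3⟩
    · have r1 := measurable_empiricalRisk_network (n := n)
        (measurable_fst (α := (Fin N → EuclideanSpace ℝ (Fin d)) × (Fin N → ℝ))
          (β := Fin n → EuclideanSpace ℝ (Fin d) × ℝ)) measurable_snd hwh
      have r2 := measurable_empiricalRisk_network (n := n)
        (measurable_fst (α := (Fin N → EuclideanSpace ℝ (Fin d)) × (Fin N → ℝ))
          (β := Fin n → EuclideanSpace ℝ (Fin d) × ℝ)) measurable_snd
        (measurable_const (a := (0 : EuclideanSpace ℝ (Fin N))))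
      have r3 := measurable_empiricalRisk_network (n := n)
        (measurable_fst (α := (Fin N → EuclideanSpace ℝ (Fin d)) × (Fin N → ℝ))
          (β := Fin n → EuclideanSpace ℝ (Fin d) × ℝ)) measurable_snd (hws.comp measurable_fst)
      exact (measurableSet_le hwh.norm measurable_const).inter
        ((measurableSet_le r1 r2).inter (measurableSet_le r1 r3))
  have hae' := Measure.ae_ae_of_ae_prod hae
  let F : ((((Fin N → EuclideanSpace ℝ (Fin d)) × (Fin N → ℝ)) ×
      (Fin n → EuclideanSpace ℝ (Fin d) × ℝ)) × (EuclideanSpace ℝ (Fin d) × ℝ)) → ℝ≥0∞ :=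
    fun q => ENNReal.ofReal ((H q.2.1 - network q.1.1.1 q.1.1.2 (wh q.1) q.2.1) ^ 2)
  have hF : Measurable F := by
    have := measurable_network.comp ((measurable_fst.comp measurable_fst).prodMk
      ((hwh.comp measurable_fst).prodMk (measurable_fst.comp measurable_snd)) :
      Measurable fun q : ((((Fin N → EuclideanSpace ℝ (Fin d)) × (Fin N → ℝ)) ×
        (Fin n → EuclideanSpace ℝ (Fin d) × ℝ)) × (EuclideanSpace ℝ (Fin d) × ℝ)) =>
        (q.1.1, wh q.1, q.2.1))
    exact (((hHm.comp (measurable_fst.comp measurable_snd)).sub this).pow_const 2).ennreal_ofReal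
  let G : (((Fin N → EuclideanSpace ℝ (Fin d)) × (Fin N → ℝ)) ×
      (EuclideanSpace ℝ (Fin d) × ℝ)) → ℝ≥0∞ :=
    fun q => ENNReal.ofReal ((H q.2.1 - network q.1.1 q.1.2 (ws q.1) q.2.1) ^ 2)
  have hG : Measurable G := by
    have := measurable_network.comp (measurable_fst.prodMk
      ((hws.comp measurable_fst).prodMk (measurable_fst.comp measurable_snd)) :
      Measurable fun q : ((Fin N → EuclideanSpace ℝ (Fin d)) × (Fin N → ℝ)) ×
        (EuclideanSpace ℝ (Fin d) × ℝ) => (q.1, ws q.1, q.2.1))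
    exact (((hHm.comp (measurable_fst.comp measurable_snd)).sub this).pow_const 2).ennreal_ofReal
  have hm₄ : ∫ z, z.2 ^ 4 ∂μ = ∫ ω, (D 0 ω).2 ^ 4 ∂P :=
    integral_map (hD.measurable 0).aemeasurable (Measurable.aestronglyMeasurable (by fun_prop))
  have hm₄0 : 0 ≤ ∫ ω, (D 0 ω).2 ^ 4 ∂P := integral_nonneg fun ω => by positivity
  -- mean square error of the comparison network
  have happ : ∫⁻ a, ∫⁻ z, G (a, z) ∂μ ∂α ≤ ENNReal.ofReal (((2 * M + 1) * B) ^ 2 / N) := by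
    rw [lintegral_lintegral_swap hG.aemeasurable]
    calc ∫⁻ z, ∫⁻ a, G (a, z) ∂α ∂μ
        ≤ ∫⁻ _z, ENNReal.ofReal (((2 * M + 1) * B) ^ 2 / N) ∂μ := by
          refine lintegral_mono_ae ?_
          filter_upwards [hμ.mem_cube] with z hz
          have hGz : Measurable fun a => G (a, z) := hG.comp measurable_prodMk_right
          refine le_trans (le_of_eq ?_)
            (hh.lintegral_sq_sub_le hd hM hN (weightLaw d ν πb) hz (hH _ hz))
          have hpm := measurable_pairs.comp hm
          rw [← hAB.map_pair, hα, lintegral_map hGz hm]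
          refine Eq.trans ?_ (lintegral_map ?_ hpm).symm
          · rfl
          · have : Measurable fun p : Fin N → EuclideanSpace ℝ (Fin d) × ℝ =>
                (((fun i => (p i).1, fun i => (p i).2) :
                  (Fin N → EuclideanSpace ℝ (Fin d)) × (Fin N → ℝ)), z) := by fun_prop
            exact hG.comp this
      _ = _ := by simp
  have hsize : ∫⁻ a, ENNReal.ofReal (13 * (sizeSq a.1 M lam + 1 + ∫ z, z.2 ^ 4 ∂μ)
      / Real.sqrt n) ∂α ≤ ENNReal.ofReal (13 *
        (lam ^ 2 * M ^ 2 * d ^ 2 * N * (ν ^ 2 / (ν - 2)) + 1 + ∫ ω, (D 0 ω).2 ^ 4 ∂P)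
          / Real.sqrt n) := by
    have hsm : Measurable fun a : (Fin N → EuclideanSpace ℝ (Fin d)) × (Fin N → ℝ) =>
        sizeSq a.1 M lam := by unfold sizeSq; fun_prop
    have hsplit : ∀ a : (Fin N → EuclideanSpace ℝ (Fin d)) × (Fin N → ℝ),
        ENNReal.ofReal (13 * (sizeSq a.1 M lam + 1 + ∫ z, z.2 ^ 4 ∂μ) / Real.sqrt n)
        = ENNReal.ofReal (13 / Real.sqrt n) * (ENNReal.ofReal (sizeSq a.1 M lam)
          + ENNReal.ofReal (1 + ∫ ω, (D 0 ω).2 ^ 4 ∂P)) := by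
      intro a
      rw [← ENNReal.ofReal_add (sizeSq_nonneg _) (by positivity),
        ← ENNReal.ofReal_mul (by positivity), hm₄]
      congr 1; ring
    simp_rw [hsplit]
    rw [lintegral_const_mul _ (hsm.ennreal_ofReal.add_const _),
      lintegral_add_right _ measurable_const, lintegral_const, measure_univ, mul_one, hα,
      lintegral_map hsm.ennreal_ofReal hm]
    calc _ ≤ ENNReal.ofReal (13 / Real.sqrt n) *
          (ENNReal.ofReal (lam ^ 2 * M ^ 2 * d ^ 2 * N * (ν ^ 2 / (ν - 2)))
            + ENNReal.ofReal (1 + ∫ ω, (D 0 ω).2 ^ 4 ∂P)) := by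
          gcongr
          exact hAB.lintegral_sizeSq_le hd hν M lam
      _ = _ := by
          rw [← ENNReal.ofReal_add (by positivity) (by positivity),
            ← ENNReal.ofReal_mul (by positivity)]
          congr 1; ring
  have hGi : Measurable fun a => ∫⁻ z, G (a, z) ∂μ := hG.lintegral_prod_right'
  calc ∫⁻ ω, F ((hiddenWeights A b ω, sample D ω), T ω) ∂P
      = ∫⁻ a, ∫⁻ s, ∫⁻ z, F ((a, s), z) ∂μ ∂(Measure.pi fun _ => μ) ∂α := by
        rw [← lintegral_map (f := F) hF (hq.prodMk hT.measurable), hjoint,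
          lintegral_prod _ hF.aemeasurable,
          lintegral_prod _ hF.lintegral_prod_right'.aemeasurable]
    _ ≤ ∫⁻ a, (∫⁻ z, G (a, z) ∂μ + ENNReal.ofReal (13 * (sizeSq a.1 M lam + 1 + ∫ z, z.2 ^ 4 ∂μ)
          / Real.sqrt n)) ∂α := by
        refine lintegral_mono_ae ?_
        filter_upwards [hae'] with a ha
        exact hμ.lintegral_excess_le a.1 a.2 hM hlam hn (ws a) (fun s => wh (a, s)) ha
    _ ≤ _ := by
        rw [lintegral_add_left hGi]
        exact add_le_add happ hsize

end PredictionError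

/-! ### Constants and rates -/

section Conclusion

/-- The sampled output weights approximate the target uniformly on the cube. -/
lemma IsTameWeight.exists_uniform_approximation {Ω : Type*} [MeasurableSpace Ω] {P : Measure Ω}
    [IsProbabilityMeasure P] {d N : ℕ} [NeZero N] {M B ν : ℝ} {πb : ℝ → ℝ}
    {A : Fin N → Ω → EuclideanSpace ℝ (Fin d)} {b : Fin N → Ω → ℝ}
    {h : EuclideanSpace ℝ (Fin d) × ℝ → ℝ} (hh : IsTameWeight M B h) (hd : 1 ≤ d) (hM : 0 ≤ M)
    (hAB : IsHiddenWeights P ν πb A b) {H : EuclideanSpace ℝ (Fin d) → ℝ} (hHc : Continuous H)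
    (hH : ∀ x ∈ cube d M, H x = ∫ z, h z * relu (inner ℝ z.1 x + z.2) ∂weightLaw d ν πb) :
    ∃ W : Ω → EuclideanSpace ℝ (Fin N), Measurable[sigmaWeights A b] W ∧
      ∫⁻ ω, ⨆ x ∈ cube d M, ENNReal.ofReal
        |network (fun i => A i ω) (fun i => b i ω) (W ω) x - H x| ∂P
        ≤ ENNReal.ofReal ((6 * M + 2) * B / Real.sqrt N) ∧
      ∀ i, eLpNorm (fun ω => W ω i) ∞ P ≤ ENNReal.ofReal (B / N) := by
  have hN : 1 ≤ N := Nat.one_le_iff_ne_zero.2 (NeZero.ne N)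
  have hm := hAB.measurable_hiddenWeights
  have hprob := hAB.isProbabilityMeasure_studentMeasure
  have hprob' := hAB.isProbabilityMeasure_bias
  have hprobw : IsProbabilityMeasure (weightLaw d ν πb) := by unfold weightLaw; infer_instance
  refine ⟨fun ω => sampledWeights h fun i => (A i ω, b i ω), ?_, ?_, fun i => ?_⟩
  · exact ((measurable_sampledWeights hh.measurable).comp measurable_pairs).comp
      (comap_measurable (hiddenWeights A b))
  · refine le_trans (le_of_eq ?_) (hh.lintegral_iSup_le hd hM hN (weightLaw d ν πb) hHc hH)
    have hrelu := continuous_relu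
    have hpm : Measurable fun ω i => (A i ω, b i ω) := measurable_pairs.comp hm
    rw [← hAB.map_pair, lintegral_map _ hpm]
    · rfl
    · refine measurable_iSup_cube (G := fun (z : Fin N → EuclideanSpace ℝ (Fin d) × ℝ) x =>
        ∑ i, h (z i) / N * relu (inner ℝ (z i).1 x + (z i).2) - H x) (fun x => ?_) (fun z => ?_) hM
      · refine (Finset.measurable_sum _ fun i _ => ?_).sub_const _
        have h1 := hh.measurable.comp (measurable_pi_apply (X := fun _ : Fin N =>
          EuclideanSpace ℝ (Fin d) × ℝ) i)
        have h2 : Measurable fun z : Fin N → EuclideanSpace ℝ (Fin d) × ℝ =>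
            relu (inner ℝ (z i).1 x + (z i).2) := Continuous.measurable (by fun_prop)
        exact (h1.div_const _).mul h2
      · fun_prop
  · rw [eLpNorm_exponent_top]
    refine eLpNormEssSup_le_of_ae_bound (ae_of_all _ fun ω => ?_)
    exact hh.abs_sampledWeights_le hd _ i

/-- The threshold on `C` gives `4π²C > √2 π`; only the weaker bound by `π` is needed. -/
lemma pi_lt_of_lt {C : ℝ} (hC : 1 / (2 ^ (3 / 2 : ℝ) * Real.pi) < C) :
    Real.pi < 4 * Real.pi ^ 2 * C := by
  have hpi := Real.pi_pos
  have h1 : (2 : ℝ) ^ (3 / 2 : ℝ) ≤ 4 := by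
    calc (2 : ℝ) ^ (3 / 2 : ℝ) ≤ 2 ^ (2 : ℝ) :=
          Real.rpow_le_rpow_of_exponent_le one_le_two (by norm_num)
      _ = 4 := by norm_num
  have h2 : 1 / (4 * Real.pi) ≤ 1 / (2 ^ (3 / 2 : ℝ) * Real.pi) := by gcongr
  calc Real.pi = 4 * Real.pi ^ 2 * (1 / (4 * Real.pi)) := by field_simp
    _ < 4 * Real.pi ^ 2 * C := by gcongr; linarith

/-- A mean square error `a² + q` is a root mean square error of at most `a + √q`; here `q` is the
estimation error under a weight constraint of order `d ^ p / √N`. -/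
lemma sqrt_risk_le {a Clam M v m₄ lam p : ℝ} {d N n : ℕ} (hd : 1 ≤ d) (hN : 1 ≤ N) (hn : 1 ≤ n)
    (ha : 0 ≤ a) (hv : 0 ≤ v) (hm₄ : 0 ≤ m₄) (hp : 0 ≤ p) (hlam : 0 < lam)
    (hle : lam ≤ Clam * (d : ℝ) ^ p / Real.sqrt N) :
    Real.sqrt (a ^ 2 / N + 13 * (lam ^ 2 * M ^ 2 * d ^ 2 * N * v + 1 + m₄) / Real.sqrt n)
      ≤ a / Real.sqrt N + Real.sqrt (13 * (Clam ^ 2 * M ^ 2 * v + 1 + m₄)) * (d : ℝ) ^ (p + 1) /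
        (n : ℝ) ^ (1 / 4 : ℝ) := by
  have hd1 : (1 : ℝ) ≤ d := by exact_mod_cast hd
  have hN' : (0 : ℝ) < N := by exact_mod_cast hN
  have hn' : (0 : ℝ) < n := by exact_mod_cast hn
  have hsN : 0 < Real.sqrt N := Real.sqrt_pos.2 hN'
  have hdp : 1 ≤ (d : ℝ) ^ (p + 1) := Real.one_le_rpow hd1 (by linarith)
  have hsz : lam ^ 2 * M ^ 2 * d ^ 2 * N * v + 1 + m₄
      ≤ (Clam ^ 2 * M ^ 2 * v + 1 + m₄) * ((d : ℝ) ^ (p + 1)) ^ 2 := by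
    have h1 : lam ^ 2 * N ≤ (Clam * (d : ℝ) ^ p) ^ 2 := by
      have h2 : lam * Real.sqrt N ≤ Clam * (d : ℝ) ^ p := (le_div_iff₀ hsN).1 hle
      calc lam ^ 2 * N = (lam * Real.sqrt N) ^ 2 := by rw [mul_pow, Real.sq_sqrt hN'.le]
        _ ≤ _ := by gcongr
    have h3 : (d : ℝ) ^ (p + 1) = (d : ℝ) ^ p * d := Real.rpow_add_one (by linarith) p
    have h4 : 1 ≤ ((d : ℝ) ^ (p + 1)) ^ 2 := one_le_pow₀ hdp
    calc lam ^ 2 * M ^ 2 * d ^ 2 * N * v + 1 + m₄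
        = (lam ^ 2 * N) * (M ^ 2 * d ^ 2 * v) + (1 + m₄) * 1 := by ring
      _ ≤ (Clam * (d : ℝ) ^ p) ^ 2 * (M ^ 2 * d ^ 2 * v)
          + (1 + m₄) * ((d : ℝ) ^ (p + 1)) ^ 2 := by gcongr
      _ = _ := by rw [h3]; ring
  have hn4 : ((n : ℝ) ^ (1 / 4 : ℝ)) ^ 2 = Real.sqrt n := by
    rw [← Real.rpow_natCast, ← Real.rpow_mul hn'.le, Real.sqrt_eq_rpow]
    norm_num
  have hc : 0 ≤ 13 * (Clam ^ 2 * M ^ 2 * v + 1 + m₄) := by positivity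
  rw [Real.sqrt_le_left (by positivity)]
  set r := Real.sqrt (13 * (Clam ^ 2 * M ^ 2 * v + 1 + m₄)) with hr
  set t := (n : ℝ) ^ (1 / 4 : ℝ) with ht
  have e1 : (a / Real.sqrt N) ^ 2 = a ^ 2 / N := by rw [div_pow, Real.sq_sqrt hN'.le]
  have e2 : 13 * (lam ^ 2 * M ^ 2 * d ^ 2 * N * v + 1 + m₄) / Real.sqrt n
      ≤ (r * (d : ℝ) ^ (p + 1) / t) ^ 2 := by
    rw [div_pow, mul_pow, hn4, hr, Real.sq_sqrt hc, mul_assoc 13]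
    gcongr
  have e3 : 0 ≤ (a / Real.sqrt N) * (r * (d : ℝ) ^ (p + 1) / t) := by positivity
  nlinarith

end Conclusion

end RandomFeatures


end

theorem mainTheorem6 (πb : ℝ → ℝ) (hπb : RandomFeatures.PolynomialDecay πb) :
    -- `k` depends only on `πb`; `Capp` and `Cwgt` only on `πb, ν, C, M`;
    -- `Cest` only on `πb, ν, Clam, M` and the fourth moment of the response
    ∃ (k : ℕ) (Capp Cwgt : ℝ → ℝ → ℝ → ℝ) (Cest : ℝ → ℝ → ℝ → ℝ → ℝ),
      ∀ ν C M : ℝ, 2 < ν → 1 / (2 ^ (3 / 2 : ℝ) * Real.pi) < C → 0 < M →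
        0 < Capp ν C M ∧ 0 < Cwgt ν C M ∧
        (∀ Clam m₄ : ℝ, 0 < Clam → 0 ≤ m₄ → 0 < Cest ν Clam M m₄) ∧
        ∀ (d N : ℕ) [NeZero d] [NeZero N]
          (Ω : Type*) [MeasurableSpace Ω] (P : Measure Ω) [IsProbabilityMeasure P]
          (A : Fin N → Ω → EuclideanSpace ℝ (Fin d)) (B : Fin N → Ω → ℝ)
          (Φ : EuclideanSpace ℝ (Fin d) → ℝ) (V : Ω → EuclideanSpace ℝ (Fin d))
          (H : EuclideanSpace ℝ (Fin d) → ℝ),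
          RandomFeatures.IsHiddenWeights P ν πb A B →
          RandomFeatures.IsConvolutional P C Φ V H →
          -- the constants are constants of the uniform approximation result
          (∃ W : Ω → EuclideanSpace ℝ (Fin N),
            Measurable[RandomFeatures.sigmaWeights A B] W ∧
            ∫⁻ ω, ⨆ x ∈ RandomFeatures.cube d M, ENNReal.ofReal
                |RandomFeatures.network (fun i => A i ω) (fun i => B i ω) (W ω) x - H x| ∂P
              ≤ ENNReal.ofReal
                  (Capp ν C M * (∫ x, |Φ x|) * (ν + d) ^ (k + 3) / Real.sqrt N) ∧
            ∀ i, eLpNorm (fun ω => W ω i) ∞ P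
              ≤ ENNReal.ofReal
                  (Cwgt ν C M * (∫ x, |Φ x|) * (ν + d) ^ (2 * (k : ℝ) + 1 / 2) / N)) ∧
          -- the prediction error of constrained regression
          (∀ (n : ℕ) [NeZero n] (D : Fin n → Ω → EuclideanSpace ℝ (Fin d) × ℝ)
            (T : Ω → EuclideanSpace ℝ (Fin d) × ℝ)
            (Clam p lam : ℝ) (What : Ω → EuclideanSpace ℝ (Fin N)),
            RandomFeatures.IsSample P A B D →
            RandomFeatures.IsTestPair P A B D T →
            RandomFeatures.IsRegressionFunction P (D 0) H →
            (∀ᵐ ω ∂P, (D 0 ω).1 ∈ RandomFeatures.cube d M) →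
            MemLp (fun ω => (D 0 ω).2) 4 P →
            0 < Clam → 0 ≤ p → 0 < lam →
            Cwgt ν C M * (∫ x, |Φ x|) * (ν + d) ^ (2 * (k : ℝ) + 1 / 2) / Real.sqrt N ≤ lam →
            lam ≤ Clam * (d : ℝ) ^ p / Real.sqrt N →
            RandomFeatures.IsConstrainedLeastSquares P A B D lam What →
            eLpNorm (fun ω => H (T ω).1 -
                RandomFeatures.network (fun i => A i ω) (fun i => B i ω) (What ω) (T ω).1) 2 P
              ≤ ENNReal.ofReal
                  (Capp ν C M * (∫ x, |Φ x|) * (ν + d) ^ (k + 3) / Real.sqrt N +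
                    Cest ν Clam M (∫ ω, (D 0 ω).2 ^ 4 ∂P) * (d : ℝ) ^ (p + 1) /
                      (n : ℝ) ^ (1 / 4 : ℝ))) := by
  have hconst := fun (ν C M : ℝ) (hν : 2 < ν) (hC : 1 / (2 ^ (3 / 2 : ℝ) * Real.pi) < C)
    (hM : 0 < M) => RandomFeatures.exists_tameWeight_constant hπb (ν := ν) (by linarith)
      (RandomFeatures.pi_lt_of_lt hC) hM
  choose! K hK0 hK using hconst
  -- the constant of the representation does not depend on the dimension, so `k = 0` suffices
  refine ⟨0, fun ν C M => (6 * M + 2) * K ν C M, K, fun ν Clam M m₄ =>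
    Real.sqrt (13 * (Clam ^ 2 * M ^ 2 * (ν ^ 2 / (ν - 2)) + 1 + m₄)), ?_⟩
  intro ν C M hν hC hM
  have hKpos := hK0 ν C M hν hC hM
  have hν2 : 0 < ν - 2 := by linarith
  refine ⟨by positivity, hKpos, fun Clam m₄ _ hm₄ => by positivity, ?_⟩
  intro d N _ _ Ω _ P _ A B Φ V H hAB hconv
  have hd : 1 ≤ d := Nat.one_le_iff_ne_zero.2 (NeZero.ne d)
  have hN : 1 ≤ N := Nat.one_le_iff_ne_zero.2 (NeZero.ne N)
  obtain ⟨hHc, hHb, h, hh, hH⟩ := hK ν C M hν hC hM d hd hAB.isProbabilityMeasure_studentMeasure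
    hAB.isProbabilityMeasure_bias Ω P Φ V H hconv
  have hS : 0 ≤ ∫ x, |Φ x| := integral_nonneg fun x => abs_nonneg _
  set S := ∫ x, |Φ x| with hSdef
  have hKS : 0 ≤ K ν C M * S := by positivity
  have hν1 : 1 ≤ ν + d := by
    have : (0 : ℝ) ≤ d := Nat.cast_nonneg d
    linarith
  have hpow : 1 ≤ (ν + d) ^ (0 + 3) := one_le_pow₀ hν1
  have hrpow : 1 ≤ (ν + d) ^ (2 * ((0 : ℕ) : ℝ) + 1 / 2) :=
    Real.one_le_rpow hν1 (by norm_num)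
  have happ : (6 * M + 2) * (K ν C M * S)
      ≤ (6 * M + 2) * K ν C M * S * (ν + d) ^ (0 + 3) := by
    rw [mul_assoc (6 * M + 2)]
    exact le_mul_of_one_le_right (by positivity) hpow
  have hwgt : K ν C M * S ≤ K ν C M * S * (ν + d) ^ (2 * ((0 : ℕ) : ℝ) + 1 / 2) :=
    le_mul_of_one_le_right hKS hrpow
  constructor
  · obtain ⟨W, hWm, hW1, hW2⟩ := hh.exists_uniform_approximation hd hM.le hAB hHc hH
    refine ⟨W, hWm, hW1.trans (ENNReal.ofReal_le_ofReal ?_),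
      fun i => (hW2 i).trans (ENNReal.ofReal_le_ofReal ?_)⟩
    · exact div_le_div_of_nonneg_right happ (Real.sqrt_nonneg _)
    · exact div_le_div_of_nonneg_right hwgt (Nat.cast_nonneg _)
  · intro n _ D T Clam p lam What hD hT hreg hcube hY hClam hp hlam hlow hup hWhat
    have hn : 1 ≤ n := Nat.one_le_iff_ne_zero.2 (NeZero.ne n)
    have hμ := RandomFeatures.isRegressionLaw_map (hD.measurable 0) hreg hHc hHb hcube hY
    have hB : K ν C M * S / Real.sqrt N ≤ lam :=
      (div_le_div_of_nonneg_right hwgt (Real.sqrt_nonneg _)).trans hlow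
    have hm₄ : 0 ≤ ∫ ω, (D 0 ω).2 ^ 4 ∂P := integral_nonneg fun ω => by positivity
    have hmse := hWhat.lintegral_sq_le hd hν hM.le hlam hAB hD hT hμ hh hB hH
    rw [← ENNReal.ofReal_add (by positivity) (by positivity)] at hmse
    have hsqrt := RandomFeatures.sqrt_risk_le (a := (2 * M + 1) * (K ν C M * S)) (M := M)
      (v := ν ^ 2 / (ν - 2)) hd hN hn (by positivity) (by positivity) hm₄ hp hlam hup
    have happ' : (2 * M + 1) * (K ν C M * S) / Real.sqrt N
        ≤ (6 * M + 2) * K ν C M * S * (ν + d) ^ (0 + 3) / Real.sqrt N := by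
      refine div_le_div_of_nonneg_right (le_trans ?_ happ) (Real.sqrt_nonneg _)
      exact mul_le_mul_of_nonneg_right (by linarith) hKS
    have hnorm : eLpNorm (fun ω => H (T ω).1 -
        RandomFeatures.network (fun i => A i ω) (fun i => B i ω) (What ω) (T ω).1) 2 P
        = (∫⁻ ω, ENNReal.ofReal ((H (T ω).1 - RandomFeatures.network (fun i => A i ω)
          (fun i => B i ω) (What ω) (T ω).1) ^ 2) ∂P) ^ (1 / 2 : ℝ) := by
      rw [eLpNorm_eq_lintegral_rpow_enorm_toReal (by norm_num) (by norm_num)]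
      simp only [ENNReal.toReal_ofNat]
      congr 1
      refine lintegral_congr fun ω => ?_
      rw [← ofReal_norm, ENNReal.ofReal_rpow_of_nonneg (norm_nonneg _) (by norm_num),
        Real.norm_eq_abs]
      congr 1
      rw [Real.rpow_two, sq_abs]
    rw [hnorm]
    calc _ ≤ ENNReal.ofReal _ ^ (1 / 2 : ℝ) := ENNReal.rpow_le_rpow hmse (by norm_num)
      _ = ENNReal.ofReal (Real.sqrt _) := by
          rw [ENNReal.ofReal_rpow_of_nonneg (by positivity) (by norm_num), ← Real.sqrt_eq_rpow]
      _ ≤ _ := ENNReal.ofReal_le_ofReal (hsqrt.trans (add_le_add_left happ' _))
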